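/- Let $G$ be a locally compact (Hausdorff) group and let $\alpha:G\to\operatorname{Aut}A$ be a strongly continuous action on a $C^*$-algebra $A$. Let $N$ and $K$ be closed subgroups of $G$ with $N\subset K$ and $N$ normal in $G$. Fix left Haar measures on $G$ and $N$, with modular functions $\Delta_G$, $\Delta_N$ normalised by $\Delta_G(s)\int_G f(rs)\,dr=\int_G f(r)\,dr$. A *covariant representation* of a system $(B,L,\gamma)$ on a Hilbert space consists of a nondegenerate $*$-representation $\pi$ of $B$ and a strongly continuous unitary representation $U$ of $L$ on that space with $\pi(\gamma_l(b))=U_l\pi(b)U_l^*$; for $L$ locally compact, $\pi\rtimes U$ denotes its integrated form, $(\pi\rtimes U)(f)=\int_L\pi(f(l))U_l\,dl$ for $f\in C_c(L,B)$, a representation of the full crossed product $B\rtimes_\gamma L$. Identify $A\otimes C_0(G/N)$ with $C_0(G/N,A)$. Let $G$ act on it by $(\alpha\otimes\mathrm{lt})_s(f)(rN)=\alpha_s(f(s^{-1}rN))$, and let $G/N$ act on it by $(\mathrm{id}\otimes\mathrm{rt})_{tN}(f)(sN)=f(stN)$. These actions commute, so $\mathrm{id}\otimes\mathrm{rt}$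 induces an action $\beta$ of $G/N$ on $(A\otimes C_0(G/N))\rtimes_{\alpha\otimes\mathrm{lt}}G$, given by $\beta_{tN}(z)(r)=(\mathrm{id}\otimes\mathrm{rt})_{tN}(z(r))$ for $z\in C_c(G,C_0(G/N,A))$; restrict it to $K/N$. Let $X_N^G$ be Green's right-Hilbert bimodule, the completion of $C_c(G,A)$ in the $C_c(N,A)\subset A\rtimes_\alpha N$-valued inner product $$\langle x,y\rangle(n)=\Delta_N(n)^{-1/2}\int_G\alpha_t\big(x(t^{-1})^*y(t^{-1}n)\big)\,dt,$$ with the left action of $(A\otimes C_0(G/N))\rtimes_{\alpha\otimes\mathrm{lt}}G$ given for $z\in C_c(G\times G/N,A)$ and $x\in C_c(G,A)$ by $$(z\cdot x)(s)=\int_G z(t,sN)\,\alpha_t(x(t^{-1}s))\,\Delta_G(t)^{1/2}\,dt.$$ For a covariant representation $(\pi,U)$ of $(A,N,\alpha)$ on a Hilbert space $\mathcal H$, let $X_N^G\otimes_{A\rtimes_\alpha N}\mathcal H$ be the Hilbert space completion of the algebraic tensor product $C_c(G,A)\odot\mathcal H$ in the (semi-)inner product determined, with inner products of Hilbert spaces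 linear in the second variable, by $(x\otimes h\mid y\otimes k)=\big(h\mid(\pi\rtimes U)(\langle x,y\rangle)k\big)$, and let $X_N^G\text{-}\mathrm{Ind}(\pi\rtimes U)$ be the representation of $(A\otimes C_0(G/N))\rtimes_{\alpha\otimes\mathrm{lt}}G$ on it given by $z\mapsto(x\otimes h\mapsto (z\cdot x)\otimes h)$. **Theorem.** Let $(\pi,U)$ be a covariant representation of $(A,N,\alpha)$ on a Hilbert space $\mathcal H$. Then there exists a covariant representation $(\pi,V)$ of $(A,K,\alpha)$ on $\mathcal H$ with $V|_N=U$ if and only if there exists a strongly continuous unitary representation $T$ of $K/N$ on $X_N^G\otimes_{A\rtimes_\alpha N}\mathcal H$ such that $(X_N^G\text{-}\mathrm{Ind}(\pi\rtimes U),T)$ is a covariant representation of $\big((A\otimes C_0(G/N))\rtimes_{\alpha\otimes\mathrm{lt}}G,\;K/N,\;\beta\big)$. -/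

import Mathlib

open MeasureTheory Topology
open scoped ENNReal NNReal TensorProduct CompactlySupported ZeroAtInfty

universe u

namespace CDyn

noncomputable section

section Covariant

/-- An action `α : G → Aut B` is (strongly) continuous if each orbit map `s ↦ α_s(b)` is
norm continuous. -/
def IsContinuousAction {G B : Type*} [Group G] [TopologicalSpace G] [NonUnitalCStarAlgebra B]
    (α : G →* (B ≃⋆ₐ[ℂ] B)) : Prop :=
  ∀ b : B, Continuous fun s : G => α s b

/-- `(π, U)` is a covariant representation of `(B, G, γ)` on the Hilbert space `H`: `π` is a
nondegenerate `*`-representation, `U` is a strongly continuous unitary representation, and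
`π (γ_s b) = U_s π(b) U_s^*`. -/
structure IsCovariant {G B H : Type*} [Group G] [TopologicalSpace G] [NonUnitalCStarAlgebra B]
    [NormedAddCommGroup H] [InnerProductSpace ℂ H] [CompleteSpace H]
    (γ : G →* (B ≃⋆ₐ[ℂ] B)) (π : B →⋆ₙₐ[ℂ] (H →L[ℂ] H)) (U : G →* unitary (H →L[ℂ] H)) :
    Prop where
  nondegenerate :
    (Submodule.span ℂ {v : H | ∃ (b : B) (h : H), π b h = v}).topologicalClosure = ⊤
  continuous : ∀ h : H, Continuous fun s : G => (U s : H →L[ℂ] H) h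
  covariant : ∀ (s : G) (b : B),
    π (γ s b) = (U s : H →L[ℂ] H) * π b * star (U s : H →L[ℂ] H)

/-- A covariant representation of `(B, G, γ)`, bundled together with its Hilbert space. -/
structure CovRep {G B : Type u} [Group G] [TopologicalSpace G] [NonUnitalCStarAlgebra B]
    (γ : G →* (B ≃⋆ₐ[ℂ] B)) : Type (u + 1) where
  H : Type u
  [normedAddCommGroup : NormedAddCommGroup H]
  [innerProductSpace : InnerProductSpace ℂ H]
  [completeSpace : CompleteSpace H]
  π : B →⋆ₙₐ[ℂ] (H →L[ℂ] H)
  U : G →* unitary (H →L[ℂ] H)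
  isCovariant : IsCovariant γ π U

attribute [instance] CovRep.normedAddCommGroup CovRep.innerProductSpace CovRep.completeSpace

lemma norm_unitary_apply {H : Type*} [NormedAddCommGroup H] [InnerProductSpace ℂ H]
    [CompleteSpace H] (u : unitary (H →L[ℂ] H)) (h : H) : ‖(u : H →L[ℂ] H) h‖ = ‖h‖ :=
  Unitary.norm_map u h

variable {G B : Type u} [Group G] [TopologicalSpace G] [NonUnitalCStarAlgebra B]
  {γ : G →* (B ≃⋆ₐ[ℂ] B)}

lemma CovRep.norm_π_le (σ : CovRep γ) (b : B) : ‖σ.π b‖ ≤ ‖b‖ :=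
  NonUnitalStarAlgHom.norm_apply_le σ.π b

lemma CovRep.continuous_π (σ : CovRep γ) : Continuous σ.π :=
  AddMonoidHomClass.continuous_of_bound σ.π 1 (fun b => by simpa using σ.norm_π_le b)

lemma CovRep.continuous_U (σ : CovRep γ) :
    Continuous fun p : G × σ.H => (σ.U p.1 : σ.H →L[ℂ] σ.H) p.2 := by
  rw [continuous_iff_continuousAt]
  rintro ⟨s, h⟩
  rw [ContinuousAt, tendsto_iff_norm_sub_tendsto_zero]
  have h1 : Filter.Tendsto (fun p : G × σ.H => ‖p.2 - h‖ +
      ‖(σ.U p.1 : σ.H →L[ℂ] σ.H) h - (σ.U s : σ.H →L[ℂ] σ.H) h‖) (𝓝 (s, h)) (𝓝 0) := by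
    have c : Continuous (fun p : G × σ.H => ‖p.2 - h‖ +
      ‖(σ.U p.1 : σ.H →L[ℂ] σ.H) h - (σ.U s : σ.H →L[ℂ] σ.H) h‖) := by
      have := (σ.isCovariant.continuous h).comp (continuous_fst : Continuous (Prod.fst : G × σ.H → G))
      simp only [Function.comp_def] at this
      fun_prop
    simpa using c.tendsto (s, h)
  refine squeeze_zero (fun _ => norm_nonneg _) (fun p => ?_) h1
  calc ‖(σ.U p.1 : σ.H →L[ℂ] σ.H) p.2 - (σ.U s : σ.H →L[ℂ] σ.H) h‖
      = ‖(σ.U p.1 : σ.H →L[ℂ] σ.H) (p.2 - h) +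
          ((σ.U p.1 : σ.H →L[ℂ] σ.H) h - (σ.U s : σ.H →L[ℂ] σ.H) h)‖ := by
        rw [map_sub]; abel_nf
    _ ≤ _ := by
        refine (norm_add_le _ _).trans ?_
        rw [norm_unitary_apply]

lemma CovRep.U_π (σ : CovRep γ) (s : G) (b : B) (h : σ.H) :
    (σ.U s : σ.H →L[ℂ] σ.H) (σ.π b h) = σ.π (γ s b) ((σ.U s : σ.H →L[ℂ] σ.H) h) := by
  rw [σ.isCovariant.covariant s b]
  have : star (σ.U s : σ.H →L[ℂ] σ.H) ((σ.U s : σ.H →L[ℂ] σ.H) h) = h := by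
    have := Unitary.coe_star_mul_self (σ.U s)
    exact congrArg (fun T : σ.H →L[ℂ] σ.H => T h) this
  simp only [mul_apply_eq_comp, this]

lemma CovRep.inner_U (σ : CovRep γ) (s : G) (h k : σ.H) :
    inner ℂ ((σ.U s : σ.H →L[ℂ] σ.H) h) ((σ.U s : σ.H →L[ℂ] σ.H) k) = inner ℂ h k :=
  Unitary.inner_map_map (σ.U s) h k

lemma CovRep.U_mul (σ : CovRep γ) (s t : G) (h : σ.H) :
    (σ.U (s * t) : σ.H →L[ℂ] σ.H) h = (σ.U s : σ.H →L[ℂ] σ.H) ((σ.U t : σ.H →L[ℂ] σ.H) h) := by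
  rw [map_mul]; rfl

lemma CovRep.U_one (σ : CovRep γ) (h : σ.H) : (σ.U 1 : σ.H →L[ℂ] σ.H) h = h := by
  rw [map_one]; rfl

lemma CovRep.inner_π (σ : CovRep γ) (b : B) (h k : σ.H) :
    inner ℂ (σ.π b h) k = inner ℂ h (σ.π (star b) k) := by
  rw [map_star, ContinuousLinearMap.star_eq_adjoint, ContinuousLinearMap.adjoint_inner_right]

/-- If `θ` is an automorphism of `B` commuting with the action `γ`, then `(π ∘ θ, U)` is a covariant
representation whenever `(π, U)` is. -/
def CovRep.twist (σ : CovRep γ) (θ : B ≃⋆ₐ[ℂ] B) (hθ : ∀ s b, θ (γ s b) = γ s (θ b)) :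
    CovRep γ where
  H := σ.H
  π := σ.π.comp (θ : B →⋆ₙₐ[ℂ] B)
  U := σ.U
  isCovariant :=
    { nondegenerate := by
        have h := σ.isCovariant.nondegenerate
        have e : {v : σ.H | ∃ (b : B) (h : σ.H), (σ.π.comp (θ : B →⋆ₙₐ[ℂ] B)) b h = v}
            = {v : σ.H | ∃ (b : B) (h : σ.H), σ.π b h = v} := by
          ext v
          constructor
          · rintro ⟨b, h, rfl⟩
            exact ⟨θ b, h, rfl⟩
          · rintro ⟨b, h, rfl⟩
            exact ⟨θ.symm b, h, by
              change σ.π (θ (θ.symm b)) h = _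
              rw [StarAlgEquiv.apply_symm_apply]⟩
        rw [e, h]
      continuous := σ.isCovariant.continuous
      covariant := fun s b => by
        change σ.π (θ (γ s b)) = _ * σ.π (θ b) * _
        rw [hθ, σ.isCovariant.covariant] }

end Covariant

section CrossedProduct

variable {G B : Type u} [Group G] [TopologicalSpace G]
  [MeasurableSpace G] [BorelSpace G] [NonUnitalCStarAlgebra B]
  (γ : G →* (B ≃⋆ₐ[ℂ] B)) (μ : Measure G) [IsFiniteMeasureOnCompacts μ]

variable {γ} in
lemma CovRep.integrable (σ : CovRep γ) (f : C_c(G, B)) (h : σ.H) :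
    Integrable (fun s => σ.π (f s) ((σ.U s : σ.H →L[ℂ] σ.H) h)) μ := by
  apply Continuous.integrable_of_hasCompactSupport
  · have h1 := σ.continuous_π.comp f.continuous
    exact h1.clm_apply (σ.isCovariant.continuous h)
  · refine f.hasCompactSupport.mono ?_
    intro s hs hf
    simp [hf] at hs

/-- The integrated form `(π ⋊ U)(f) = ∫ π(f(s)) U_s ds` on `f ∈ C_c(G, B)`. -/
def CovRep.integrated {γ : G →* (B ≃⋆ₐ[ℂ] B)} (σ : CovRep γ) (f : C_c(G, B)) : σ.H →L[ℂ] σ.H :=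
  LinearMap.mkContinuous
    { toFun := fun h => ∫ s, σ.π (f s) ((σ.U s : σ.H →L[ℂ] σ.H) h) ∂μ
      map_add' := fun h k => by
        simp only [map_add]
        exact integral_add (σ.integrable μ f h) (σ.integrable μ f k)
      map_smul' := fun c h => by
        simp only [map_smul, RingHom.id_apply]
        exact integral_smul c _ }
    (∫ s, ‖f s‖ ∂μ) (fun h => by
      have hi : Integrable (fun s => ‖f s‖) μ :=
        (f.continuous.integrable_of_hasCompactSupport f.hasCompactSupport).norm
      rw [← integral_mul_const]
      refine norm_integral_le_of_norm_le (hi.mul_const _) (Filter.Eventually.of_forall fun s => ?_)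
      refine ((σ.π (f s)).le_opNorm _).trans ?_
      rw [norm_unitary_apply]
      gcongr
      exact σ.norm_π_le _)

lemma CovRep.integrated_apply {γ : G →* (B ≃⋆ₐ[ℂ] B)} (σ : CovRep γ) (f : C_c(G, B)) (h : σ.H) :
    σ.integrated μ f h = ∫ s, σ.π (f s) ((σ.U s : σ.H →L[ℂ] σ.H) h) ∂μ := rfl

lemma CovRep.norm_integrated_le {γ : G →* (B ≃⋆ₐ[ℂ] B)} (σ : CovRep γ) (f : C_c(G, B)) :
    ‖σ.integrated μ f‖ ≤ ∫ s, ‖f s‖ ∂μ :=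
  LinearMap.mkContinuous_norm_le _ (integral_nonneg fun _ => norm_nonneg _) _

/-- The `C^*`-algebra of bounded families of operators, indexed by all covariant representations
of `(B, G, γ)`. -/
def UniversalAlgebra : Type (u + 1) :=
  lp (fun σ : CovRep γ => σ.H →L[ℂ] σ.H) ∞

instance : NonUnitalCStarAlgebra (UniversalAlgebra γ) :=
  inferInstanceAs (NonUnitalCStarAlgebra (lp (fun σ : CovRep γ => σ.H →L[ℂ] σ.H) ∞))

/-- The universal representation `f ↦ ((π ⋊ U)(f))_{(π, U)}` of `C_c(G, B)`. -/
def universalRep (f : C_c(G, B)) : UniversalAlgebra γ :=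
  ⟨fun σ => σ.integrated μ f, memℓp_infty ⟨∫ s, ‖f s‖ ∂μ, by
    rintro _ ⟨σ, rfl⟩
    exact σ.norm_integrated_le μ f⟩⟩

/-- The `C^*`-algebra generated by the image of `C_c(G, B)` in its universal representation. -/
def crossedProductSubalgebra : NonUnitalStarSubalgebra ℂ (UniversalAlgebra γ) :=
  (NonUnitalStarAlgebra.adjoin ℂ (Set.range (universalRep γ μ))).topologicalClosure

lemma isClosed_crossedProductSubalgebra :
    IsClosed (crossedProductSubalgebra γ μ : Set (UniversalAlgebra γ)) :=
  NonUnitalStarSubalgebra.isClosed_topologicalClosure _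

/-- The full crossed product `B ⋊_γ G`: the completion of `C_c(G, B)` in the universal norm
`‖f‖ = sup ‖(π ⋊ U)(f)‖`, the supremum over all covariant representations `(π, U)`. It is realised
as the `C^*`-algebra generated by the image of `C_c(G, B)` in its universal representation. -/
def CrossedProduct : Type (u + 1) := crossedProductSubalgebra γ μ

instance : NonUnitalCStarAlgebra (CrossedProduct γ μ) :=
  NonUnitalStarSubalgebra.nonUnitalCStarAlgebra (crossedProductSubalgebra γ μ)
    (h_closed := isClosed_crossedProductSubalgebra γ μ)

/-- The inclusion of the crossed product in its universal representation. -/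
def CrossedProduct.incl : CrossedProduct γ μ →⋆ₙₐ[ℂ] UniversalAlgebra γ where
  toFun c := c.1
  map_smul' _ _ := rfl
  map_zero' := rfl
  map_add' _ _ := rfl
  map_mul' _ _ := rfl
  map_star' _ := rfl

/-- The canonical map `C_c(G, B) → B ⋊_γ G`. -/
def toCrossedProduct (f : C_c(G, B)) : CrossedProduct γ μ :=
  ⟨universalRep γ μ f, NonUnitalStarSubalgebra.le_topologicalClosure _
    (NonUnitalStarAlgebra.subset_adjoin ℂ _ ⟨f, rfl⟩)⟩

variable {γ} in
/-- The evaluation of bounded families of operators at one covariant representation. -/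
def CovRep.eval (σ : CovRep γ) : UniversalAlgebra γ →⋆ₙₐ[ℂ] (σ.H →L[ℂ] σ.H) where
  toFun c := c.1 σ
  map_smul' _ _ := rfl
  map_zero' := rfl
  map_add' _ _ := rfl
  map_mul' _ _ := rfl
  map_star' _ := rfl

variable {γ} in
/-- The integrated form `π ⋊ U` of a covariant representation, as a representation of the crossed
product. -/
def CovRep.integratedForm (σ : CovRep γ) : CrossedProduct γ μ →⋆ₙₐ[ℂ] (σ.H →L[ℂ] σ.H) :=
  σ.eval.comp (CrossedProduct.incl γ μ)

lemma CovRep.integratedForm_toCrossedProduct (σ : CovRep γ) (f : C_c(G, B)) (h : σ.H) :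
    σ.integratedForm μ (toCrossedProduct γ μ f) h =
      ∫ s, σ.π (f s) ((σ.U s : σ.H →L[ℂ] σ.H) h) ∂μ := rfl

/-- An automorphism `θ` of `B` commuting with `γ` acts on families of operators by permuting the
covariant representations. -/
def universalTwist (θ : B ≃⋆ₐ[ℂ] B) (hθ : ∀ s b, θ (γ s b) = γ s (θ b)) :
    UniversalAlgebra γ →⋆ₙₐ[ℂ] UniversalAlgebra γ where
  toFun c := ⟨fun σ => c.1 (σ.twist θ hθ), memℓp_infty (by
    obtain ⟨C, hC⟩ := (lp.memℓp c).bddAbove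
    exact ⟨C, by rintro _ ⟨σ, rfl⟩; exact hC ⟨σ.twist θ hθ, rfl⟩⟩)⟩
  map_smul' _ _ := rfl
  map_zero' := rfl
  map_add' _ _ := rfl
  map_mul' _ _ := rfl
  map_star' _ := rfl

/-- Pointwise application of an automorphism to a compactly supported function. -/
def mapCc (θ : B ≃⋆ₐ[ℂ] B) (f : C_c(G, B)) : C_c(G, B) where
  toFun s := θ (f s)
  continuous_toFun :=
    (NonUnitalStarAlgHom.isometry (θ : B →⋆ₙₐ[ℂ] B) θ.injective).continuous.comp f.continuous
  hasCompactSupport' := f.hasCompactSupport.comp_left (map_zero θ)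

lemma universalTwist_universalRep (θ : B ≃⋆ₐ[ℂ] B) (hθ : ∀ s b, θ (γ s b) = γ s (θ b))
    (f : C_c(G, B)) : universalTwist γ θ hθ (universalRep γ μ f) = universalRep γ μ (mapCc θ f) :=
  rfl

lemma universalTwist_mem (θ : B ≃⋆ₐ[ℂ] B) (hθ : ∀ s b, θ (γ s b) = γ s (θ b))
    {c : UniversalAlgebra γ} (hc : c ∈ crossedProductSubalgebra γ μ) :
    universalTwist γ θ hθ c ∈ crossedProductSubalgebra γ μ := by
  have hcont : Continuous (universalTwist γ θ hθ) :=
    AddMonoidHomClass.continuous_of_bound _ 1 (fun b => by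
      simpa using NonUnitalStarAlgHom.norm_apply_le (universalTwist γ θ hθ) b)
  have : crossedProductSubalgebra γ μ ≤
      (crossedProductSubalgebra γ μ).comap (universalTwist γ θ hθ) := by
    refine NonUnitalStarSubalgebra.topologicalClosure_minimal _ ?_ ?_
    · refine NonUnitalStarAlgebra.adjoin_le ?_
      rintro _ ⟨f, rfl⟩
      exact (toCrossedProduct γ μ (mapCc θ f)).2
    · exact (isClosed_crossedProductSubalgebra γ μ).preimage hcont
  exact this hc

/-- The endomorphism of `B ⋊_γ G` induced by an automorphism of `B` commuting with `γ`. -/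
def crossedProductMap (θ : B ≃⋆ₐ[ℂ] B) (hθ : ∀ s b, θ (γ s b) = γ s (θ b)) :
    CrossedProduct γ μ →⋆ₙₐ[ℂ] CrossedProduct γ μ where
  toFun c := ⟨universalTwist γ θ hθ c.1, universalTwist_mem γ μ θ hθ c.2⟩
  map_smul' _ _ := rfl
  map_zero' := rfl
  map_add' _ _ := rfl
  map_mul' _ _ := rfl
  map_star' _ := rfl

lemma crossedProductMap_comp (θ₁ θ₂ θ : B ≃⋆ₐ[ℂ] B) (h₁ : ∀ s b, θ₁ (γ s b) = γ s (θ₁ b))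
    (h₂ : ∀ s b, θ₂ (γ s b) = γ s (θ₂ b)) (h : ∀ s b, θ (γ s b) = γ s (θ b))
    (e : θ₁ * θ₂ = θ) (c : CrossedProduct γ μ) :
    crossedProductMap γ μ θ₁ h₁ (crossedProductMap γ μ θ₂ h₂ c) = crossedProductMap γ μ θ h c := by
  subst e
  rfl

lemma crossedProductMap_one (θ : B ≃⋆ₐ[ℂ] B) (h : ∀ s b, θ (γ s b) = γ s (θ b))
    (e : θ = 1) (c : CrossedProduct γ μ) : crossedProductMap γ μ θ h c = c := by
  subst e
  rfl

variable {L : Type*} [Group L] (δ : L →* (B ≃⋆ₐ[ℂ] B))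
  (hδ : ∀ l s b, δ l (γ s b) = γ s (δ l b))

/-- An action `δ` of a group `L` on `B` commuting with the action `γ` of `G` induces an action of
`L` on `B ⋊_γ G`, given on `f ∈ C_c(G, B)` by `(l · f)(s) = δ_l(f(s))`. -/
def inducedAction : L →* (CrossedProduct γ μ ≃⋆ₐ[ℂ] CrossedProduct γ μ) where
  toFun l :=
    { toFun := crossedProductMap γ μ (δ l) (hδ l)
      invFun := crossedProductMap γ μ (δ l⁻¹) (hδ l⁻¹)
      left_inv := fun c => by
        rw [crossedProductMap_comp γ μ (δ l⁻¹) (δ l) 1 _ _ (fun _ _ => rfl)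
          (by rw [← map_mul, inv_mul_cancel, map_one])]
        exact crossedProductMap_one γ μ 1 _ rfl c
      right_inv := fun c => by
        rw [crossedProductMap_comp γ μ (δ l) (δ l⁻¹) 1 _ _ (fun _ _ => rfl)
          (by rw [← map_mul, mul_inv_cancel, map_one])]
        exact crossedProductMap_one γ μ 1 _ rfl c
      map_mul' := fun _ _ => rfl
      map_add' := fun _ _ => rfl
      map_star' := fun _ => rfl
      map_smul' := fun _ _ => rfl }
  map_one' := by
    ext c
    exact crossedProductMap_one γ μ _ _ (map_one δ) c
  map_mul' l m := by
    ext c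
    exact (crossedProductMap_comp γ μ _ _ _ (hδ l) (hδ m) (hδ (l * m)) (map_mul δ l m).symm c).symm

lemma inducedAction_toCrossedProduct (l : L) (f : C_c(G, B)) :
    inducedAction γ μ δ hδ l (toCrossedProduct γ μ f) = toCrossedProduct γ μ (mapCc (δ l) f) :=
  rfl

end CrossedProduct

set_option linter.unusedSectionVars false

section Coefficients

variable {X A : Type*} [TopologicalSpace X] [NonUnitalCStarAlgebra A]

lemma continuous_starAlgEquiv (φ : A ≃⋆ₐ[ℂ] A) : Continuous φ :=
  (NonUnitalStarAlgHom.isometry (φ : A →⋆ₙₐ[ℂ] A) φ.injective).continuous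

lemma norm_starAlgEquiv (φ : A ≃⋆ₐ[ℂ] A) (a : A) : ‖φ a‖ = ‖a‖ :=
  NonUnitalStarAlgHom.norm_map (φ : A →⋆ₙₐ[ℂ] A) φ.injective a

/-- The function `x ↦ φ (f (e x))` in `C_0(X, A)`. -/
def c0Map (φ : A ≃⋆ₐ[ℂ] A) (e : X ≃ₜ X) (f : C₀(X, A)) : C₀(X, A) where
  toFun x := φ (f (e x))
  continuous_toFun := (continuous_starAlgEquiv φ).comp (f.continuous.comp e.continuous)
  zero_at_infty' := by
    have h1 := (zero_at_infty f).comp e.isClosedEmbedding.tendsto_cocompact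
    have h2 := ((continuous_starAlgEquiv φ).tendsto 0).comp h1
    rwa [map_zero] at h2

/-- The automorphism `f ↦ φ ∘ f ∘ e` of `A ⊗ C_0(X) = C_0(X, A)`. -/
def c0Aut (φ : A ≃⋆ₐ[ℂ] A) (e : X ≃ₜ X) : C₀(X, A) ≃⋆ₐ[ℂ] C₀(X, A) where
  toFun := c0Map φ e
  invFun := c0Map φ.symm e.symm
  left_inv f := by ext x; simp [c0Map]
  right_inv f := by ext x; simp [c0Map]
  map_mul' f g := by ext x; simp [c0Map]
  map_add' f g := by ext x; simp [c0Map]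
  map_star' f := by ext x; exact map_star φ (f (e x))
  map_smul' c f := by ext x; simp [c0Map]

@[simp] lemma c0Aut_apply (φ : A ≃⋆ₐ[ℂ] A) (e : X ≃ₜ X) (f : C₀(X, A)) (x : X) :
    c0Aut φ e f x = φ (f (e x)) := rfl

variable {G : Type*} [Group G] [TopologicalSpace G] [IsTopologicalGroup G]
  (α : G →* (A ≃⋆ₐ[ℂ] A)) (N : Subgroup G) [N.Normal]

/-- The action `α ⊗ lt` of `G` on `A ⊗ C_0(G/N) = C_0(G/N, A)`:
`((α ⊗ lt)_s f)(rN) = α_s(f(s⁻¹rN))`. -/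
def alphaLt : G →* (C₀(G ⧸ N, A) ≃⋆ₐ[ℂ] C₀(G ⧸ N, A)) where
  toFun s := c0Aut (α s) (Homeomorph.mulLeft ((s : G ⧸ N)⁻¹))
  map_one' := by ext f x; simp
  map_mul' s t := by ext f x; simp [mul_assoc]

@[simp] lemma alphaLt_apply (s : G) (f : C₀(G ⧸ N, A)) (x : G ⧸ N) :
    alphaLt α N s f x = α s (f ((s : G ⧸ N)⁻¹ * x)) := rfl

variable (A) in
/-- The action `id ⊗ rt` of `G/N` on `A ⊗ C_0(G/N) = C_0(G/N, A)`:
`((id ⊗ rt)_{tN} f)(sN) = f(stN)`. -/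
def idRt : (G ⧸ N) →* (C₀(G ⧸ N, A) ≃⋆ₐ[ℂ] C₀(G ⧸ N, A)) where
  toFun q := c0Aut 1 (Homeomorph.mulRight q)
  map_one' := by ext f x; simp
  map_mul' s t := by ext f x; simp [mul_assoc]

@[simp] lemma idRt_apply (q : G ⧸ N) (f : C₀(G ⧸ N, A)) (x : G ⧸ N) :
    idRt A N q f x = f (x * q) := rfl

lemma idRt_alphaLt (q : G ⧸ N) (s : G) (f : C₀(G ⧸ N, A)) :
    idRt A N q (alphaLt α N s f) = alphaLt α N s (idRt A N q f) := by
  ext x; simp [mul_assoc]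

end Coefficients

section Beta

variable {G A : Type u} [Group G] [TopologicalSpace G] [IsTopologicalGroup G]
  [MeasurableSpace G] [BorelSpace G] [NonUnitalCStarAlgebra A]
  (α : G →* (A ≃⋆ₐ[ℂ] A)) (N : Subgroup G) [N.Normal] (μ : Measure G)
  [IsFiniteMeasureOnCompacts μ]

/-- The action `β` of `G/N` on `(A ⊗ C_0(G/N)) ⋊_{α ⊗ lt} G` induced by `id ⊗ rt`. -/
def beta : (G ⧸ N) →*
    (CrossedProduct (alphaLt α N) μ ≃⋆ₐ[ℂ] CrossedProduct (alphaLt α N) μ) :=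
  inducedAction (alphaLt α N) μ (idRt A N) (idRt_alphaLt α N)

/-- The restriction of `β` to `K/N`, through the homomorphism `kN ↦ kN` from `K/N` to `G/N`. -/
def betaRestrict (K : Subgroup G) : (K ⧸ N.subgroupOf K) →*
    (CrossedProduct (alphaLt α N) μ ≃⋆ₐ[ℂ] CrossedProduct (alphaLt α N) μ) :=
  (beta α N μ).comp (QuotientGroup.map (N.subgroupOf K) N K.subtype (fun _ h => h))

end Beta

section Modular

variable {G : Type*} [Group G] [TopologicalSpace G] [IsTopologicalGroup G] [LocallyCompactSpace G]

/-- The modular function `Δ_G`, with the convention `∫ f(rs) dr = Δ_G(s)⁻¹ ∫ f(r) dr` for a left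
Haar measure `dr`. (Mathlib's modular character is the inverse of this.) -/
def modularFn (s : G) : ℝ := ((Measure.modularCharacterFun s : ℝ≥0) : ℝ)⁻¹

lemma modularFn_pos (s : G) : 0 < modularFn s :=
  inv_pos.2 (NNReal.coe_pos.2 (Measure.modularCharacterFun_pos s))

lemma modularFn_mul (s t : G) : modularFn (s * t) = modularFn s * modularFn t := by
  simp [modularFn, Measure.modularCharacterFun_map_mul, mul_comm]

lemma modularFn_one : modularFn (1 : G) = 1 := by
  simp [modularFn, Measure.modularCharacterFun_map_one]

lemma modularFn_inv (s : G) : modularFn s⁻¹ = (modularFn s)⁻¹ := by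
  have := modularFn_mul s s⁻¹
  rw [mul_inv_cancel, modularFn_one] at this
  exact (inv_eq_of_mul_eq_one_right this.symm).symm

variable [MeasurableSpace G] [BorelSpace G] (μ : Measure G) [μ.IsHaarMeasure] [μ.Regular]
  {E : Type*} [NormedAddCommGroup E] [NormedSpace ℝ E]

lemma integral_mul_right_modularFn (f : G → E) (s : G) :
    ∫ r, f (r * s) ∂μ = (modularFn s)⁻¹ • ∫ r, f r ∂μ := by
  have h1 : Measure.map (· * s) μ = Measure.modularCharacterFun s • μ := by
    rw [Measure.modularCharacterFun_eq_haarScalarFactor μ]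
    have : (Measure.map (· * s) μ).Regular := Measure.Regular.map (Homeomorph.mulRight s)
    exact Measure.isMulLeftInvariant_eq_smul_of_regular _ μ
  have h2 : ∫ r, f r ∂(Measure.map (· * s) μ) = ∫ r, f (r * s) ∂μ :=
    (Homeomorph.mulRight s).measurableEmbedding.integral_map f
  rw [← h2, h1, integral_smul_nnreal_measure, modularFn, inv_inv]
  rfl

lemma continuous_modularFn : Continuous (modularFn : G → ℝ) := by
  borelize G
  let μ : Measure G := Measure.haar
  obtain ⟨⟨f, f_cont⟩, f_comp, f_nonneg, f_one⟩ :
    ∃ f : C(G, ℝ), HasCompactSupport f ∧ 0 ≤ f ∧ f 1 ≠ 0 := exists_continuous_nonneg_pos 1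
  have hpos : 0 < ∫ x, f x ∂μ :=
    f_cont.integral_pos_of_hasCompactSupport_nonneg_nonzero f_comp f_nonneg f_one
  have h : ∀ s, modularFn s = (∫ x, f x ∂μ) * (∫ x, f (x * s) ∂μ)⁻¹ := by
    intro s
    rw [integral_mul_right_modularFn μ f s, smul_eq_mul, mul_inv, inv_inv, mul_comm, mul_assoc,
      inv_mul_cancel₀ hpos.ne', mul_one]
  have hne : ∀ s, ∫ x, f (x * s) ∂μ ≠ 0 := by
    intro s
    rw [integral_mul_right_modularFn μ f s, smul_eq_mul]
    exact (mul_pos (inv_pos.2 (modularFn_pos s)) hpos).ne'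
  have hc : Continuous fun s => ∫ x, f (x * s) ∂μ := by
    rw [continuous_iff_continuousAt]
    intro s₀
    obtain ⟨t, t_comp, ht⟩ := exists_compact_mem_nhds s₀
    refine ContinuousOn.continuousAt (s := t) ?_ ht
    apply continuousOn_integral_of_compact_support
      (k := (fun p : G × G => p.1 * p.2⁻¹) '' (tsupport f ×ˢ t))
    · exact (f_comp.isCompact.prod t_comp).image (by fun_prop)
    · exact Continuous.continuousOn (by fun_prop)
    · intro p x hp hx
      by_contra hne
      exact hx ⟨(x * p, p), ⟨subset_tsupport _ hne, hp⟩, by simp⟩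
  rw [funext h]
  exact continuous_const.mul (hc.inv₀ hne)

end Modular

section Subgroup

variable {G : Type*} [Group G] [TopologicalSpace G]

instance locallyCompactSpace_subgroup [LocallyCompactSpace G] (N : Subgroup G)
    [hN : IsClosed (N : Set G)] : LocallyCompactSpace N :=
  hN.isClosedEmbedding_subtypeVal.locallyCompactSpace

lemma isCompact_subgroup_preimage (N : Subgroup G) [hN : IsClosed (N : Set G)] {K : Set G}
    (hK : IsCompact K) : IsCompact {n : N | (n : G) ∈ K} :=
  hN.isClosedEmbedding_subtypeVal.isCompact_preimage hK

end Subgroup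

section Form

variable {G A : Type u} [Group G] [TopologicalSpace G] [IsTopologicalGroup G]
  [LocallyCompactSpace G] [T2Space G] [MeasurableSpace G] [BorelSpace G] [NonUnitalCStarAlgebra A]
  {N : Subgroup G} [hN : IsClosed (N : Set G)]
  (μG : Measure G) [μG.IsHaarMeasure] [μG.Regular]
  (μN : Measure N) [μN.IsHaarMeasure] [μN.Regular]
  {δ : N →* (A ≃⋆ₐ[ℂ] A)} (σ : CovRep δ)

/-- The weight `Δ_N(n)^{-1/2}`. -/
def wt (n : N) : ℝ := (√(modularFn n))⁻¹

lemma wt_pos (n : N) : 0 < wt n := inv_pos.2 (Real.sqrt_pos.2 (modularFn_pos n))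

lemma wt_mul (m n : N) : wt (m * n) = wt m * wt n := by
  simp [wt, modularFn_mul, Real.sqrt_mul (modularFn_pos m).le, mul_comm]

lemma wt_mul_self (n : N) : wt n * wt n = (modularFn n)⁻¹ := by
  rw [wt, ← mul_inv, Real.mul_self_sqrt (modularFn_pos n).le]

lemma wt_inv (n : N) : wt n⁻¹ = (wt n)⁻¹ := by
  simp [wt, modularFn_inv, Real.sqrt_inv]

lemma continuous_wt : Continuous (wt : N → ℝ) :=
  (Real.continuous_sqrt.comp continuous_modularFn).inv₀
    fun n => (Real.sqrt_pos.2 (modularFn_pos n)).ne'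

/-- The integrand of `fibInt`. -/
def fibIntegrand (η : C_c(G, σ.H)) (t : G) (n : N) : σ.H :=
  wt n • (σ.U n : σ.H →L[ℂ] σ.H) (η (t * n))

/-- `∫_N Δ_N(n)^{-1/2} U_n η(tn) dn`. -/
def fibInt (η : C_c(G, σ.H)) (t : G) : σ.H := ∫ n, fibIntegrand σ η t n ∂μN

lemma continuous_fibIntegrand (η : C_c(G, σ.H)) :
    Continuous fun p : G × N => fibIntegrand σ η p.1 p.2 := by
  unfold fibIntegrand
  refine (continuous_wt.comp continuous_snd).smul ?_
  have : Continuous fun p : G × N => (p.2, η (p.1 * p.2)) :=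
    continuous_snd.prodMk (η.continuous.comp
      (continuous_fst.mul (continuous_subtype_val.comp continuous_snd)))
  exact σ.continuous_U.comp this

lemma fibIntegrand_eq_zero (η : C_c(G, σ.H)) {S : Set G} (t : G) (ht : t ∈ S) (n : N)
    (hn : (n : G) ∉ (fun p : G × G => p.1⁻¹ * p.2) '' (S ×ˢ tsupport η)) :
    fibIntegrand σ η t n = 0 := by
  by_contra h
  refine hn ⟨(t, t * n), ⟨ht, subset_tsupport _ ?_⟩, by simp⟩
  intro h'
  exact h (by simp [fibIntegrand, h'])

lemma isCompact_fibSet (η : C_c(G, σ.H)) {S : Set G} (hS : IsCompact S) :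
    IsCompact {n : N | (n : G) ∈ (fun p : G × G => p.1⁻¹ * p.2) '' (S ×ˢ tsupport η)} :=
  isCompact_subgroup_preimage N ((hS.prod η.hasCompactSupport.isCompact).image (by fun_prop))

lemma hasCompactSupport_fibIntegrand (η : C_c(G, σ.H)) (t : G) :
    HasCompactSupport fun n => fibIntegrand σ η t n :=
  HasCompactSupport.intro (isCompact_fibSet σ η (isCompact_singleton (x := t)))
    (fun n hn => fibIntegrand_eq_zero σ η (S := {t}) t rfl n hn)

lemma integrable_fibIntegrand (η : C_c(G, σ.H)) (t : G) :
    Integrable (fun n => fibIntegrand σ η t n) μN :=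
  Continuous.integrable_of_hasCompactSupport
    ((continuous_fibIntegrand σ η).comp (continuous_const.prodMk continuous_id))
    (hasCompactSupport_fibIntegrand σ η t)

lemma continuous_fibInt (η : C_c(G, σ.H)) : Continuous (fibInt μN σ η) := by
  rw [continuous_iff_continuousAt]
  intro t₀
  obtain ⟨S, hS, hS'⟩ := exists_compact_mem_nhds t₀
  refine ContinuousOn.continuousAt (s := S) ?_ hS'
  exact continuousOn_integral_of_compact_support (isCompact_fibSet σ η hS)
    (continuous_fibIntegrand σ η).continuousOn
    (fun t n ht hn => fibIntegrand_eq_zero σ η t ht n hn)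

lemma fibInt_eq (η : C_c(G, σ.H)) (t : G) (m : N) :
    fibInt μN σ η t = wt m • (σ.U m : σ.H →L[ℂ] σ.H) (fibInt μN σ η (t * m)) := by
  rw [fibInt, fibInt, ← ContinuousLinearMap.integral_comp_comm _ (integrable_fibIntegrand μN σ η _),
    ← integral_smul, ← integral_mul_left_eq_self _ m]
  congr 1
  ext n
  simp only [fibIntegrand, wt_mul, σ.U_mul, Subgroup.coe_mul, mul_assoc, ContinuousLinearMap.map_smul_of_tower, smul_smul]

lemma fibInt_mul_inv (η : C_c(G, σ.H)) (t : G) (n : N) :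
    fibInt μN σ η (t * (n : G)⁻¹) = wt n • (σ.U n : σ.H →L[ℂ] σ.H) (fibInt μN σ η t) := by
  have := fibInt_eq μN σ η (t * (n : G)⁻¹) n
  rwa [inv_mul_cancel_right] at this

/-- The form `∫_G ∫_N Δ_N(n)^{-1/2} ⟪ξ(t⁻¹), U_n η(t⁻¹n)⟫ dn dt`. -/
def form (ξ η : C_c(G, σ.H)) : ℂ := ∫ t, inner ℂ (ξ t) (fibInt μN σ η t) ∂μG.inv

lemma integrable_form (ξ η : C_c(G, σ.H)) :
    Integrable (fun t => inner ℂ (ξ t) (fibInt μN σ η t)) μG.inv := by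
  apply Continuous.integrable_of_hasCompactSupport
  · exact ξ.continuous.inner (continuous_fibInt μN σ η)
  · refine ξ.hasCompactSupport.mono ?_
    intro t ht h
    simp [h] at ht

/-- `b` integrates to one over the cosets of `N` that meet `S`. -/
def IsCutoff (b : C_c(G, ℝ)) (S : Set G) : Prop :=
  (∀ t, 0 ≤ b t) ∧ ∀ t ∈ S, ∫ n : N, (modularFn n)⁻¹ * b (t * (n : G)⁻¹) ∂μN = 1

lemma form_eq_cutoff (ξ η : C_c(G, σ.H)) (b : C_c(G, ℝ)) (hb : IsCutoff μN b (tsupport ξ)) :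
    form μG μN σ ξ η =
      ∫ t, (b t : ℂ) * inner ℂ (fibInt μN σ ξ t) (fibInt μN σ η t) ∂μG.inv := by
  symm
  have e1 : ∀ t, (b t : ℂ) * inner ℂ (fibInt μN σ ξ t) (fibInt μN σ η t) =
      ∫ n, (b t : ℂ) * inner ℂ (fibIntegrand σ ξ t n) (fibInt μN σ η t) ∂μN := by
    intro t
    rw [integral_const_mul]
    congr 1
    have := integral_inner (𝕜 := ℂ) (integrable_fibIntegrand μN σ ξ t) (fibInt μN σ η t)
    have h2 : (fun n => inner ℂ (fibIntegrand σ ξ t n) (fibInt μN σ η t)) =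
      fun n => (starRingEnd ℂ) (inner ℂ (fibInt μN σ η t) (fibIntegrand σ ξ t n)) := by
      ext n; exact (inner_conj_symm _ _).symm
    rw [h2, integral_conj, this, inner_conj_symm]
    rfl
  simp_rw [e1]
  rw [integral_integral_swap_of_hasCompactSupport]
  rotate_left
  · refine ((Complex.continuous_ofReal.comp (b.continuous.comp continuous_fst)).mul ?_)
    exact (continuous_fibIntegrand σ ξ).inner ((continuous_fibInt μN σ η).comp continuous_fst)
  · refine HasCompactSupport.intro
      (b.hasCompactSupport.isCompact.prod (isCompact_fibSet σ ξ b.hasCompactSupport.isCompact)) ?_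
    rintro ⟨t, n⟩ hp
    by_cases ht : t ∈ tsupport b
    · have : fibIntegrand σ ξ t n = 0 :=
        fibIntegrand_eq_zero σ ξ t ht n (fun h => hp ⟨ht, h⟩)
      simp [Function.uncurry, this]
    · simp [Function.uncurry, image_eq_zero_of_notMem_tsupport ht]
  have e2 : ∀ n : N, ∫ t, (b t : ℂ) * inner ℂ (fibIntegrand σ ξ t n) (fibInt μN σ η t) ∂μG.inv =
      ∫ t, (((modularFn n)⁻¹ * b (t * (n : G)⁻¹) : ℝ) : ℂ) * inner ℂ (ξ t) (fibInt μN σ η t)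
        ∂μG.inv := by
    intro n
    rw [← integral_mul_right_eq_self _ (n : G)⁻¹]
    congr 1
    ext t
    rw [fibInt_mul_inv, fibIntegrand, inv_mul_cancel_right, ← wt_mul_self]
    simp only [inner_smul_left_eq_smul, inner_smul_right_eq_smul, σ.inner_U]
    simp only [Complex.real_smul]
    push_cast
    ring
  simp_rw [e2]
  rw [← integral_integral_swap_of_hasCompactSupport]
  rotate_left
  · refine Continuous.mul (Complex.continuous_ofReal.comp (Continuous.mul ?_ ?_)) ?_
    · exact (continuous_modularFn.comp continuous_snd).inv₀ fun _ => (modularFn_pos _).ne'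
    · refine b.continuous.comp (continuous_fst.mul ?_)
      exact (continuous_subtype_val.comp continuous_snd).inv
    · exact (ξ.continuous.comp continuous_fst).inner
        ((continuous_fibInt μN σ η).comp continuous_fst)
  · have hc : IsCompact {n : N | (n : G) ∈ (fun p : G × G => p.2⁻¹ * p.1) ''
        (tsupport ξ ×ˢ tsupport b)} :=
      isCompact_subgroup_preimage N ((ξ.hasCompactSupport.isCompact.prod
        b.hasCompactSupport.isCompact).image (by fun_prop))
    refine HasCompactSupport.intro (ξ.hasCompactSupport.isCompact.prod hc) ?_
    rintro ⟨t, n⟩ hp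
    by_cases ht : t ∈ tsupport ξ
    · by_cases hb : t * (n : G)⁻¹ ∈ tsupport b
      · exact absurd ⟨ht, ⟨(t, t * (n : G)⁻¹), ⟨ht, hb⟩, by simp⟩⟩ hp
      · simp [Function.uncurry, image_eq_zero_of_notMem_tsupport hb]
    · simp [Function.uncurry, image_eq_zero_of_notMem_tsupport ht]
  rw [form]
  congr 1
  ext t
  rw [integral_mul_const]
  by_cases ht : t ∈ tsupport ξ
  · rw [integral_complex_ofReal, hb.2 t ht]
    simp
  · simp [image_eq_zero_of_notMem_tsupport ht]

lemma exists_isCutoff {S : Set G} (hS : IsCompact S) : ∃ b : C_c(G, ℝ), IsCutoff μN b S := by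
  obtain ⟨φ, hφ1, hφc, hφ01⟩ : ∃ φ : C(G, ℝ), Set.EqOn φ 1 S ∧ HasCompactSupport φ ∧
      ∀ x, φ x ∈ Set.Icc (0 : ℝ) 1 := by
    obtain ⟨φ, h1, _, h3, h4⟩ := exists_continuous_one_zero_of_isCompact hS isClosed_empty
      (Set.disjoint_empty S)
    exact ⟨φ, h1, h3, h4⟩
  let Φ : G → ℝ := fun t => ∫ n : N, (modularFn n)⁻¹ * φ (t * (n : G)⁻¹) ∂μN
  have hcont2 : Continuous fun p : G × N => (modularFn p.2)⁻¹ * φ (p.1 * (p.2 : G)⁻¹) := by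
    refine Continuous.mul ?_ ?_
    · exact (continuous_modularFn.comp continuous_snd).inv₀ fun _ => (modularFn_pos _).ne'
    · exact φ.continuous.comp (continuous_fst.mul
        (continuous_subtype_val.comp continuous_snd).inv)
  have hc : ∀ T : Set G, IsCompact T → IsCompact {n : N | (n : G) ∈
      (fun p : G × G => p.2⁻¹ * p.1) '' (T ×ˢ tsupport φ)} := fun T hT =>
    isCompact_subgroup_preimage N ((hT.prod hφc.isCompact).image (by fun_prop))
  have hz : ∀ (T : Set G) (t : G), t ∈ T → ∀ n : N, n ∉ {n : N | (n : G) ∈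
      (fun p : G × G => p.2⁻¹ * p.1) '' (T ×ˢ tsupport φ)} →
      (modularFn n)⁻¹ * φ (t * (n : G)⁻¹) = 0 := by
    intro T t ht n hn
    by_cases hb : t * (n : G)⁻¹ ∈ tsupport φ
    · exact absurd ⟨(t, t * (n : G)⁻¹), ⟨ht, hb⟩, by simp⟩ hn
    · simp [image_eq_zero_of_notMem_tsupport hb]
  have hΦc : Continuous Φ := by
    rw [continuous_iff_continuousAt]
    intro t₀
    obtain ⟨T, hT, hT'⟩ := exists_compact_mem_nhds t₀
    refine ContinuousOn.continuousAt (s := T) ?_ hT'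
    exact continuousOn_integral_of_compact_support (hc T hT) hcont2.continuousOn
      (fun t n ht hn => hz T t ht n hn)
  have hΦpos : ∀ t ∈ S, 0 < Φ t := by
    intro t ht
    refine Continuous.integral_pos_of_hasCompactSupport_nonneg_nonzero (x := 1)
      (hcont2.comp (continuous_const.prodMk continuous_id)) ?_ ?_ ?_
    · exact HasCompactSupport.intro (hc {t} isCompact_singleton) (fun n hn => hz {t} t rfl n hn)
    · intro n
      exact mul_nonneg (inv_nonneg.2 (modularFn_pos _).le) (hφ01 _).1
    · simp [hφ1 ht, modularFn_one]
  have hΦinv : ∀ t (m : N), Φ (t * (m : G)⁻¹) = Φ t := by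
    intro t m
    have h := integral_mul_right_modularFn μN
      (fun n : N => (modularFn n)⁻¹ * φ (t * (n : G)⁻¹)) m
    rw [smul_eq_mul, eq_inv_mul_iff_mul_eq₀ (modularFn_pos m).ne'] at h
    change _ = ∫ n : N, (modularFn n)⁻¹ * φ (t * (n : G)⁻¹) ∂μN
    rw [← h, ← integral_const_mul]
    change ∫ n : N, _ ∂μN = _
    congr 1
    ext n
    rw [modularFn_mul, mul_inv, Subgroup.coe_mul, mul_inv_rev]
    have := (modularFn_pos m).ne'
    field_simp
    rw [mul_assoc]
  obtain ⟨ε, hε, hεS⟩ : ∃ ε > 0, ∀ t ∈ S, ε ≤ Φ t := by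
    rcases S.eq_empty_or_nonempty with rfl | hne
    · exact ⟨1, one_pos, by simp⟩
    · obtain ⟨t, ht, hmin⟩ := hS.exists_isMinOn hne hΦc.continuousOn
      exact ⟨Φ t, hΦpos t ht, fun s hs => hmin hs⟩
  have hmax : ∀ t, 0 < max (Φ t) ε := fun t => lt_max_of_lt_right hε
  refine ⟨⟨⟨fun t => φ t * (max (Φ t) ε)⁻¹, ?_⟩, ?_⟩, ?_, ?_⟩
  · exact φ.continuous.mul ((hΦc.max continuous_const).inv₀ fun t => (hmax t).ne')
  · exact HasCompactSupport.mul_right hφc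
  · intro t
    exact mul_nonneg (hφ01 t).1 (inv_nonneg.2 (hmax t).le)
  · intro t ht
    change ∫ n : N, (modularFn n)⁻¹ * (φ (t * (n : G)⁻¹) * (max (Φ (t * (n : G)⁻¹)) ε)⁻¹) ∂μN = 1
    simp_rw [hΦinv, ← mul_assoc]
    rw [integral_mul_const, max_eq_left (hεS t ht)]
    exact mul_inv_cancel₀ (hΦpos t ht).ne'

end Form

section FormProps

variable {G A : Type u} [Group G] [TopologicalSpace G] [IsTopologicalGroup G]
  [LocallyCompactSpace G] [T2Space G] [MeasurableSpace G] [BorelSpace G] [NonUnitalCStarAlgebra A]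
  {N : Subgroup G} [hN : IsClosed (N : Set G)]
  (μG : Measure G) [μG.IsHaarMeasure] [μG.Regular]
  (μN : Measure N) [μN.IsHaarMeasure] [μN.Regular]
  {δ : N →* (A ≃⋆ₐ[ℂ] A)} (σ : CovRep δ)

lemma fibInt_add (η η' : C_c(G, σ.H)) (t : G) :
    fibInt μN σ (η + η') t = fibInt μN σ η t + fibInt μN σ η' t := by
  rw [fibInt, fibInt, fibInt, ← integral_add (integrable_fibIntegrand μN σ η t)
    (integrable_fibIntegrand μN σ η' t)]
  congr 1
  ext n
  simp [fibIntegrand]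

lemma fibInt_smul (c : ℂ) (η : C_c(G, σ.H)) (t : G) :
    fibInt μN σ (c • η) t = c • fibInt μN σ η t := by
  rw [fibInt, fibInt, ← integral_smul]
  congr 1
  ext n
  simp only [fibIntegrand, CompactlySupportedContinuousMap.smul_apply, map_smul]
  rw [smul_comm]

lemma form_add_left (ξ ξ' η : C_c(G, σ.H)) :
    form μG μN σ (ξ + ξ') η = form μG μN σ ξ η + form μG μN σ ξ' η := by
  rw [form, form, form, ← integral_add (integrable_form μG μN σ ξ η) (integrable_form μG μN σ ξ' η)]
  simp

lemma form_add_right (ξ η η' : C_c(G, σ.H)) :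
    form μG μN σ ξ (η + η') = form μG μN σ ξ η + form μG μN σ ξ η' := by
  rw [form, form, form, ← integral_add (integrable_form μG μN σ ξ η) (integrable_form μG μN σ ξ η')]
  simp [fibInt_add]

lemma form_smul_left (c : ℂ) (ξ η : C_c(G, σ.H)) :
    form μG μN σ (c • ξ) η = (starRingEnd ℂ) c * form μG μN σ ξ η := by
  rw [form, form, ← integral_const_mul]
  simp only [CompactlySupportedContinuousMap.smul_apply, inner_smul_left]

lemma form_smul_right (c : ℂ) (ξ η : C_c(G, σ.H)) :
    form μG μN σ ξ (c • η) = c * form μG μN σ ξ η := by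
  rw [form, form, ← integral_const_mul]
  simp [fibInt_smul]

lemma form_conj (ξ η : C_c(G, σ.H)) :
    (starRingEnd ℂ) (form μG μN σ η ξ) = form μG μN σ ξ η := by
  obtain ⟨b, hb⟩ := exists_isCutoff μN (ξ.hasCompactSupport.isCompact.union
    η.hasCompactSupport.isCompact)
  rw [form_eq_cutoff μG μN σ ξ η b ⟨hb.1, fun t ht => hb.2 t (Or.inl ht)⟩,
    form_eq_cutoff μG μN σ η ξ b ⟨hb.1, fun t ht => hb.2 t (Or.inr ht)⟩, ← integral_conj]
  congr 1
  ext t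
  simp [inner_conj_symm]

lemma form_self_eq (ξ : C_c(G, σ.H)) (b : C_c(G, ℝ)) (hb : IsCutoff μN b (tsupport ξ)) :
    (form μG μN σ ξ ξ).re = ∫ t, b t * ‖fibInt μN σ ξ t‖ ^ 2 ∂μG.inv := by
  rw [form_eq_cutoff μG μN σ ξ ξ b hb]
  have : ∀ t, (b t : ℂ) * inner ℂ (fibInt μN σ ξ t) (fibInt μN σ ξ t) =
      ((b t * ‖fibInt μN σ ξ t‖ ^ 2 : ℝ) : ℂ) := by
    intro t
    rw [inner_self_eq_norm_sq_to_K]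
    push_cast
    rfl
  simp_rw [this]
  rw [integral_complex_ofReal, Complex.ofReal_re]

lemma form_self_nonneg (ξ : C_c(G, σ.H)) : 0 ≤ (form μG μN σ ξ ξ).re := by
  obtain ⟨b, hb⟩ := exists_isCutoff μN ξ.hasCompactSupport.isCompact
  rw [form_self_eq μG μN σ ξ b hb]
  exact integral_nonneg fun t => mul_nonneg (hb.1 t) (sq_nonneg _)

/-- A decomposable operator is bounded for the form. -/
lemma form_self_le (ξ ξ' : C_c(G, σ.H)) (m : G → σ.H →L[ℂ] σ.H) (C : ℝ)
    (hm : ∀ t, ‖m t‖ ≤ C) (h1 : ∀ t, ξ' t = m t (ξ t))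
    (h2 : ∀ t, fibInt μN σ ξ' t = m t (fibInt μN σ ξ t)) :
    (form μG μN σ ξ' ξ').re ≤ C ^ 2 * (form μG μN σ ξ ξ).re := by
  obtain ⟨b, hb⟩ := exists_isCutoff μN ξ.hasCompactSupport.isCompact
  have hsub : tsupport ξ' ⊆ tsupport ξ := by
    refine closure_mono fun t ht h => ht ?_
    rw [h1 t, h, map_zero]
  have hint : ∀ η : C_c(G, σ.H), Integrable (fun t => b t * ‖fibInt μN σ η t‖ ^ 2) μG.inv := by
    intro η
    refine Continuous.integrable_of_hasCompactSupport ?_ ?_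
    · exact b.continuous.mul ((continuous_fibInt μN σ η).norm.pow 2)
    · exact HasCompactSupport.mul_right b.hasCompactSupport
  rw [form_self_eq μG μN σ ξ b hb, form_self_eq μG μN σ ξ' b ⟨hb.1, fun t ht => hb.2 t (hsub ht)⟩,
    ← integral_const_mul]
  refine integral_mono (hint _) ((hint _).const_mul _) fun t => ?_
  change b t * ‖fibInt μN σ ξ' t‖ ^ 2 ≤ C ^ 2 * (b t * ‖fibInt μN σ ξ t‖ ^ 2)
  rw [h2 t]
  have h3 : ‖m t (fibInt μN σ ξ t)‖ ≤ C * ‖fibInt μN σ ξ t‖ :=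
    ((m t).le_opNorm _).trans (by gcongr; exact hm t)
  calc b t * ‖m t (fibInt μN σ ξ t)‖ ^ 2 ≤ b t * (C * ‖fibInt μN σ ξ t‖) ^ 2 := by
        gcongr
        exact hb.1 t
    _ = _ := by ring

/-- On functions supported in a fixed compact set, the form is dominated by the sup norm. -/
lemma exists_form_le {S : Set G} (hS : IsCompact S) : ∃ C : ℝ, 0 ≤ C ∧
    ∀ (ξ : C_c(G, σ.H)) (M : ℝ), 0 ≤ M → tsupport ξ ⊆ S → (∀ t, ‖ξ t‖ ≤ M) →
      (form μG μN σ ξ ξ).re ≤ C * M ^ 2 := by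
  let T : Set N := {n : N | (n : G) ∈ (fun p : G × G => p.1⁻¹ * p.2) '' (S ×ˢ S)}
  have hT : IsCompact T := isCompact_subgroup_preimage N ((hS.prod hS).image (by fun_prop))
  have hTi : IntegrableOn (fun n : N => wt n) T μN := continuous_wt.continuousOn.integrableOn_compact hT
  let c : ℝ := ∫ n in T, wt n ∂μN
  have hc : 0 ≤ c := integral_nonneg fun n => (wt_pos n).le
  refine ⟨c * μG.inv.real S, mul_nonneg hc measureReal_nonneg, fun ξ M hM hsub hξ => ?_⟩
  have hF : ∀ t ∈ S, ‖fibInt μN σ ξ t‖ ≤ c * M := by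
    intro t ht
    have hz : ∀ n, n ∉ T → fibIntegrand σ ξ t n = 0 := by
      intro n hn
      refine fibIntegrand_eq_zero σ ξ (S := {t}) t rfl n fun h => hn ?_
      obtain ⟨⟨a, b⟩, ⟨ha, hb⟩, hab⟩ := h
      cases ha
      exact ⟨(a, b), ⟨ht, hsub hb⟩, hab⟩
    have : fibInt μN σ ξ t = ∫ n in T, fibIntegrand σ ξ t n ∂μN :=
      (setIntegral_eq_integral_of_forall_compl_eq_zero hz).symm
    rw [this, ← integral_mul_const]
    refine norm_integral_le_of_norm_le (hTi.mul_const M) (Filter.Eventually.of_forall fun n => ?_)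
    rw [fibIntegrand, norm_smul, norm_unitary_apply, Real.norm_of_nonneg (wt_pos n).le]
    exact mul_le_mul_of_nonneg_left (hξ _) (wt_pos n).le
  have hz : ∀ t, t ∉ S → inner ℂ (ξ t) (fibInt μN σ ξ t) = 0 := by
    intro t ht
    have : ξ t = 0 := image_eq_zero_of_notMem_tsupport fun h => ht (hsub h)
    simp [this]
  have e : form μG μN σ ξ ξ = ∫ t in S, inner ℂ (ξ t) (fibInt μN σ ξ t) ∂μG.inv :=
    (setIntegral_eq_integral_of_forall_compl_eq_zero hz).symm
  refine (Complex.re_le_norm _).trans ?_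
  rw [e]
  have := norm_setIntegral_le_of_norm_le_const (μ := μG.inv) (s := S) (C := M * (c * M))
    (f := fun t => inner ℂ (ξ t) (fibInt μN σ ξ t)) hS.measure_lt_top (fun t ht => ?_)
  · refine this.trans (le_of_eq ?_)
    ring
  · refine (norm_inner_le_norm _ _).trans ?_
    exact mul_le_mul (hξ t) (hF t ht) (norm_nonneg _) hM

lemma fibInt_translate (s : G) (c : ℝ) (ξ ξ' : C_c(G, σ.H)) (h : ∀ t, ξ' t = c • ξ (s⁻¹ * t))
    (t : G) : fibInt μN σ ξ' t = c • fibInt μN σ ξ (s⁻¹ * t) := by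
  rw [fibInt, fibInt, ← integral_smul]
  congr 1
  ext n
  simp only [fibIntegrand, h, mul_assoc]
  rw [ContinuousLinearMap.map_smul_of_tower, smul_comm]

/-- Left translation preserves the form. -/
lemma form_translate (s : G) (ξ ξ' η η' : C_c(G, σ.H))
    (h : ∀ t, ξ' t = √(modularFn s) • ξ (s⁻¹ * t))
    (h' : ∀ t, η' t = √(modularFn s) • η (s⁻¹ * t)) :
    form μG μN σ ξ' η' = form μG μN σ ξ η := by
  have e : ∀ f : G → ℂ, ∫ t, f t ∂μG.inv = ∫ t, f t⁻¹ ∂μG := by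
    intro f
    exact (Homeomorph.inv G).measurableEmbedding.integral_map f
  rw [form, form, e, e]
  have h1 := integral_mul_right_modularFn μG (fun t => inner ℂ (ξ t⁻¹) (fibInt μN σ η t⁻¹)) s
  rw [eq_inv_smul_iff₀ (modularFn_pos s).ne', ← integral_smul] at h1
  rw [← h1]
  congr 1
  ext t
  rw [h, fibInt_translate μN σ s _ η η' h']
  simp only [inner_smul_left_eq_smul, inner_smul_right_eq_smul, smul_smul,
    Real.mul_self_sqrt (modularFn_pos s).le, mul_inv_rev]

end FormProps

section Green

variable {G A : Type u} [Group G] [TopologicalSpace G] [IsTopologicalGroup G]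
  [LocallyCompactSpace G] [T2Space G] [MeasurableSpace G] [BorelSpace G] [NonUnitalCStarAlgebra A]
  {α : G →* (A ≃⋆ₐ[ℂ] A)} (hα : IsContinuousAction α)
  {N : Subgroup G} [hN : IsClosed (N : Set G)]
  (μG : Measure G) [μG.IsHaarMeasure] [μG.Regular]
  (μN : Measure N) [μN.IsHaarMeasure] [μN.Regular]
  (σ : CovRep (α.comp N.subtype))

lemma IsContinuousAction.continuous_uncurry (hα : IsContinuousAction α) :
    Continuous fun p : G × A => α p.1 p.2 := by
  rw [continuous_iff_continuousAt]
  rintro ⟨s, a⟩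
  rw [ContinuousAt, tendsto_iff_norm_sub_tendsto_zero]
  have h1 : Filter.Tendsto (fun p : G × A => ‖p.2 - a‖ + ‖α p.1 a - α s a‖) (𝓝 (s, a)) (𝓝 0) := by
    have c : Continuous (fun p : G × A => ‖p.2 - a‖ + ‖α p.1 a - α s a‖) :=
      (continuous_snd.sub continuous_const).norm.add
        (((hα a).comp continuous_fst).sub continuous_const).norm
    simpa using c.tendsto (s, a)
  refine squeeze_zero (fun _ => norm_nonneg _) (fun p => ?_) h1
  calc ‖α p.1 p.2 - α s a‖ = ‖α p.1 (p.2 - a) + (α p.1 a - α s a)‖ := by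
        rw [map_sub]; abel_nf
    _ ≤ _ := by
        refine (norm_add_le _ _).trans ?_
        rw [norm_starAlgEquiv]

/-- The integrand `α_t(x(t⁻¹)^* y(t⁻¹n))` of the `C_c(N, A)`-valued inner product. -/
def greenIntegrand (α : G →* (A ≃⋆ₐ[ℂ] A)) (x y : C_c(G, A)) (n : N) (t : G) : A :=
  α t (star (x t⁻¹) * y (t⁻¹ * n))

lemma continuous_greenIntegrand (hα : IsContinuousAction α) (x y : C_c(G, A)) :
    Continuous fun p : N × G => greenIntegrand α x y p.1 p.2 := by
  have h : Continuous fun p : N × G => (p.2, star (x p.2⁻¹) * y (p.2⁻¹ * p.1)) := by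
    have hx := x.continuous
    have hy := y.continuous
    fun_prop
  exact hα.continuous_uncurry.comp h

lemma greenIntegrand_eq_zero_left (x y : C_c(G, A)) (n : N) (t : G)
    (ht : t ∉ (tsupport x)⁻¹) : greenIntegrand α x y n t = 0 := by
  have : x t⁻¹ = 0 := image_eq_zero_of_notMem_tsupport ht
  simp [greenIntegrand, this]

/-- The subset of `N` outside of which the inner product of `x` and `y` vanishes. -/
def greenSet (x y : C_c(G, A)) : Set N :=
  {n : N | (n : G) ∈ (fun p : G × G => p.1⁻¹ * p.2) '' (tsupport x ×ˢ tsupport y)}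

lemma isCompact_greenSet (x y : C_c(G, A)) : IsCompact (greenSet (N := N) x y) :=
  isCompact_subgroup_preimage N ((x.hasCompactSupport.isCompact.prod
    y.hasCompactSupport.isCompact).image (by fun_prop))

lemma greenIntegrand_eq_zero_right (x y : C_c(G, A)) (n : N) (t : G)
    (hn : n ∉ greenSet x y) : greenIntegrand α x y n t = 0 := by
  by_contra h
  refine hn ⟨(t⁻¹, t⁻¹ * n), ⟨subset_tsupport _ fun h' => ?_, subset_tsupport _ fun h' => ?_⟩, ?_⟩
  · exact h (by simp [greenIntegrand, h'])
  · exact h (by simp [greenIntegrand, h'])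
  · simp

lemma isCompact_greenSupp (x : C_c(G, A)) : IsCompact (tsupport x)⁻¹ :=
  x.hasCompactSupport.isCompact.inv

/-- Green's inner product on `C_c(G, A)` with values in `C_c(N, A) ⊆ A ⋊_α N`:
`⟨x, y⟩(n) = Δ_N(n)^{-1/2} ∫_G α_t(x(t⁻¹)^* y(t⁻¹n)) dt`. -/
def greenInner (x y : C_c(G, A)) : C_c(N, A) where
  toFun n := (√(modularFn n))⁻¹ • ∫ t, α t (star (x t⁻¹) * y (t⁻¹ * n)) ∂μG
  continuous_toFun := by
    refine continuous_wt.smul ?_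
    rw [← continuousOn_univ]
    exact continuousOn_integral_of_compact_support (isCompact_greenSupp x)
      (continuous_greenIntegrand hα x y).continuousOn
      (fun n t _ ht => greenIntegrand_eq_zero_left x y n t ht)
  hasCompactSupport' := HasCompactSupport.intro (isCompact_greenSet x y) (fun n hn => by
    have : ∀ t, α t (star (x t⁻¹) * y (t⁻¹ * n)) = 0 := fun t =>
      greenIntegrand_eq_zero_right x y n t hn
    simp [this])

/-- The function `t ↦ π(α_t⁻¹(x(t)))h`. -/
def greenVec (x : C_c(G, A)) (h : σ.H) : C_c(G, σ.H) where
  toFun t := σ.π (α t⁻¹ (x t)) h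
  continuous_toFun := by
    have h1 : Continuous fun t => (t⁻¹, x t) := continuous_inv.prodMk x.continuous
    have h2 := σ.continuous_π.comp (hα.continuous_uncurry.comp h1)
    exact h2.clm_apply continuous_const
  hasCompactSupport' := by
    refine x.hasCompactSupport.mono fun t ht h => ht ?_
    simp [h]

lemma greenVec_apply (x : C_c(G, A)) (h : σ.H) (t : G) :
    greenVec hα σ x h t = σ.π (α t⁻¹ (x t)) h := rfl

lemma action_apply_mul (s t : G) (a : A) : α (s * t) a = α s (α t a) := by
  rw [map_mul]; rfl

lemma action_apply_inv (s : G) (a : A) : α s (α s⁻¹ a) = a := by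
  rw [← action_apply_mul, mul_inv_cancel, map_one]; rfl

/-- The pairing `⟪h, (π ⋊ U)(⟨x, y⟩) k⟫`. -/
def greenPair (x : C_c(G, A)) (h : σ.H) (y : C_c(G, A)) (k : σ.H) : ℂ :=
  inner ℂ h (σ.integratedForm μN (toCrossedProduct _ μN (greenInner hα μG x y)) k)

lemma CovRep.π_real_smul (r : ℝ) (a : A) : σ.π (r • a) = r • σ.π a := by
  have := map_smul σ.π (r : ℂ) a
  simpa only [Complex.coe_smul] using this

lemma CovRep.π_mul_apply (a b : A) (h : σ.H) : σ.π (a * b) h = σ.π a (σ.π b h) := by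
  rw [map_mul]; rfl

lemma CovRep.inner_π_smul (r : ℝ) (a b : A) (h k : σ.H) :
    inner ℂ (σ.π a h) (r • σ.π b k) = inner ℂ h (σ.π (r • (star a * b)) k) := by
  rw [CovRep.inner_π, CovRep.π_real_smul, smul_apply, CovRep.π_mul_apply,
    ContinuousLinearMap.map_smul_of_tower]

lemma CovRep.U_π_translate (a : A) (k : σ.H) (t : G) (n : N) :
    (σ.U n : σ.H →L[ℂ] σ.H) (σ.π (α (t⁻¹ * (n : G))⁻¹ a) k) =
      σ.π (α t a) ((σ.U n : σ.H →L[ℂ] σ.H) k) := by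
  have h1 : (α.comp N.subtype) n (α (t⁻¹ * (n : G))⁻¹ a) = α t a := by
    change α (n : G) _ = _
    rw [← action_apply_mul, mul_inv_rev, inv_inv, mul_inv_cancel_left]
  exact (σ.U_π n _ k).trans
    (congrArg (fun a => σ.π a ((σ.U n : σ.H →L[ℂ] σ.H) k)) h1)

lemma greenIntegrand_eq (x y : C_c(G, A)) (t : G) (n : N) :
    greenIntegrand α x y n t = star (α t (x t⁻¹)) * α t (y (t⁻¹ * n)) := by
  rw [greenIntegrand, map_mul (α t), map_star (α t)]

lemma greenPair_key (x : C_c(G, A)) (h : σ.H) (y : C_c(G, A)) (k : σ.H) (t : G) (n : N) :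
    inner ℂ (greenVec hα σ x h t⁻¹) (fibIntegrand σ (greenVec hα σ y k) t⁻¹ n) =
      inner ℂ h (σ.π (wt n • greenIntegrand α x y n t) ((σ.U n : σ.H →L[ℂ] σ.H) k)) := by
  have e1 : greenVec hα σ x h t⁻¹ = σ.π (α t (x t⁻¹)) h :=
    congrArg (fun s : G => σ.π (α s (x t⁻¹)) h) (inv_inv t)
  have e2 : fibIntegrand σ (greenVec hα σ y k) t⁻¹ n =
      wt n • σ.π (α t (y (t⁻¹ * n))) ((σ.U n : σ.H →L[ℂ] σ.H) k) :=
    congrArg (fun v => wt n • v) (σ.U_π_translate (y (t⁻¹ * n)) k t n)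
  rw [e1, e2]
  refine (σ.inner_π_smul _ _ _ _ _).trans ?_
  exact congrArg (fun a => inner ℂ h (σ.π (wt n • a) ((σ.U n : σ.H →L[ℂ] σ.H) k)))
    (greenIntegrand_eq (α := α) x y t n).symm

lemma continuous_wt_greenIntegrand (hα : IsContinuousAction α) (x y : C_c(G, A)) :
    Continuous fun p : N × G => wt p.1 • greenIntegrand α x y p.1 p.2 :=
  (continuous_wt.comp continuous_fst).smul (continuous_greenIntegrand hα x y)

lemma integrable_wt_greenIntegrand (hα : IsContinuousAction α) (x y : C_c(G, A)) (n : N) :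
    Integrable (fun t => wt n • greenIntegrand α x y n t) μG := by
  apply Continuous.integrable_of_hasCompactSupport
  · exact (continuous_wt_greenIntegrand hα x y).comp (continuous_const.prodMk continuous_id)
  · exact HasCompactSupport.intro (isCompact_greenSupp x) fun t ht => by
      rw [greenIntegrand_eq_zero_left x y n t ht, smul_zero]

/-- The operator `a ↦ π(a) h`. -/
def CovRep.orbit (h : σ.H) : A →L[ℂ] σ.H :=
  LinearMap.mkContinuous
    { toFun := fun a => σ.π a h
      map_add' := fun a b => by simp
      map_smul' := fun c a => by simp } ‖h‖ (fun a => by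
        refine ((σ.π a).le_opNorm _).trans ?_
        rw [mul_comm]
        gcongr
        exact σ.norm_π_le a)

lemma CovRep.orbit_apply (h : σ.H) (a : A) : σ.orbit h a = σ.π a h := rfl

lemma π_greenInner (x y : C_c(G, A)) (n : N) (k : σ.H) :
    σ.π (greenInner hα μG x y n) k =
      ∫ t, σ.π (wt n • greenIntegrand α x y n t) k ∂μG := by
  have := (σ.orbit k).integral_comp_comm (integrable_wt_greenIntegrand μG hα x y n)
  rw [integral_smul] at this
  exact this.symm

lemma continuous_π_greenIntegrand (hα : IsContinuousAction α) (x y : C_c(G, A)) (k : σ.H) :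
    Continuous fun p : N × G =>
      σ.π (wt p.1 • greenIntegrand α x y p.1 p.2) ((σ.U p.1 : σ.H →L[ℂ] σ.H) k) :=
  (σ.continuous_π.comp (continuous_wt_greenIntegrand hα x y)).clm_apply
    ((σ.isCovariant.continuous k).comp continuous_fst)

lemma integrable_π_greenIntegrand (hα : IsContinuousAction α) (x y : C_c(G, A)) (k : σ.H) (n : N) :
    Integrable (fun t => σ.π (wt n • greenIntegrand α x y n t) k) μG :=
  (σ.orbit k).integrable_comp (integrable_wt_greenIntegrand μG hα x y n)

lemma greenPair_eq_integral (x : C_c(G, A)) (h : σ.H) (y : C_c(G, A)) (k : σ.H) :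
    greenPair hα μG μN σ x h y k = ∫ n, ∫ t, inner ℂ h
      (σ.π (wt n • greenIntegrand α x y n t) ((σ.U n : σ.H →L[ℂ] σ.H) k)) ∂μG ∂μN := by
  change inner ℂ h
    (∫ n, σ.π (greenInner hα μG x y n) ((σ.U n : σ.H →L[ℂ] σ.H) k) ∂μN) = _
  rw [← integral_inner (σ.integrable μN _ k)]
  refine integral_congr_ae (Filter.Eventually.of_forall fun n => ?_)
  change inner ℂ h (σ.π (greenInner hα μG x y n) ((σ.U n : σ.H →L[ℂ] σ.H) k)) = _
  rw [π_greenInner, ← integral_inner (integrable_π_greenIntegrand μG σ hα x y _ n)]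

lemma integral_inv_eq {E : Type*} [NormedAddCommGroup E] [NormedSpace ℝ E] (f : G → E) :
    ∫ t, f t ∂μG.inv = ∫ t, f t⁻¹ ∂μG :=
  (Homeomorph.inv G).measurableEmbedding.integral_map f

lemma greenVec_form_eq_integral (x : C_c(G, A)) (h : σ.H) (y : C_c(G, A)) (k : σ.H) :
    form μG μN σ (greenVec hα σ x h) (greenVec hα σ y k) = ∫ t, ∫ n, inner ℂ h
      (σ.π (wt n • greenIntegrand α x y n t) ((σ.U n : σ.H →L[ℂ] σ.H) k)) ∂μN ∂μG := by
  rw [form, integral_inv_eq]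
  refine integral_congr_ae (Filter.Eventually.of_forall fun t => ?_)
  change inner ℂ (greenVec hα σ x h t⁻¹)
    (∫ n, fibIntegrand σ (greenVec hα σ y k) t⁻¹ n ∂μN) = _
  rw [← integral_inner (integrable_fibIntegrand μN σ _ _)]
  exact integral_congr_ae (Filter.Eventually.of_forall fun n =>
    (greenPair_key hα σ x h y k t n))

lemma greenPair_eq_form (x : C_c(G, A)) (h : σ.H) (y : C_c(G, A)) (k : σ.H) :
    greenPair hα μG μN σ x h y k =
      form μG μN σ (greenVec hα σ x h) (greenVec hα σ y k) := by
  rw [greenPair_eq_integral, greenVec_form_eq_integral]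
  refine integral_integral_swap_of_hasCompactSupport
    (continuous_const.inner (continuous_π_greenIntegrand σ hα x y k)) ?_
  refine HasCompactSupport.intro ((isCompact_greenSet x y).prod (isCompact_greenSupp x)) ?_
  rintro ⟨n, t⟩ hp
  have : greenIntegrand α x y n t = 0 := by
    by_cases hn : n ∈ greenSet x y
    · exact greenIntegrand_eq_zero_left x y n t fun ht => hp ⟨hn, ht⟩
    · exact greenIntegrand_eq_zero_right x y n t hn
  simp only [Function.uncurry, this, smul_zero, map_zero, zero_apply,
    inner_zero_right]

/-- `greenVec` as a bilinear map. -/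
def greenVecBilin : C_c(G, A) →ₗ[ℂ] σ.H →ₗ[ℂ] C_c(G, σ.H) :=
  LinearMap.mk₂ ℂ (greenVec hα σ)
    (fun x y h => by ext t; simp [greenVec_apply])
    (fun c x h => by ext t; simp [greenVec_apply])
    (fun x h k => by ext t; simp [greenVec_apply])
    (fun c x h => by ext t; simp [greenVec_apply])

/-- `greenVec` on the algebraic tensor product. -/
def greenVecLift : C_c(G, A) ⊗[ℂ] σ.H →ₗ[ℂ] C_c(G, σ.H) :=
  TensorProduct.lift (greenVecBilin hα σ)

@[simp] lemma greenVecLift_tmul (x : C_c(G, A)) (h : σ.H) :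
    greenVecLift hα σ (x ⊗ₜ h) = greenVec hα σ x h := rfl

lemma greenVec_add_left (x y : C_c(G, A)) (h : σ.H) :
    greenVec hα σ (x + y) h = greenVec hα σ x h + greenVec hα σ y h :=
  LinearMap.map_add₂ (greenVecBilin hα σ) x y h

lemma greenVec_smul_left (c : ℂ) (x : C_c(G, A)) (h : σ.H) :
    greenVec hα σ (c • x) h = c • greenVec hα σ x h :=
  LinearMap.map_smul₂ (greenVecBilin hα σ) c x h

lemma greenVec_add_right (x : C_c(G, A)) (h k : σ.H) :
    greenVec hα σ x (h + k) = greenVec hα σ x h + greenVec hα σ x k :=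
  map_add (greenVecBilin hα σ x) h k

lemma greenVec_smul_right (c : ℂ) (x : C_c(G, A)) (h : σ.H) :
    greenVec hα σ x (c • h) = c • greenVec hα σ x h :=
  map_smul (greenVecBilin hα σ x) c h

/-- The linear functional `y ⊗ k ↦ ⟪h, (π ⋊ U)(⟨x, y⟩) k⟫`. -/
def greenFunctional (x : C_c(G, A)) (h : σ.H) : C_c(G, A) ⊗[ℂ] σ.H →ₗ[ℂ] ℂ :=
  TensorProduct.lift (LinearMap.mk₂ ℂ (greenPair hα μG μN σ x h)
    (fun y y' k => by simp only [greenPair_eq_form, greenVec_add_left, form_add_right])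
    (fun c y k => by
      simp only [greenPair_eq_form, greenVec_smul_left, form_smul_right, smul_eq_mul])
    (fun y k k' => by simp only [greenPair_eq_form, greenVec_add_right, form_add_right])
    (fun c y k => by
      simp only [greenPair_eq_form, greenVec_smul_right, form_smul_right, smul_eq_mul]))

lemma greenFunctional_eq (x : C_c(G, A)) (h : σ.H) (w : C_c(G, A) ⊗[ℂ] σ.H) :
    greenFunctional hα μG μN σ x h w =
      form μG μN σ (greenVec hα σ x h) (greenVecLift hα σ w) := by
  induction w with
  | zero =>
    have := form_smul_right μG μN σ 0 (greenVec hα σ x h) 0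
    simp only [zero_smul, zero_mul] at this
    rw [map_zero, map_zero, this]
  | tmul y k => exact greenPair_eq_form hα μG μN σ x h y k
  | add w w' hw hw' => rw [map_add, map_add, form_add_right, hw, hw']

/-- The sesquilinear form on the algebraic tensor product `C_c(G, A) ⊙ H` with
`⟪x ⊗ h, y ⊗ k⟫ = ⟪h, (π ⋊ U)(⟨x, y⟩) k⟫`, for Green's `A ⋊_α N`-valued inner product. -/
def greenForm : C_c(G, A) ⊗[ℂ] σ.H →ₗ⋆[ℂ] C_c(G, A) ⊗[ℂ] σ.H →ₗ[ℂ] ℂ :=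
  TensorProduct.lift (LinearMap.mk₂'ₛₗ (starRingEnd ℂ) (starRingEnd ℂ)
    (greenFunctional hα μG μN σ)
    (fun x x' h => by
      refine LinearMap.ext fun w => ?_
      simp only [LinearMap.add_apply, greenFunctional_eq, greenVec_add_left, form_add_left])
    (fun c x h => by
      refine LinearMap.ext fun w => ?_
      simp only [LinearMap.smul_apply, greenFunctional_eq, greenVec_smul_left, form_smul_left,
        smul_eq_mul])
    (fun x h h' => by
      refine LinearMap.ext fun w => ?_
      simp only [LinearMap.add_apply, greenFunctional_eq, greenVec_add_right, form_add_left])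
    (fun c x h => by
      refine LinearMap.ext fun w => ?_
      simp only [LinearMap.smul_apply, greenFunctional_eq, greenVec_smul_right, form_smul_left,
        smul_eq_mul]))

lemma greenForm_tmul (x y : C_c(G, A)) (h k : σ.H) :
    greenForm hα μG μN σ (x ⊗ₜ h) (y ⊗ₜ k) =
      inner ℂ h (σ.integratedForm μN (toCrossedProduct _ μN (greenInner hα μG x y)) k) := rfl

lemma greenForm_eq (v w : C_c(G, A) ⊗[ℂ] σ.H) :
    greenForm hα μG μN σ v w =
      form μG μN σ (greenVecLift hα σ v) (greenVecLift hα σ w) := by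
  induction v with
  | zero =>
    have := form_smul_left μG μN σ 0 0 (greenVecLift hα σ w)
    simp only [zero_smul, map_zero, zero_mul] at this
    rw [map_zero, map_zero, this]
    rfl
  | tmul x h => exact greenFunctional_eq hα μG μN σ x h w
  | add v v' hv hv' => rw [map_add, map_add, form_add_left, LinearMap.add_apply, hv, hv']

/-- The pre-inner product space `C_c(G, A) ⊙ H`. -/
@[reducible] def greenCore : PreInnerProductSpace.Core ℂ (C_c(G, A) ⊗[ℂ] σ.H) where
  inner v w := greenForm hα μG μN σ v w
  conj_inner_symm v w := by rw [greenForm_eq, greenForm_eq, form_conj]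
  re_inner_nonneg v := by
    rw [greenForm_eq]
    exact form_self_nonneg μG μN σ _
  add_left u v w := by simp
  smul_left v w c := by simp

/-- The algebraic tensor product `C_c(G, A) ⊙ H`, with the pre-inner product
`⟪x ⊗ h, y ⊗ k⟫ = ⟪h, (π ⋊ U)(⟨x, y⟩) k⟫`. -/
@[nolint unusedArguments]
def GreenPre (_hα : IsContinuousAction α) (_μG : Measure G) (_μN : Measure N)
    (σ : CovRep (α.comp N.subtype)) : Type u :=
  C_c(G, A) ⊗[ℂ] σ.H

instance : SeminormedAddCommGroup (GreenPre hα μG μN σ) :=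
  @InnerProductSpace.Core.toSeminormedAddCommGroup ℂ (C_c(G, A) ⊗[ℂ] σ.H) _ _ _
    (greenCore hα μG μN σ)

instance : InnerProductSpace ℂ (GreenPre hα μG μN σ) :=
  @InnerProductSpace.ofCore ℂ (C_c(G, A) ⊗[ℂ] σ.H) _ _ _ (greenCore hα μG μN σ)

/-- The identification of the algebraic tensor product with the pre-inner product space. -/
def GreenPre.of : C_c(G, A) ⊗[ℂ] σ.H →ₗ[ℂ] GreenPre hα μG μN σ where
  toFun v := v
  map_add' _ _ := rfl
  map_smul' _ _ := rfl

lemma GreenPre.inner_of (v w : C_c(G, A) ⊗[ℂ] σ.H) :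
    inner ℂ (GreenPre.of hα μG μN σ v) (GreenPre.of hα μG μN σ w) =
      greenForm hα μG μN σ v w := rfl

/-- The Hilbert space `X_N^G ⊗_{A ⋊ N} H` of the representation induced from `π ⋊ U`. Since
`C_c(G, A)` is dense in Green's bimodule `X_N^G`, it is the Hausdorff completion of the algebraic
tensor product `C_c(G, A) ⊙ H` in the pre-inner product
`⟪x ⊗ h, y ⊗ k⟫ = ⟪h, (π ⋊ U)(⟨x, y⟩) k⟫`. -/
abbrev GreenSpace : Type u := UniformSpace.Completion (GreenPre hα μG μN σ)

/-- The canonical map from `C_c(G, A) ⊙ H` to `X_N^G ⊗_{A ⋊ N} H`. -/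
def GreenSpace.of : C_c(G, A) ⊗[ℂ] σ.H →ₗ[ℂ] GreenSpace hα μG μN σ :=
  (UniformSpace.Completion.toComplL (𝕜 := ℂ) (E := GreenPre hα μG μN σ)).toLinearMap.comp
    (GreenPre.of hα μG μN σ)

end Green

section GreenOps

variable {G A : Type u} [Group G] [TopologicalSpace G] [IsTopologicalGroup G]
  [LocallyCompactSpace G] [T2Space G] [MeasurableSpace G] [BorelSpace G] [NonUnitalCStarAlgebra A]
  {α : G →* (A ≃⋆ₐ[ℂ] A)} (hα : IsContinuousAction α)
  {N : Subgroup G} [hN : IsClosed (N : Set G)]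
  (μG : Measure G) [μG.IsHaarMeasure] [μG.Regular]
  (μN : Measure N) [μN.IsHaarMeasure] [μN.Regular]
  (σ : CovRep (α.comp N.subtype))

lemma GreenSpace.inner_of (v w : C_c(G, A) ⊗[ℂ] σ.H) :
    inner ℂ (GreenSpace.of hα μG μN σ v) (GreenSpace.of hα μG μN σ w) =
      greenForm hα μG μN σ v w :=
  UniformSpace.Completion.inner_coe (𝕜 := ℂ) (GreenPre.of hα μG μN σ v) (GreenPre.of hα μG μN σ w)

lemma GreenSpace.inner_of_eq_form (v w : C_c(G, A) ⊗[ℂ] σ.H) :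
    inner ℂ (GreenSpace.of hα μG μN σ v) (GreenSpace.of hα μG μN σ w) =
      form μG μN σ (greenVecLift hα σ v) (greenVecLift hα σ w) :=
  (GreenSpace.inner_of hα μG μN σ v w).trans (greenForm_eq hα μG μN σ v w)

lemma GreenSpace.norm_of_sq (v : C_c(G, A) ⊗[ℂ] σ.H) :
    ‖GreenSpace.of hα μG μN σ v‖ ^ 2 =
      (form μG μN σ (greenVecLift hα σ v) (greenVecLift hα σ v)).re := by
  rw [← GreenSpace.inner_of_eq_form]
  exact norm_sq_eq_re_inner (𝕜 := ℂ) (GreenSpace.of hα μG μN σ v)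

lemma GreenPre.norm_of_sq (v : C_c(G, A) ⊗[ℂ] σ.H) :
    ‖GreenPre.of hα μG μN σ v‖ ^ 2 =
      (form μG μN σ (greenVecLift hα σ v) (greenVecLift hα σ v)).re := by
  rw [← greenForm_eq]
  exact norm_sq_eq_re_inner (𝕜 := ℂ) (GreenPre.of hα μG μN σ v)

lemma GreenSpace.induction {p : GreenSpace hα μG μN σ → Prop} (z : GreenSpace hα μG μN σ)
    (hc : IsClosed {z | p z}) (h : ∀ v, p (GreenSpace.of hα μG μN σ v)) : p z :=
  UniformSpace.Completion.induction_on z hc h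

lemma GreenSpace.ext_tmul {E : Type*} [NormedAddCommGroup E] [NormedSpace ℂ E]
    {T S : GreenSpace hα μG μN σ →L[ℂ] E}
    (h : ∀ x k, T (GreenSpace.of hα μG μN σ (x ⊗ₜ k)) = S (GreenSpace.of hα μG μN σ (x ⊗ₜ k))) :
    T = S := by
  refine ContinuousLinearMap.ext fun z => ?_
  refine GreenSpace.induction hα μG μN σ z (isClosed_eq T.continuous S.continuous) fun v => ?_
  induction v with
  | zero => rw [map_zero, map_zero, map_zero]
  | tmul x k => exact h x k
  | add v w hv hw => rw [map_add, map_add, map_add, hv, hw]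

lemma GreenPre.norm_map_le (T : C_c(G, A) →ₗ[ℂ] C_c(G, A)) (C : ℝ) (hC : 0 ≤ C)
    (hT : ∀ v, (form μG μN σ (greenVecLift hα σ (T.rTensor σ.H v))
      (greenVecLift hα σ (T.rTensor σ.H v))).re ≤
        C ^ 2 * (form μG μN σ (greenVecLift hα σ v) (greenVecLift hα σ v)).re)
    (v : C_c(G, A) ⊗[ℂ] σ.H) :
    ‖GreenPre.of hα μG μN σ (T.rTensor σ.H v)‖ ≤ C * ‖GreenPre.of hα μG μN σ v‖ := by
  refine le_of_sq_le_sq ?_ (mul_nonneg hC (norm_nonneg _))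
  rw [mul_pow, GreenPre.norm_of_sq, GreenPre.norm_of_sq]
  exact hT v

/-- The operator `T ⊗ 1` on `X_N^G ⊗_{A ⋊ N} H`, for a linear map `T` on `C_c(G, A)` such that it
is bounded. -/
def GreenSpace.op (T : C_c(G, A) →ₗ[ℂ] C_c(G, A)) (C : ℝ) (hC : 0 ≤ C)
    (hT : ∀ v, (form μG μN σ (greenVecLift hα σ (T.rTensor σ.H v))
      (greenVecLift hα σ (T.rTensor σ.H v))).re ≤
        C ^ 2 * (form μG μN σ (greenVecLift hα σ v) (greenVecLift hα σ v)).re) :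
    GreenSpace hα μG μN σ →L[ℂ] GreenSpace hα μG μN σ :=
  ContinuousLinearMap.completion (LinearMap.mkContinuous
    (show GreenPre hα μG μN σ →ₗ[ℂ] GreenPre hα μG μN σ from
      { toFun := fun v => GreenPre.of hα μG μN σ (T.rTensor σ.H v)
        map_add' := fun v w => (T.rTensor σ.H).map_add v w
        map_smul' := fun c v => (T.rTensor σ.H).map_smul c v }) C (GreenPre.norm_map_le hα μG μN σ T C hC hT))

lemma GreenSpace.op_of (T : C_c(G, A) →ₗ[ℂ] C_c(G, A)) (C : ℝ) (hC : 0 ≤ C)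
    (hT : ∀ v, (form μG μN σ (greenVecLift hα σ (T.rTensor σ.H v))
      (greenVecLift hα σ (T.rTensor σ.H v))).re ≤
        C ^ 2 * (form μG μN σ (greenVecLift hα σ v) (greenVecLift hα σ v)).re)
    (v : C_c(G, A) ⊗[ℂ] σ.H) :
    GreenSpace.op hα μG μN σ T C hC hT (GreenSpace.of hα μG μN σ v) =
      GreenSpace.of hα μG μN σ (T.rTensor σ.H v) :=
  ContinuousLinearMap.completion_apply_coe _ _

/-- The left action of `f ∈ C_0(G/N, A)` on `C_c(G, A)`: `(f · x)(s) = f(sN) x(s)`. -/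
def leftMul (f : C₀(G ⧸ N, A)) : C_c(G, A) →ₗ[ℂ] C_c(G, A) where
  toFun x :=
    { toFun := fun s => f (s : G ⧸ N) * x s
      continuous_toFun := (f.continuous.comp continuous_quotient_mk').mul x.continuous
      hasCompactSupport' := HasCompactSupport.mul_left x.hasCompactSupport }
  map_add' x y := by ext s; exact mul_add _ _ _
  map_smul' c x := by ext s; exact mul_smul_comm _ _ _

lemma leftMul_apply (f : C₀(G ⧸ N, A)) (x : C_c(G, A)) (s : G) :
    leftMul f x s = f (s : G ⧸ N) * x s := rfl

lemma continuous_transl (hα : IsContinuousAction α) (x : C_c(G, A)) : Continuous fun p : G × G =>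
    √(modularFn p.1) • α p.1 (x (p.1⁻¹ * p.2)) := by
  have h1 : Continuous fun p : G × G => (p.1, x (p.1⁻¹ * p.2)) :=
    continuous_fst.prodMk (x.continuous.comp (continuous_fst.inv.mul continuous_snd))
  exact ((Real.continuous_sqrt.comp continuous_modularFn).comp continuous_fst).smul
    (hα.continuous_uncurry.comp h1)

/-- The left action of `s ∈ G` on `C_c(G, A)`: `(s · x)(r) = Δ_G(s)^{1/2} α_s(x(s⁻¹r))`. -/
def leftTransl (s : G) : C_c(G, A) →ₗ[ℂ] C_c(G, A) where
  toFun x :=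
    { toFun := fun r => √(modularFn s) • α s (x (s⁻¹ * r))
      continuous_toFun := (continuous_transl hα x).comp (continuous_const.prodMk continuous_id)
      hasCompactSupport' := by
        have h := x.hasCompactSupport.comp_homeomorph (Homeomorph.mulLeft s⁻¹)
        refine h.mono fun r hr h' => hr ?_
        have h'' : x (s⁻¹ * r) = 0 := h'
        change √(modularFn s) • α s (x (s⁻¹ * r)) = 0
        rw [h'', map_zero, smul_zero] }
  map_add' x y := by
    ext r
    change √(modularFn s) • α s (x (s⁻¹ * r) + y (s⁻¹ * r)) = _
    rw [map_add, smul_add]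
    rfl
  map_smul' c x := by
    ext r
    change √(modularFn s) • α s (c • x (s⁻¹ * r)) = _
    rw [map_smul, smul_comm]
    rfl

lemma leftTransl_apply (s : G) (x : C_c(G, A)) (r : G) :
    leftTransl hα s x r = √(modularFn s) • α s (x (s⁻¹ * r)) := rfl

/-- The field of operators by which `leftMul f` acts. -/
def mulField (f : C₀(G ⧸ N, A)) (t : G) : σ.H →L[ℂ] σ.H := σ.π (α t⁻¹ (f (t : G ⧸ N)))

lemma norm_mulField_le (f : C₀(G ⧸ N, A)) (t : G) : ‖mulField σ f t‖ ≤ ‖f‖ := by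
  refine (σ.norm_π_le _).trans ?_
  rw [norm_starAlgEquiv]
  exact f.toBCF.norm_coe_le_norm (t : G ⧸ N)

lemma greenVecLift_leftMul (f : C₀(G ⧸ N, A)) (v : C_c(G, A) ⊗[ℂ] σ.H) (t : G) :
    greenVecLift hα σ ((leftMul f).rTensor σ.H v) t = mulField σ f t (greenVecLift hα σ v t) := by
  induction v with
  | zero =>
    rw [map_zero, map_zero]
    exact (map_zero (mulField σ f t)).symm
  | tmul x h =>
    change σ.π (α t⁻¹ (f (t : G ⧸ N) * x t)) h =
      σ.π (α t⁻¹ (f (t : G ⧸ N))) (σ.π (α t⁻¹ (x t)) h)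
    rw [map_mul (α t⁻¹), CovRep.π_mul_apply]
  | add v w hv hw =>
    rw [map_add, map_add, map_add, CompactlySupportedContinuousMap.add_apply,
      CompactlySupportedContinuousMap.add_apply, map_add, hv, hw]

lemma U_mulField (f : C₀(G ⧸ N, A)) (t : G) (n : N) (k : σ.H) :
    (σ.U n : σ.H →L[ℂ] σ.H) (mulField σ f (t * n) k) =
      mulField σ f t ((σ.U n : σ.H →L[ℂ] σ.H) k) := by
  have h1 : ((t * n : G) : G ⧸ N) = (t : G ⧸ N) := QuotientGroup.mk_mul_of_mem t n.2
  have h2 : (α.comp N.subtype) n (α (t * n : G)⁻¹ (f ((t * n : G) : G ⧸ N))) =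
      α t⁻¹ (f (t : G ⧸ N)) := by
    change α (n : G) _ = _
    rw [h1, ← action_apply_mul, mul_inv_rev, mul_inv_cancel_left]
  exact (σ.U_π n _ k).trans
    (congrArg (fun a => σ.π a ((σ.U n : σ.H →L[ℂ] σ.H) k)) h2)

lemma fibInt_mulField (f : C₀(G ⧸ N, A)) (ξ ξ' : C_c(G, σ.H))
    (h : ∀ t, ξ' t = mulField σ f t (ξ t)) (t : G) :
    fibInt μN σ ξ' t = mulField σ f t (fibInt μN σ ξ t) := by
  rw [fibInt, fibInt, ← ContinuousLinearMap.integral_comp_comm _ (integrable_fibIntegrand μN σ ξ t)]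
  refine integral_congr_ae (Filter.Eventually.of_forall fun n => ?_)
  change wt n • (σ.U n : σ.H →L[ℂ] σ.H) (ξ' (t * n)) =
    mulField σ f t (wt n • (σ.U n : σ.H →L[ℂ] σ.H) (ξ (t * n)))
  rw [h, U_mulField, ContinuousLinearMap.map_smul_of_tower]

lemma greenVecLift_leftTransl (s : G) (v : C_c(G, A) ⊗[ℂ] σ.H) (t : G) :
    greenVecLift hα σ ((leftTransl hα s).rTensor σ.H v) t =
      √(modularFn s) • greenVecLift hα σ v (s⁻¹ * t) := by
  induction v with
  | zero =>
    rw [map_zero, map_zero]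
    exact (smul_zero _).symm
  | tmul x h =>
    change σ.π (α t⁻¹ (√(modularFn s) • α s (x (s⁻¹ * t)))) h =
      √(modularFn s) • σ.π (α (s⁻¹ * t)⁻¹ (x (s⁻¹ * t))) h
    have : α t⁻¹ (√(modularFn s) • α s (x (s⁻¹ * t))) =
        √(modularFn s) • α (s⁻¹ * t)⁻¹ (x (s⁻¹ * t)) := by
      have h1 := map_smul (α t⁻¹) ((√(modularFn s) : ℝ) : ℂ) (α s (x (s⁻¹ * t)))
      simp only [Complex.coe_smul] at h1
      rw [h1, ← action_apply_mul, mul_inv_rev, inv_inv]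
    rw [this, CovRep.π_real_smul]
    rfl
  | add v w hv hw =>
    rw [map_add, map_add, map_add, CompactlySupportedContinuousMap.add_apply,
      CompactlySupportedContinuousMap.add_apply, smul_add, hv, hw]

/-- The operator `x ⊗ h ↦ (f · x) ⊗ h`. -/
def mulOp (f : C₀(G ⧸ N, A)) : GreenSpace hα μG μN σ →L[ℂ] GreenSpace hα μG μN σ :=
  GreenSpace.op hα μG μN σ (leftMul f) ‖f‖ (norm_nonneg _) (fun v =>
    form_self_le μG μN σ _ _ (mulField σ f) ‖f‖ (norm_mulField_le σ f)
      (greenVecLift_leftMul hα σ f v)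
      (fibInt_mulField μN σ f _ _ (greenVecLift_leftMul hα σ f v)))

lemma mulOp_of (f : C₀(G ⧸ N, A)) (v : C_c(G, A) ⊗[ℂ] σ.H) :
    mulOp hα μG μN σ f (GreenSpace.of hα μG μN σ v) =
      GreenSpace.of hα μG μN σ ((leftMul f).rTensor σ.H v) :=
  GreenSpace.op_of hα μG μN σ _ _ _ _ v

lemma mulOp_tmul (f : C₀(G ⧸ N, A)) (x : C_c(G, A)) (h : σ.H) :
    mulOp hα μG μN σ f (GreenSpace.of hα μG μN σ (x ⊗ₜ h)) =
      GreenSpace.of hα μG μN σ (leftMul f x ⊗ₜ h) :=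
  mulOp_of hα μG μN σ f _

/-- The operator `x ⊗ h ↦ (s · x) ⊗ h`. -/
def translOp (s : G) : GreenSpace hα μG μN σ →L[ℂ] GreenSpace hα μG μN σ :=
  GreenSpace.op hα μG μN σ (leftTransl hα s) 1 zero_le_one (fun v => by
    rw [one_pow, one_mul]
    exact le_of_eq (congrArg Complex.re (form_translate μG μN σ s _ _ _ _
      (greenVecLift_leftTransl hα σ s v) (greenVecLift_leftTransl hα σ s v))))

lemma translOp_of (s : G) (v : C_c(G, A) ⊗[ℂ] σ.H) :
    translOp hα μG μN σ s (GreenSpace.of hα μG μN σ v) =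
      GreenSpace.of hα μG μN σ ((leftTransl hα s).rTensor σ.H v) :=
  GreenSpace.op_of hα μG μN σ _ _ _ _ v

lemma translOp_tmul (s : G) (x : C_c(G, A)) (h : σ.H) :
    translOp hα μG μN σ s (GreenSpace.of hα μG μN σ (x ⊗ₜ h)) =
      GreenSpace.of hα μG μN σ (leftTransl hα s x ⊗ₜ h) :=
  translOp_of hα μG μN σ s _

lemma mulField_star (f : C₀(G ⧸ N, A)) (t : G) (h k : σ.H) :
    inner ℂ (mulField σ f t h) k = inner ℂ h (mulField σ (star f) t k) := by
  have : mulField σ (star f) t = σ.π (star (α t⁻¹ (f (t : G ⧸ N)))) := by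
    rw [← map_star (α t⁻¹)]
    rfl
  rw [this]
  exact σ.inner_π _ h k

lemma inner_mulOp (f : C₀(G ⧸ N, A)) (z w : GreenSpace hα μG μN σ) :
    inner ℂ (mulOp hα μG μN σ f z) w = inner ℂ z (mulOp hα μG μN σ (star f) w) := by
  refine GreenSpace.induction hα μG μN σ z (isClosed_eq
    ((mulOp hα μG μN σ f).continuous.inner continuous_const)
    (continuous_id'.inner continuous_const)) fun v => ?_
  refine GreenSpace.induction hα μG μN σ w (isClosed_eq
    (continuous_const.inner continuous_id')
    (continuous_const.inner (mulOp hα μG μN σ (star f)).continuous)) fun v' => ?_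
  rw [mulOp_of, mulOp_of, GreenSpace.inner_of_eq_form, GreenSpace.inner_of_eq_form, form, form]
  refine integral_congr_ae (Filter.Eventually.of_forall fun t => ?_)
  change inner ℂ (greenVecLift hα σ ((leftMul f).rTensor σ.H v) t) _ = inner ℂ _
    (fibInt μN σ (greenVecLift hα σ ((leftMul (star f)).rTensor σ.H v')) t)
  rw [greenVecLift_leftMul, mulField_star,
    fibInt_mulField μN σ (star f) _ _ (greenVecLift_leftMul hα σ (star f) v')]

lemma inner_translOp (s : G) (z w : GreenSpace hα μG μN σ) :
    inner ℂ (translOp hα μG μN σ s z) (translOp hα μG μN σ s w) = inner ℂ z w := by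
  refine GreenSpace.induction hα μG μN σ z (isClosed_eq
    ((translOp hα μG μN σ s).continuous.inner continuous_const)
    (continuous_id'.inner continuous_const)) fun v => ?_
  refine GreenSpace.induction hα μG μN σ w (isClosed_eq
    (continuous_const.inner (translOp hα μG μN σ s).continuous)
    (continuous_const.inner continuous_id')) fun v' => ?_
  rw [translOp_of, translOp_of, GreenSpace.inner_of_eq_form, GreenSpace.inner_of_eq_form]
  exact form_translate μG μN σ s _ _ _ _
      (greenVecLift_leftTransl hα σ s v) (greenVecLift_leftTransl hα σ s v')

lemma translOp_mul (s t : G) :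
    translOp hα μG μN σ (s * t) = translOp hα μG μN σ s * translOp hα μG μN σ t := by
  refine GreenSpace.ext_tmul hα μG μN σ fun x k => ?_
  rw [mul_apply_eq_comp, translOp_tmul, translOp_tmul, translOp_tmul]
  congr 2
  ext r
  change √(modularFn (s * t)) • α (s * t) (x ((s * t)⁻¹ * r)) =
    √(modularFn s) • α s (√(modularFn t) • α t (x (t⁻¹ * (s⁻¹ * r))))
  have h1 := map_smul (α s) ((√(modularFn t) : ℝ) : ℂ) (α t (x (t⁻¹ * (s⁻¹ * r))))
  simp only [Complex.coe_smul] at h1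
  rw [h1, ← action_apply_mul, mul_inv_rev, mul_assoc, smul_smul, modularFn_mul,
    Real.sqrt_mul (modularFn_pos s).le]

lemma translOp_one : translOp hα μG μN σ 1 = 1 := by
  refine GreenSpace.ext_tmul hα μG μN σ fun x k => ?_
  rw [translOp_tmul]
  change _ = GreenSpace.of hα μG μN σ (x ⊗ₜ k)
  congr 2
  ext r
  change √(modularFn (1 : G)) • α 1 (x (1⁻¹ * r)) = x r
  rw [modularFn_one, Real.sqrt_one, one_smul, map_one, inv_one, one_mul]
  rfl

lemma star_translOp (s : G) : star (translOp hα μG μN σ s) = translOp hα μG μN σ s⁻¹ := by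
  symm
  rw [ContinuousLinearMap.star_eq_adjoint, ContinuousLinearMap.eq_adjoint_iff]
  intro z w
  rw [← inner_translOp hα μG μN σ s (translOp hα μG μN σ s⁻¹ z) w, ← mul_apply_eq_comp,
    ← translOp_mul, mul_inv_cancel, translOp_one]
  rfl

/-- The unitary representation `s ↦ (x ⊗ h ↦ (s · x) ⊗ h)` of `G`. -/
def translRep : G →* unitary (GreenSpace hα μG μN σ →L[ℂ] GreenSpace hα μG μN σ) where
  toFun s := ⟨translOp hα μG μN σ s, by
    rw [Unitary.mem_iff, star_translOp, ← translOp_mul, ← translOp_mul, inv_mul_cancel,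
      mul_inv_cancel, translOp_one]
    exact ⟨rfl, rfl⟩⟩
  map_one' := Subtype.ext (translOp_one hα μG μN σ)
  map_mul' s t := Subtype.ext (translOp_mul hα μG μN σ s t)

/-- The representation `f ↦ (x ⊗ h ↦ (f · x) ⊗ h)` of `A ⊗ C_0(G/N) = C_0(G/N, A)`. -/
def mulRep : C₀(G ⧸ N, A) →⋆ₙₐ[ℂ] (GreenSpace hα μG μN σ →L[ℂ] GreenSpace hα μG μN σ) where
  toFun := mulOp hα μG μN σ
  map_smul' c f := by
    refine GreenSpace.ext_tmul hα μG μN σ fun x k => ?_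
    rw [MonoidHom.id_apply, smul_apply, mulOp_tmul, mulOp_tmul, ← map_smul,
      TensorProduct.smul_tmul']
    congr 2
    ext s
    exact smul_mul_assoc _ _ _
  map_zero' := by
    refine GreenSpace.ext_tmul hα μG μN σ fun x k => ?_
    rw [mulOp_tmul, zero_apply]
    have : leftMul (0 : C₀(G ⧸ N, A)) x = 0 := by ext s; exact zero_mul _
    rw [this, TensorProduct.zero_tmul, map_zero]
  map_add' f g := by
    refine GreenSpace.ext_tmul hα μG μN σ fun x k => ?_
    rw [add_apply, mulOp_tmul, mulOp_tmul, mulOp_tmul, ← map_add, ← TensorProduct.add_tmul]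
    congr 2
    ext s
    exact add_mul _ _ _
  map_mul' f g := by
    refine GreenSpace.ext_tmul hα μG μN σ fun x k => ?_
    rw [mul_apply_eq_comp, mulOp_tmul, mulOp_tmul, mulOp_tmul]
    congr 2
    ext s
    exact mul_assoc _ _ _
  map_star' f := by
    rw [ContinuousLinearMap.star_eq_adjoint, ContinuousLinearMap.eq_adjoint_iff]
    intro z w
    rw [inner_mulOp, star_star]

end GreenOps

section GreenInd

variable {G A : Type u} [Group G] [TopologicalSpace G] [IsTopologicalGroup G]
  [LocallyCompactSpace G] [T2Space G] [MeasurableSpace G] [BorelSpace G] [NonUnitalCStarAlgebra A]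
  {α : G →* (A ≃⋆ₐ[ℂ] A)} (hα : IsContinuousAction α)
  {N : Subgroup G} [hN : IsClosed (N : Set G)]
  (μG : Measure G) [μG.IsHaarMeasure] [μG.Regular]
  (μN : Measure N) [μN.IsHaarMeasure] [μN.Regular]
  (σ : CovRep (α.comp N.subtype))

lemma exists_norm_of_tmul_le {S : Set G} (hS : IsCompact S) : ∃ C : ℝ, 0 ≤ C ∧
    ∀ (x : C_c(G, A)) (h : σ.H) (M : ℝ), 0 ≤ M → tsupport x ⊆ S → (∀ t, ‖x t‖ ≤ M) →
      ‖GreenSpace.of hα μG μN σ (x ⊗ₜ h)‖ ≤ C * (M * ‖h‖) := by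
  obtain ⟨C, hC, H⟩ := exists_form_le μG μN σ hS
  refine ⟨√C, Real.sqrt_nonneg _, fun x h M hM hx hxM => ?_⟩
  refine le_of_sq_le_sq ?_ (by positivity)
  rw [GreenSpace.norm_of_sq, mul_pow, Real.sq_sqrt hC]
  refine H (greenVec hα σ x h) (M * ‖h‖) (by positivity) ?_ fun t => ?_
  · have hsub : Function.support (greenVec hα σ x h) ⊆ Function.support x := fun t ht h' => ht (by
      rw [greenVec_apply, h', map_zero, map_zero, zero_apply])
    exact (closure_mono hsub).trans hx
  · rw [greenVec_apply]
    refine ((σ.π _).le_opNorm h).trans ?_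
    gcongr
    refine (σ.norm_π_le _).trans ?_
    rw [norm_starAlgEquiv]
    exact hxM t

/-- A single element acting as an approximate unit on a compact set. -/
lemma exists_approx_unit {S : Set A} (hS : IsCompact S) {ε : ℝ} (hε : 0 < ε) :
    ∃ e : A, ∀ a ∈ S, ‖e * a - a‖ ≤ ε := by
  let _ := CStarAlgebra.spectralOrder A
  let _ := CStarAlgebra.spectralOrderedRing A
  obtain ⟨F, _, hF⟩ := hS.elim_finite_subcover_image (b := S) (c := fun a => Metric.ball a (ε / 3))
    (fun _ _ => Metric.isOpen_ball)
    (fun a ha => Set.mem_biUnion ha (Metric.mem_ball_self (by positivity)))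
  have hu := CStarAlgebra.increasingApproximateUnit A
  have h1 : ∀ᶠ e in CStarAlgebra.approximateUnit A, ∀ a ∈ F, ‖e * a - a‖ < ε / 3 := by
    rw [Filter.eventually_all_finite hF.1]
    intro a _
    have := (Metric.tendsto_nhds.1 (hu.tendsto_mul_right a)) (ε / 3) (by positivity)
    simpa only [dist_eq_norm] using this
  obtain ⟨e, he1, he2⟩ := (h1.and hu.eventually_norm).exists
  refine ⟨e, fun a ha => ?_⟩
  obtain ⟨a', ha', hd⟩ := Set.mem_iUnion₂.1 (hF.2 ha)
  rw [Metric.mem_ball, dist_eq_norm] at hd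
  have e1 : e * a - a = e * (a - a') + (e * a' - a') - (a - a') := by
    rw [mul_sub]; abel
  rw [e1]
  refine (norm_sub_le _ _).trans ?_
  have h2 := norm_add_le (e * (a - a')) (e * a' - a')
  have h3 : ‖e * (a - a')‖ ≤ ‖a - a'‖ :=
    (norm_mul_le _ _).trans (mul_le_of_le_one_left (norm_nonneg _) he2)
  have h4 := he1 a' ha'
  linarith

lemma mulRep_nondegenerate [N.Normal] :
    (Submodule.span ℂ {v : GreenSpace hα μG μN σ | ∃ (f : C₀(G ⧸ N, A))
      (w : GreenSpace hα μG μN σ), mulRep hα μG μN σ f w = v}).topologicalClosure = ⊤ := by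
  rw [eq_top_iff]
  rintro z -
  refine GreenSpace.induction hα μG μN σ z
    (Submodule.isClosed_topologicalClosure _) fun v => ?_
  induction v with
  | zero => rw [map_zero]; exact Submodule.zero_mem _
  | add v w hv hw => rw [map_add]; exact Submodule.add_mem _ hv hw
  | tmul x h =>
    let S := tsupport x
    have hS : IsCompact S := x.hasCompactSupport.isCompact
    obtain ⟨C, hC, H⟩ := exists_norm_of_tmul_le hα μG μN σ hS
    obtain ⟨φ, hφ1, hφc⟩ : ∃ φ : C(G ⧸ N, ℝ), Set.EqOn φ 1 ((fun s : G => (s : G ⧸ N)) '' S) ∧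
        HasCompactSupport φ := by
      obtain ⟨φ, h1, _, h3, _⟩ := exists_continuous_one_zero_of_isCompact
        (hS.image (QuotientGroup.continuous_mk (N := N))) isClosed_empty (Set.disjoint_empty _)
      exact ⟨φ, h1, h3⟩
    rw [← SetLike.mem_coe, Submodule.topologicalClosure_coe, Metric.mem_closure_iff]
    intro ε hε
    let δ : ℝ := ε / (C * ‖h‖ + 1)
    have hpos : 0 < C * ‖h‖ + 1 := by positivity
    have hδ : 0 < δ := div_pos hε hpos
    obtain ⟨e, he⟩ := exists_approx_unit (hS.image x.continuous) hδ
    let f : C₀(G ⧸ N, A) :=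
      { toFun := fun q => φ q • e
        continuous_toFun := φ.continuous.smul continuous_const
        zero_at_infty' := (HasCompactSupport.smul_right (f' := fun _ => e) hφc).is_zero_at_infty }
    refine ⟨mulRep hα μG μN σ f (GreenSpace.of hα μG μN σ (x ⊗ₜ h)),
      Submodule.subset_span ⟨f, _, rfl⟩, ?_⟩
    have e1 : mulRep hα μG μN σ f (GreenSpace.of hα μG μN σ (x ⊗ₜ h)) =
      GreenSpace.of hα μG μN σ (leftMul f x ⊗ₜ h) := mulOp_tmul hα μG μN σ f x h
    rw [e1, dist_comm, dist_eq_norm, ← map_sub, ← TensorProduct.sub_tmul]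
    have hval : ∀ t, (leftMul f x - x) t = φ (t : G ⧸ N) • (e * x t) - x t := fun t =>
      congrArg (fun a => a - x t) (smul_mul_assoc _ _ _)
    refine (H _ h δ hδ.le ?_ ?_).trans_lt ?_
    · refine closure_mono fun t ht h' => ht ?_
      rw [hval, h', mul_zero, smul_zero, sub_zero]
    · intro t
      rw [hval]
      by_cases ht : t ∈ S
      · rw [hφ1 ⟨t, ht, rfl⟩, Pi.one_apply, one_smul]
        exact he _ ⟨t, ht, rfl⟩
      · rw [image_eq_zero_of_notMem_tsupport ht, mul_zero, smul_zero, sub_zero, norm_zero]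
        exact hδ.le
    · have : C * (δ * ‖h‖) = ε * ((C * ‖h‖) / (C * ‖h‖ + 1)) := by
        simp only [δ]; ring
      rw [this]
      exact mul_lt_of_lt_one_right hε ((div_lt_one hpos).2 (lt_add_one _))

lemma continuousAt_translOp_tmul (x : C_c(G, A)) (h : σ.H) (s₀ : G) :
    ContinuousAt (fun s => translOp hα μG μN σ s (GreenSpace.of hα μG μN σ (x ⊗ₜ h))) s₀ := by
  obtain ⟨V, hV, hVs⟩ := exists_compact_mem_nhds s₀
  let S : Set G := (fun p : G × G => p.1 * p.2) '' (V ×ˢ tsupport x)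
  have hS : IsCompact S := (hV.prod x.hasCompactSupport.isCompact).image (by fun_prop)
  obtain ⟨C, hC, H⟩ := exists_norm_of_tmul_le hα μG μN σ hS
  have hs₀ : s₀ ∈ V := mem_of_mem_nhds hVs
  have hz : ∀ s ∈ V, ∀ r, r ∉ S → leftTransl hα s x r = 0 := by
    intro s hs r hr
    have h0 : x (s⁻¹ * r) = 0 := image_eq_zero_of_notMem_tsupport fun h' =>
      hr ⟨(s, s⁻¹ * r), ⟨hs, h'⟩, mul_inv_cancel_left s r⟩
    rw [leftTransl_apply, h0, map_zero, smul_zero]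
  let Ψ : C(G, C(G, A)) := ContinuousMap.curry ⟨_, continuous_transl hα x⟩
  have hΨ : TendstoUniformlyOn (fun s r => Ψ s r) (Ψ s₀) (𝓝 s₀) S :=
    ContinuousMap.tendsto_iff_forall_isCompact_tendstoUniformlyOn.1 (Ψ.continuous.tendsto s₀) S hS
  rw [Metric.tendstoUniformlyOn_iff] at hΨ
  rw [Metric.continuousAt_iff']
  intro ε hε
  let δ : ℝ := ε / (C * ‖h‖ + 1)
  have hpos : 0 < C * ‖h‖ + 1 := by positivity
  have hδ : 0 < δ := div_pos hε hpos
  filter_upwards [hΨ δ hδ, hVs] with s hs hsV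
  rw [translOp_tmul, translOp_tmul, dist_eq_norm, ← map_sub, ← TensorProduct.sub_tmul]
  have hval : ∀ r, (leftTransl hα s x - leftTransl hα s₀ x) r =
    leftTransl hα s x r - leftTransl hα s₀ x r := fun r => rfl
  refine (H _ h δ hδ.le ?_ ?_).trans_lt ?_
  · refine closure_minimal (fun r hr => ?_) hS.isClosed
    by_contra hrS
    refine hr ?_
    rw [hval, hz s hsV r hrS, hz s₀ hs₀ r hrS, sub_zero]
  · intro r
    rw [hval]
    by_cases hr : r ∈ S
    · have := hs r hr
      rw [dist_comm, dist_eq_norm] at this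
      exact this.le
    · rw [hz s hsV r hr, hz s₀ hs₀ r hr, sub_zero, norm_zero]
      exact hδ.le
  · have : C * (δ * ‖h‖) = ε * ((C * ‖h‖) / (C * ‖h‖ + 1)) := by
      simp only [δ]; ring
    rw [this]
    exact mul_lt_of_lt_one_right hε ((div_lt_one hpos).2 (lt_add_one _))

lemma norm_translOp (s : G) (z : GreenSpace hα μG μN σ) : ‖translOp hα μG μN σ s z‖ = ‖z‖ :=
  norm_unitary_apply (translRep hα μG μN σ s) z

lemma continuous_translOp (z : GreenSpace hα μG μN σ) :
    Continuous fun s => translOp hα μG μN σ s z := by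
  refine GreenSpace.induction hα μG μN σ
    (p := fun z => Continuous fun s => translOp hα μG μN σ s z) z ?_ fun v => ?_
  · refine isClosed_of_closure_subset fun z hz => ?_
    refine continuous_of_uniform_approx_of_continuous fun u hu => ?_
    obtain ⟨ε, hε, hεu⟩ := Metric.mem_uniformity_dist.1 hu
    obtain ⟨w, hw, hd⟩ := Metric.mem_closure_iff.1 hz ε hε
    refine ⟨fun s => translOp hα μG μN σ s w, hw, fun s => hεu ?_⟩
    rw [dist_eq_norm, ← map_sub, norm_translOp, ← dist_eq_norm]
    exact hd
  · induction v with
    | zero =>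
      simp only [map_zero]
      exact continuous_const
    | tmul x h => exact continuous_iff_continuousAt.2 (continuousAt_translOp_tmul hα μG μN σ x h)
    | add v w hv hw =>
      simp only [map_add]
      exact hv.add hw

lemma mulOp_covariant [N.Normal] (s : G) (f : C₀(G ⧸ N, A)) :
    translOp hα μG μN σ s * mulOp hα μG μN σ f =
      mulOp hα μG μN σ (alphaLt α N s f) * translOp hα μG μN σ s := by
  refine GreenSpace.ext_tmul hα μG μN σ fun x k => ?_
  rw [mul_apply_eq_comp, mul_apply_eq_comp, mulOp_tmul, translOp_tmul, translOp_tmul, mulOp_tmul]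
  congr 2
  ext r
  change √(modularFn s) • α s (f ((s⁻¹ * r : G) : G ⧸ N) * x (s⁻¹ * r)) =
    α s (f ((s : G ⧸ N)⁻¹ * (r : G ⧸ N))) * (√(modularFn s) • α s (x (s⁻¹ * r)))
  rw [map_mul (α s), mul_smul_comm]
  rfl

variable [N.Normal]

/-- The covariant representation `((ρ ⊗ μ), W)` of `(A ⊗ C_0(G/N), G, α ⊗ lt)` on
`X_N^G ⊗_{A ⋊ N} H` coming from the left actions of `C_0(G/N, A)` and `G` on `X_N^G`. -/
def greenCovRep : CovRep (alphaLt α N) where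
  H := GreenSpace hα μG μN σ
  π := mulRep hα μG μN σ
  U := translRep hα μG μN σ
  isCovariant :=
    { nondegenerate := mulRep_nondegenerate hα μG μN σ
      continuous := continuous_translOp hα μG μN σ
      covariant := fun s f => by
        change mulOp hα μG μN σ (alphaLt α N s f) =
          translOp hα μG μN σ s * mulOp hα μG μN σ f * star (translOp hα μG μN σ s)
        rw [mulOp_covariant, star_translOp, mul_assoc, ← translOp_mul, mul_inv_cancel,
          translOp_one, mul_one] }

/-- The representation `X_N^G-Ind(π ⋊ U)` of `(A ⊗ C_0(G/N)) ⋊_{α ⊗ lt} G` on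
`X_N^G ⊗_{A ⋊ N} H`, given by the left action on `X_N^G`. -/
def greenInd : CrossedProduct (alphaLt α N) μG →⋆ₙₐ[ℂ]
    (GreenSpace hα μG μN σ →L[ℂ] GreenSpace hα μG μN σ) :=
  (greenCovRep hα μG μN σ).integratedForm μG

/-- On `z ∈ C_c(G, C_0(G/N, A))`, the induced representation acts by integrating
`x ⊗ h ↦ (z(t) · (t · x)) ⊗ h`, where
`(z(t) · (t · x))(s) = z(t)(sN) (Δ_G(t)^{1/2} α_t(x(t⁻¹s)))`. -/
lemma greenInd_toCrossedProduct_tmul (z : C_c(G, C₀(G ⧸ N, A))) (x : C_c(G, A)) (h : σ.H) :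
    greenInd hα μG μN σ (toCrossedProduct (alphaLt α N) μG z)
      (GreenSpace.of hα μG μN σ (x ⊗ₜ h)) =
        ∫ t, GreenSpace.of hα μG μN σ (leftMul (z t) (leftTransl hα t x) ⊗ₜ h) ∂μG := by
  refine ((greenCovRep hα μG μN σ).integratedForm_toCrossedProduct _ μG z _).trans ?_
  refine integral_congr_ae (Filter.Eventually.of_forall fun t => ?_)
  exact (congrArg (mulOp hα μG μN σ (z t)) (translOp_tmul hα μG μN σ t x h)).trans
    (mulOp_tmul hα μG μN σ (z t) _ h)

end GreenInd

end

end CDyn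

namespace CDyn

noncomputable section

set_option linter.unusedSectionVars false

/-! ### Integrals depending on a parameter -/

section ParametricIntegrals

variable {X Y E : Type*} [TopologicalSpace X] [TopologicalSpace Y] [MeasurableSpace Y]
  [OpensMeasurableSpace Y] [NormedAddCommGroup E] [NormedSpace ℝ E]
  {ν : Measure Y} [IsFiniteMeasureOnCompacts ν]

/-! Besides its module structures, `C_c(G, A)` carries right translations (x·k)(s) = c(k) x(sk)
(`rightTransl`), where c(k) is the inverse square root of the modulus of n ↦ k⁻¹nk on N. They
commute with the left action of G, intertwine multiplication by C₀(G/N, A) up to id ⊗ rt, and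
satisfy (x·a)·k = (x·k)·α_k(a). The two sides of the equivalence are linked by the single formula
T_k(x ⊗ h) = (x·k) ⊗ V_k h.

If V extends U, then V_k U_{k⁻¹nk} = U_n V_k, and the formula therefore preserves inner products
(`form_rightTransl`). For m in N it gives the identity, because (x·m) ⊗ U_m h = x ⊗ h holds in the
balanced tensor product (`of_rightTransl_coe`). Hence T descends to K/N, and covariance is checked
on `C_c` functions, which determine a homomorphism on the crossed product.

Conversely, write x ⊗ h as `creation` x h, and let y^* z denote the adjoint of `creation` y applied
to z. There are elements E(x, y) of the crossed product (`leftInner`) that act as the rank-one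
operators z ↦ x ⊗ y^* z (`greenInd_leftInner`), and β_k E(x, y) = E(x·k, y·k) (`mapCc_leftInner`).
Covariance of T therefore says that T_k(x ⊗ v) = (x·k) ⊗ w for every x, where v = y^* z and w =
(y·k)^* T_k z. The relation between such v and w is isometric: letting x concentrate near the
identity recovers ‖π(a)v‖ for all a, hence ‖v‖ (`norm_eq_of_forall_norm_creation_eq`). It is also
closed, with dense projections, so it is the graph of a unitary V_k (`exists_intertwiner`). Since
T_k determines V_k, the homomorphism property, covariance with π and V|_N = U all follow from the
corresponding facts about T. Strong continuity follows from V_k(y^* z) = (y·k)^* T_k z. -/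

lemma continuous_integral_of_locally_supported [LocallyCompactSpace X] {f : X → Y → E}
    (hf : Continuous f.uncurry)
    (h : ∀ S : Set X, IsCompact S → ∃ k : Set Y, IsCompact k ∧ ∀ p ∈ S, ∀ y ∉ k, f p y = 0) :
    Continuous fun p => ∫ y, f p y ∂ν := by
  rw [continuous_iff_continuousAt]
  intro p
  obtain ⟨S, hS, hp⟩ := exists_compact_mem_nhds p
  obtain ⟨k, hk, hz⟩ := h S hS
  exact (continuousOn_integral_of_compact_support hk hf.continuousOn
    fun q y hq hy => hz q hq y hy).continuousAt hp

lemma eq_zero_of_notMem_image_fst {f : X → Y → E} {p : X}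
    (hp : p ∉ Prod.fst '' tsupport f.uncurry) (y : Y) : f p y = 0 := by
  by_contra h
  exact hp ⟨(p, y), subset_tsupport _ h, rfl⟩

lemma eq_zero_of_notMem_image_snd {f : X → Y → E} {y : Y}
    (hy : y ∉ Prod.snd '' tsupport f.uncurry) (p : X) : f p y = 0 := by
  by_contra h
  exact hy ⟨(p, y), subset_tsupport _ h, rfl⟩

/-- Joint compact support confines the integration variable to one compact set for all parameters,
so the parameter space need not be locally compact. -/
lemma continuous_integral_of_hasCompactSupport {f : X → Y → E}
    (hf : Continuous f.uncurry) (h : HasCompactSupport f.uncurry) :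
    Continuous fun p => ∫ y, f p y ∂ν := by
  rw [← continuousOn_univ]
  exact continuousOn_integral_of_compact_support (h.isCompact.image continuous_snd)
    hf.continuousOn fun p y _ hy => eq_zero_of_notMem_image_snd hy p

lemma hasCompactSupport_integral [T2Space X] {f : X → Y → E} (h : HasCompactSupport f.uncurry) :
    HasCompactSupport fun p => ∫ y, f p y ∂ν := by
  refine HasCompactSupport.intro (h.isCompact.image continuous_fst) fun p hp => ?_
  simp only [eq_zero_of_notMem_image_fst hp, integral_zero]

end ParametricIntegrals

/-! ### The modulus of conjugation on the normal subgroup -/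

section ConjugationModulus

variable {G : Type*} [Group G] [TopologicalSpace G] [IsTopologicalGroup G]
  {N : Subgroup G} [N.Normal]

variable (N) in
/-- The automorphism `n ↦ k⁻¹ n k` of a normal subgroup. -/
def conjEquiv (k : G) : N ≃ₜ* N where
  toFun n := ⟨k⁻¹ * n * k, by simpa using ‹N.Normal›.conj_mem n n.2 k⁻¹⟩
  invFun n := ⟨k * n * k⁻¹, ‹N.Normal›.conj_mem n n.2 k⟩
  left_inv n := by ext; simp [mul_assoc]
  right_inv n := by ext; simp [mul_assoc]
  map_mul' m n := by ext; simp [mul_assoc]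
  continuous_toFun := by fun_prop
  continuous_invFun := by fun_prop

lemma coe_conjEquiv (k : G) (n : N) : (conjEquiv N k n : G) = k⁻¹ * n * k := rfl

lemma conjEquiv_mul (k l : G) : conjEquiv N (k * l) = (conjEquiv N k).trans (conjEquiv N l) := by
  ext n
  change (k * l)⁻¹ * n * (k * l) = l⁻¹ * (k⁻¹ * n * k) * l
  group

lemma mul_conjEquiv (t k : G) (n : N) : t * k * (conjEquiv N k n : G) = t * n * k := by
  rw [coe_conjEquiv]; group

lemma continuous_conjEquiv : Continuous fun p : G × N => conjEquiv N p.1 p.2 := by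
  refine Continuous.subtype_mk ?_ _
  fun_prop

variable [LocallyCompactSpace G] [T2Space G] [MeasurableSpace G] [BorelSpace G]
  [hN : IsClosed (N : Set G)]

variable (N) in
/-- The modulus of the automorphism `n ↦ k⁻¹ n k` of `N`. -/
def conjMod (k : G) : ℝ := ((mulEquivHaarChar (conjEquiv N k) : ℝ≥0) : ℝ)⁻¹

lemma conjMod_pos (k : G) : 0 < conjMod N k :=
  inv_pos.2 (NNReal.coe_pos.2 (mulEquivHaarChar_pos _))

lemma conjMod_mul (k l : G) : conjMod N (k * l) = conjMod N k * conjMod N l := by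
  rw [conjMod, conjEquiv_mul, mulEquivHaarChar_trans, NNReal.coe_mul, mul_inv]
  rfl

lemma conjMod_one : conjMod N (1 : G) = 1 := by
  have h := conjMod_mul (N := N) (1 : G) 1
  rw [mul_one] at h
  exact (mul_eq_left₀ (conjMod_pos (N := N) (1 : G)).ne').1 h.symm

/-- `mulEquivHaarChar` is the factor that restores `μN` from its image measure; `conjMod` is the
inverse, so that it appears here as the Jacobian. -/
lemma integral_conjEquiv {E : Type*} [NormedAddCommGroup E] [NormedSpace ℝ E]
    (μN : Measure N) [μN.IsHaarMeasure] [μN.Regular] (f : N → E) (k : G) :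
    ∫ n, f (conjEquiv N k n) ∂μN = conjMod N k • ∫ n, f n ∂μN := by
  have h1 : ∫ n, f n ∂(μN.map (conjEquiv N k)) = ∫ n, f (conjEquiv N k n) ∂μN :=
    (conjEquiv N k).toHomeomorph.measurableEmbedding.integral_map f
  have h2 := mulEquivHaarChar_smul_map μN (conjEquiv N k)
  rw [← h1]
  conv_rhs => rw [← h2]
  rw [integral_smul_nnreal_measure, conjMod, NNReal.smul_def, inv_smul_smul₀]
  exact (NNReal.coe_pos.2 (mulEquivHaarChar_pos _)).ne'

variable (N) in
lemma exists_bump_integral_pos (μN : Measure N) [μN.IsHaarMeasure] :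
    ∃ f : C(N, ℝ), HasCompactSupport f ∧ 0 < ∫ n, f n ∂μN := by
  obtain ⟨f, hc, h0, h1⟩ : ∃ f : C(N, ℝ), HasCompactSupport f ∧ 0 ≤ f ∧ f 1 ≠ 0 :=
    exists_continuous_nonneg_pos 1
  exact ⟨f, hc, f.continuous.integral_pos_of_hasCompactSupport_nonneg_nonzero hc h0 h1⟩

/-- Left invariance removes m⁻¹ from f(m⁻¹nm) and leaves a right translation by m. This is what
makes c(m)⁻¹ equal to Δ_N(m)^{-1/2}, the weight in Green's inner product. -/
lemma conjMod_coe (m : N) : conjMod N (m : G) = (modularFn m)⁻¹ := by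
  obtain ⟨f, -, hf⟩ := exists_bump_integral_pos N (Measure.haar : Measure N)
  have h := integral_conjEquiv (Measure.haar : Measure N) f (m : G)
  have h' : ∫ n, f (conjEquiv N (m : G) n) ∂(Measure.haar : Measure N) =
      ∫ n, f (n * m) ∂(Measure.haar : Measure N) :=
    integral_mul_left_eq_self (fun n => f (n * m)) m⁻¹
  rw [h', integral_mul_right_modularFn, smul_eq_mul, smul_eq_mul] at h
  exact (mul_right_cancel₀ hf.ne' h).symm

/-- The integral over m of f(k⁻¹mk · k⁻¹nk) is computed twice: by substituting for k⁻¹mk, and as a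
right translation by n of m ↦ f(k⁻¹mk). -/
lemma modularFn_conjEquiv (k : G) (n : N) : modularFn (conjEquiv N k n) = modularFn n := by
  obtain ⟨f, -, hf⟩ := exists_bump_integral_pos N (Measure.haar : Measure N)
  have h1 := integral_conjEquiv (Measure.haar : Measure N)
    (fun m => f (m * conjEquiv N k n)) k
  have h2 := integral_mul_right_modularFn (Measure.haar : Measure N)
    (fun m => f (conjEquiv N k m)) n
  simp only [map_mul] at h2
  rw [h2, integral_mul_right_modularFn, integral_conjEquiv, smul_comm] at h1
  simp only [smul_eq_mul] at h1
  have := mul_right_cancel₀ hf.ne' (mul_left_cancel₀ (conjMod_pos (N := N) k).ne' h1)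
  exact (inv_injective this).symm

lemma wt_conjEquiv (k : G) (n : N) : wt (conjEquiv N k n) = wt n := by
  rw [wt, modularFn_conjEquiv, wt]

variable (N) in
-- The modulus is a ratio of integrals of one bump f. If k⁻¹nk lies in supp f, then n lies in k
-- (supp f) k⁻¹, which stays in a compact set while k does.
lemma continuous_conjMod : Continuous (conjMod N : G → ℝ) := by
  obtain ⟨f, hc, hf⟩ := exists_bump_integral_pos N (Measure.haar : Measure N)
  have h : ∀ k : G, conjMod N k =
      (∫ n, f (conjEquiv N k n) ∂(Measure.haar : Measure N)) * (∫ n, f n ∂Measure.haar)⁻¹ := by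
    intro k
    rw [integral_conjEquiv, smul_eq_mul, mul_inv_cancel_right₀ hf.ne']
  rw [funext h]
  refine Continuous.mul ?_ continuous_const
  refine continuous_integral_of_locally_supported (f.continuous.comp continuous_conjEquiv)
    fun S hS => ⟨{n : N | (n : G) ∈ (fun p : G × N => p.1 * p.2 * p.1⁻¹) '' (S ×ˢ tsupport f)},
      isCompact_subgroup_preimage N ((hS.prod hc.isCompact).image (by fun_prop)),
      fun k hk n hn => ?_⟩
  by_contra hne
  exact hn ⟨(k, conjEquiv N k n), ⟨hk, subset_tsupport _ hne⟩, by simp [coe_conjEquiv, mul_assoc]⟩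

variable (N) in
/-- The weight that makes right translation by `k` unitary. -/
def conjWt (k : G) : ℝ := (√(conjMod N k))⁻¹

lemma conjWt_pos (k : G) : 0 < conjWt N k := inv_pos.2 (Real.sqrt_pos.2 (conjMod_pos k))

lemma conjWt_mul (k l : G) : conjWt N (k * l) = conjWt N k * conjWt N l := by
  rw [conjWt, conjMod_mul, Real.sqrt_mul (conjMod_pos k).le, mul_inv]
  rfl

lemma conjWt_one : conjWt N (1 : G) = 1 := by
  rw [conjWt, conjMod_one, Real.sqrt_one, inv_one]

variable (N) in
lemma continuous_conjWt : Continuous (conjWt N : G → ℝ) :=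
  (Real.continuous_sqrt.comp (continuous_conjMod N)).inv₀
    fun k => (Real.sqrt_pos.2 (conjMod_pos k)).ne'

lemma conjWt_mul_self (k : G) : conjWt N k * conjWt N k = (conjMod N k)⁻¹ := by
  rw [conjWt, ← mul_inv, Real.mul_self_sqrt (conjMod_pos k).le]

lemma conjWt_mul_conjMod (k : G) : conjWt N k * conjMod N k = (conjWt N k)⁻¹ := by
  refine eq_inv_of_mul_eq_one_left ?_
  rw [mul_right_comm, conjWt_mul_self, inv_mul_cancel₀ (conjMod_pos k).ne']

lemma inv_conjWt_coe (m : N) : (conjWt N (m : G))⁻¹ = wt m := by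
  rw [conjWt, inv_inv, conjMod_coe, Real.sqrt_inv, wt]

end ConjugationModulus

end

end CDyn
namespace CDyn

noncomputable section

set_option linter.unusedSectionVars false

/-! ### Right translations and creation operators on Green's bimodule -/

section RightTranslation

variable {G A : Type u} [Group G] [TopologicalSpace G] [IsTopologicalGroup G]
  [LocallyCompactSpace G] [T2Space G] [MeasurableSpace G] [BorelSpace G] [NonUnitalCStarAlgebra A]
  {α : G →* (A ≃⋆ₐ[ℂ] A)} (hα : IsContinuousAction α)
  {N : Subgroup G} [N.Normal] [hN : IsClosed (N : Set G)]
  (μG : Measure G) [μG.IsHaarMeasure] [μG.Regular]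
  (μN : Measure N) [μN.IsHaarMeasure] [μN.Regular]
  (σ : CovRep (α.comp N.subtype))

variable (N) in
/-- The right translation `(x · k)(s) = c(k) x(sk)` on `C_c(G, A)`, where `c(k)` makes it
isometric for Green's inner product. -/
def rightTransl (k : G) : C_c(G, A) →ₗ[ℂ] C_c(G, A) where
  toFun x :=
    { toFun := fun s => conjWt N k • x (s * k)
      continuous_toFun := by
        have := x.continuous
        fun_prop
      hasCompactSupport' :=
        HasCompactSupport.smul_left (f := fun _ => conjWt N k)
          (x.hasCompactSupport.comp_homeomorph (Homeomorph.mulRight k)) }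
  map_add' x y := by ext s; exact smul_add _ _ _
  map_smul' c x := by ext s; exact smul_comm _ _ _

lemma rightTransl_apply (k : G) (x : C_c(G, A)) (s : G) :
    rightTransl N k x s = conjWt N k • x (s * k) := rfl

lemma rightTransl_mul (k l : G) (x : C_c(G, A)) :
    rightTransl N (k * l) x = rightTransl N k (rightTransl N l x) := by
  ext s
  simp only [rightTransl_apply, conjWt_mul, mul_smul, mul_assoc]

lemma rightTransl_one (x : C_c(G, A)) : rightTransl N 1 x = x := by
  ext s
  rw [rightTransl_apply, conjWt_one, one_smul, mul_one]

lemma rightTransl_inv_self (k : G) (x : C_c(G, A)) :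
    rightTransl N k (rightTransl N k⁻¹ x) = x := by
  rw [← rightTransl_mul, mul_inv_cancel, rightTransl_one]

/-- The right action of `a ∈ A` on `C_c(G, A)`: `(x · a)(s) = x(s) α_s(a)`. -/
def rightMul (hα : IsContinuousAction α) (a : A) (x : C_c(G, A)) : C_c(G, A) where
  toFun s := x s * α s a
  continuous_toFun := x.continuous.mul (hα a)
  hasCompactSupport' := HasCompactSupport.mul_right x.hasCompactSupport

lemma rightMul_apply (a : A) (x : C_c(G, A)) (s : G) : rightMul hα a x s = x s * α s a := rfl

/-- This is the bimodule counterpart of V_k π(a) = π(α_k(a)) V_k. -/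
lemma rightTransl_rightMul (k : G) (a : A) (x : C_c(G, A)) :
    rightTransl N k (rightMul hα a x) = rightMul hα (α k a) (rightTransl N k x) := by
  ext s
  rw [rightTransl_apply, rightMul_apply, rightMul_apply, rightTransl_apply, action_apply_mul,
    smul_mul_assoc]

lemma leftMul_rightTransl (k : G) (f : C₀(G ⧸ N, A)) (x : C_c(G, A)) :
    rightTransl N k (leftMul f x) = leftMul (idRt A N (k : G ⧸ N) f) (rightTransl N k x) := by
  ext s
  rw [rightTransl_apply, leftMul_apply, leftMul_apply, rightTransl_apply, mul_smul_comm]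
  rfl

lemma leftTransl_rightTransl (k s : G) (x : C_c(G, A)) :
    rightTransl N k (leftTransl hα s x) = leftTransl hα s (rightTransl N k x) := by
  ext r
  rw [rightTransl_apply, leftTransl_apply, leftTransl_apply, rightTransl_apply, mul_assoc]
  have h := map_smul (α s) ((conjWt N k : ℝ) : ℂ) (x (s⁻¹ * (r * k)))
  simp only [Complex.coe_smul] at h
  rw [h, smul_comm]

set_option maxHeartbeats 400000 in
-- Since tnk = tk(k⁻¹nk), the relation `hV` turns the integrand into V of the integrand of ξ at tk
-- and k⁻¹nk. Substituting for k⁻¹nk brings in the modulus c(k)⁻², which changes the factor c(k)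
-- into c(k)⁻¹.
lemma fibInt_rightTransl (k : G) (V : σ.H →L[ℂ] σ.H)
    (hV : ∀ (n : N) (h : σ.H), V ((σ.U (conjEquiv N k n) : σ.H →L[ℂ] σ.H) h) =
      (σ.U n : σ.H →L[ℂ] σ.H) (V h))
    (ξ ξ' : C_c(G, σ.H)) (h : ∀ t, ξ' t = conjWt N k • V (ξ (t * k))) (t : G) :
    fibInt μN σ ξ' t = (conjWt N k)⁻¹ • V (fibInt μN σ ξ (t * k)) := by
  have e : ∀ n, fibIntegrand σ ξ' t n =
      conjWt N k • V (fibIntegrand σ ξ (t * k) (conjEquiv N k n)) := by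
    intro n
    have h0 : fibIntegrand σ ξ (t * k) (conjEquiv N k n) =
        wt n • (σ.U (conjEquiv N k n) : σ.H →L[ℂ] σ.H) (ξ (t * n * k)) :=
      congrArg₂ (fun (r : ℝ) g => r • (σ.U (conjEquiv N k n) : σ.H →L[ℂ] σ.H) (ξ g))
        (wt_conjEquiv k n) (mul_conjEquiv t k n)
    rw [h0, ContinuousLinearMap.map_smul_of_tower V (wt n), hV n, fibIntegrand, h,
      ContinuousLinearMap.map_smul_of_tower _ (conjWt N k)]
    exact smul_comm (wt n) (conjWt N k) _
  have e1 : ∫ n, conjWt N k • V (fibIntegrand σ ξ (t * k) (conjEquiv N k n)) ∂μN =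
      conjWt N k • conjMod N k • ∫ n, V (fibIntegrand σ ξ (t * k) n) ∂μN := by
    rw [integral_smul]
    exact congrArg (conjWt N k • ·)
      (integral_conjEquiv μN (fun n => V (fibIntegrand σ ξ (t * k) n)) k)
  have e2 : ∫ n, V (fibIntegrand σ ξ (t * k) n) ∂μN = V (fibInt μN σ ξ (t * k)) :=
    V.integral_comp_comm (integrable_fibIntegrand μN σ ξ _)
  have e3 : fibInt μN σ ξ' t =
      ∫ n, conjWt N k • V (fibIntegrand σ ξ (t * k) (conjEquiv N k n)) ∂μN :=
    integral_congr_ae (Filter.Eventually.of_forall e)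
  refine (e3.trans e1).trans ?_
  rw [e2, smul_smul (conjWt N k), conjWt_mul_conjMod]

/-- The left vector carries c(k) and the fibre integral on the right carries c(k)⁻¹, which is the
reason for the choice of c(k). The remaining shift t ↦ tk is harmless because `μG.inv` is a right
Haar measure. -/
lemma form_rightTransl (k : G) (V : σ.H →L[ℂ] σ.H)
    (hV : ∀ (n : N) (h : σ.H), V ((σ.U (conjEquiv N k n) : σ.H →L[ℂ] σ.H) h) =
      (σ.U n : σ.H →L[ℂ] σ.H) (V h))
    (hV' : ∀ h h', inner ℂ (V h) (V h') = inner ℂ h h')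
    (ξ ξ' η η' : C_c(G, σ.H)) (h : ∀ t, ξ' t = conjWt N k • V (ξ (t * k)))
    (h' : ∀ t, η' t = conjWt N k • V (η (t * k))) :
    form μG μN σ ξ' η' = form μG μN σ ξ η := by
  rw [form, form,
    ← integral_mul_right_eq_self (fun t => inner ℂ (ξ t) (fibInt μN σ η t)) k]
  refine integral_congr_ae (Filter.Eventually.of_forall fun t => ?_)
  simp only [h, fibInt_rightTransl μN σ k V hV η η' h', inner_smul_left_eq_smul,
    inner_smul_right_eq_smul, hV', smul_smul, inv_mul_cancel₀ (conjWt_pos (N := N) k).ne',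
    one_smul]

/-- Write (tk)⁻¹ = k⁻¹t⁻¹; moving V past π inserts α_k, which cancels the k⁻¹. This supplies the
pointwise hypotheses of `form_rightTransl`. -/
lemma greenVecLift_rightTransl (k : G) (V : σ.H →L[ℂ] σ.H)
    (hV : ∀ a h, V (σ.π a h) = σ.π (α k a) (V h)) (v : C_c(G, A) ⊗[ℂ] σ.H) (t : G) :
    greenVecLift hα σ (TensorProduct.map (rightTransl N k) V.toLinearMap v) t =
      conjWt N k • V (greenVecLift hα σ v (t * k)) := by
  induction v with
  | zero =>
    rw [map_zero, map_zero]
    change (0 : σ.H) = conjWt N k • V 0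
    rw [map_zero, smul_zero]
  | tmul x h =>
    change σ.π (α t⁻¹ (conjWt N k • x (t * k))) (V h) =
      conjWt N k • V (σ.π (α (t * k)⁻¹ (x (t * k))) h)
    have h1 := map_smul (α t⁻¹) ((conjWt N k : ℝ) : ℂ) (x (t * k))
    simp only [Complex.coe_smul] at h1
    rw [h1, CovRep.π_real_smul, hV, ← action_apply_mul, mul_inv_rev, mul_inv_cancel_left]
    rfl
  | add v w hv hw =>
    rw [map_add, map_add, CompactlySupportedContinuousMap.add_apply, hv, hw, ← smul_add,
      ← V.map_add]
    exact (congrArg (fun ξ : C_c(G, σ.H) => conjWt N k • V (ξ (t * k)))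
      (map_add (greenVecLift hα σ) v w)).symm

/-- The form sees its second argument only through the fibre integral. -/
lemma GreenSpace.of_eq_of_fibInt_eq {v w : C_c(G, A) ⊗[ℂ] σ.H}
    (h : ∀ t, fibInt μN σ (greenVecLift hα σ v) t = fibInt μN σ (greenVecLift hα σ w) t) :
    GreenSpace.of hα μG μN σ v = GreenSpace.of hα μG μN σ w := by
  refine ext_inner_left ℂ fun z => ?_
  refine GreenSpace.induction hα μG μN σ z (isClosed_eq (continuous_id'.inner continuous_const)
    (continuous_id'.inner continuous_const)) fun u => ?_
  rw [GreenSpace.inner_of_eq_form, GreenSpace.inner_of_eq_form, form, form]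
  simp_rw [h]

lemma U_conjEquiv_coe (m n : N) (h : σ.H) :
    (σ.U m : σ.H →L[ℂ] σ.H) ((σ.U (conjEquiv N (m : G) n) : σ.H →L[ℂ] σ.H) h) =
      (σ.U n : σ.H →L[ℂ] σ.H) ((σ.U m : σ.H →L[ℂ] σ.H) h) := by
  rw [← σ.U_mul, ← σ.U_mul]
  congr 3
  rw [show conjEquiv N (m : G) n = m⁻¹ * n * m from Subtype.ext rfl, mul_assoc,
    mul_inv_cancel_left]

/-- The map `h ↦ x ⊗ h` from `H` to `X_N^G ⊗_{A ⋊ N} H`. -/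
def creation (x : C_c(G, A)) : σ.H →L[ℂ] GreenSpace hα μG μN σ :=
  LinearMap.mkContinuousOfExistsBound
    ((GreenSpace.of hα μG μN σ).comp (TensorProduct.mk ℂ (C_c(G, A)) σ.H x)) (by
    obtain ⟨C, -, H⟩ := exists_norm_of_tmul_le hα μG μN σ x.hasCompactSupport.isCompact
    obtain ⟨M, hM⟩ := x.continuous.bounded_above_of_compact_support x.hasCompactSupport
    have hM0 : 0 ≤ M := (norm_nonneg _).trans (hM 1)
    exact ⟨C * M, fun h => (H x h M hM0 subset_rfl hM).trans (mul_assoc C M ‖h‖).ge⟩)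

lemma creation_apply (x : C_c(G, A)) (h : σ.H) :
    creation hα μG μN σ x h = GreenSpace.of hα μG μN σ (x ⊗ₜ h) := rfl

lemma creation_sub (x y : C_c(G, A)) :
    creation hα μG μN σ (x - y) = creation hα μG μN σ x - creation hα μG μN σ y := by
  ext h
  rw [sub_apply, creation_apply, creation_apply, creation_apply, TensorProduct.sub_tmul, map_sub]

lemma exists_norm_creation_le {S : Set G} (hS : IsCompact S) : ∃ C : ℝ, 0 ≤ C ∧
    ∀ (x : C_c(G, A)) (M : ℝ), 0 ≤ M → tsupport x ⊆ S → (∀ t, ‖x t‖ ≤ M) →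
      ‖creation hα μG μN σ x‖ ≤ C * M := by
  obtain ⟨C, hC, H⟩ := exists_norm_of_tmul_le hα μG μN σ hS
  refine ⟨C, hC, fun x M hM hx hxM => ?_⟩
  refine ContinuousLinearMap.opNorm_le_bound _ (mul_nonneg hC hM) fun h => ?_
  rw [mul_assoc]
  exact H x h M hM hx hxM

lemma inner_creation (x y : C_c(G, A)) (h k : σ.H) :
    inner ℂ (creation hα μG μN σ x h) (creation hα μG μN σ y k) =
      form μG μN σ (greenVec hα σ x h) (greenVec hα σ y k) := by
  rw [creation_apply, creation_apply, GreenSpace.inner_of_eq_form]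
  rfl

lemma adjoint_creation_creation (x y : C_c(G, A)) (h : σ.H) :
    (creation hα μG μN σ x).adjoint (creation hα μG μN σ y h) =
      σ.integratedForm μN (toCrossedProduct _ μN (greenInner hα μG x y)) h := by
  refine ext_inner_left ℂ fun k => ?_
  rw [ContinuousLinearMap.adjoint_inner_right]
  exact (GreenSpace.inner_of hα μG μN σ _ _).trans (greenForm_tmul hα μG μN σ x y k h)

/-- Balancing over A: the two functions on G agree pointwise because α_t⁻¹α_t is the identity. -/
lemma creation_π (x : C_c(G, A)) (a : A) (h : σ.H) :
    creation hα μG μN σ x (σ.π a h) = creation hα μG μN σ (rightMul hα a x) h := by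
  rw [creation_apply, creation_apply]
  refine GreenSpace.of_eq_of_fibInt_eq hα μG μN σ fun t => ?_
  congr 1
  ext t
  change σ.π (α t⁻¹ (x t)) (σ.π a h) = σ.π (α t⁻¹ (x t * α t a)) h
  rw [map_mul (α t⁻¹), ← action_apply_mul (α := α) t⁻¹ t, inv_mul_cancel, map_one,
    CovRep.π_mul_apply]
  rfl

/-- Balancing over N. With V = U_m the factor c(m)⁻¹ is `wt m`, so the translated fibre integral is
the right side of the equivariance `fibInt_eq`. -/
lemma of_rightTransl_coe (m : N) (v : C_c(G, A) ⊗[ℂ] σ.H) :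
    GreenSpace.of hα μG μN σ (TensorProduct.map (rightTransl N (m : G))
      (σ.U m : σ.H →L[ℂ] σ.H).toLinearMap v) = GreenSpace.of hα μG μN σ v := by
  refine GreenSpace.of_eq_of_fibInt_eq hα μG μN σ fun t => ?_
  rw [fibInt_rightTransl μN σ (m : G) (σ.U m) (U_conjEquiv_coe σ m) _ _
    (greenVecLift_rightTransl hα σ (m : G) (σ.U m) (fun a h => σ.U_π m a h) v), inv_conjWt_coe,
    ← fibInt_eq]

lemma creation_rightTransl_coe (m : N) (x : C_c(G, A)) (h : σ.H) :
    creation hα μG μN σ (rightTransl N (m : G) x) ((σ.U m : σ.H →L[ℂ] σ.H) h) =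
      creation hα μG μN σ x h :=
  of_rightTransl_coe hα μG μN σ m (x ⊗ₜ h)

lemma GreenSpace.ext_creation {E : Type*} [NormedAddCommGroup E] [NormedSpace ℂ E]
    {T S : GreenSpace hα μG μN σ →L[ℂ] E}
    (h : ∀ x k, T (creation hα μG μN σ x k) = S (creation hα μG μN σ x k)) : T = S :=
  GreenSpace.ext_tmul hα μG μN σ h

/-- Convergence is uniform with supports in a fixed compact set, the mode of convergence that
`exists_norm_creation_le` converts into operator norm convergence. -/
lemma continuousAt_rightTransl_uniform (x : C_c(G, A)) (k₀ : G) :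
    ∃ S : Set G, IsCompact S ∧ ∀ ε > 0, ∀ᶠ k in 𝓝 k₀,
      tsupport (rightTransl N k x - rightTransl N k₀ x) ⊆ S ∧
        ∀ t, ‖(rightTransl N k x - rightTransl N k₀ x) t‖ ≤ ε := by
  obtain ⟨V, hV, hVs⟩ := exists_compact_mem_nhds k₀
  let S : Set G := (fun p : G × G => p.1 * p.2⁻¹) '' (tsupport x ×ˢ V)
  have hS : IsCompact S := (x.hasCompactSupport.isCompact.prod hV).image (by fun_prop)
  have hk₀ : k₀ ∈ V := mem_of_mem_nhds hVs
  have hz : ∀ k ∈ V, ∀ r, r ∉ S → rightTransl N k x r = 0 := by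
    intro k hk r hr
    have h0 : x (r * k) = 0 := image_eq_zero_of_notMem_tsupport fun h' =>
      hr ⟨(r * k, k), ⟨h', hk⟩, mul_inv_cancel_right r k⟩
    rw [rightTransl_apply, h0, smul_zero]
  have hcont : Continuous fun p : G × G => conjWt N p.1 • x (p.2 * p.1) :=
    ((continuous_conjWt N).comp continuous_fst).smul
      (x.continuous.comp (continuous_snd.mul continuous_fst))
  let Ψ : C(G, C(G, A)) := ContinuousMap.curry ⟨_, hcont⟩
  have hΨ : TendstoUniformlyOn (fun s r => Ψ s r) (Ψ k₀) (𝓝 k₀) S :=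
    ContinuousMap.tendsto_iff_forall_isCompact_tendstoUniformlyOn.1 (Ψ.continuous.tendsto k₀) S hS
  rw [Metric.tendstoUniformlyOn_iff] at hΨ
  refine ⟨S, hS, fun ε hε => ?_⟩
  filter_upwards [hΨ ε hε, hVs] with k hk hkV
  have hval : ∀ r, (rightTransl N k x - rightTransl N k₀ x) r =
    rightTransl N k x r - rightTransl N k₀ x r := fun r => rfl
  refine ⟨closure_minimal (fun r hr => ?_) hS.isClosed, fun r => ?_⟩
  · by_contra hrS
    refine hr ?_
    rw [hval, hz k hkV r hrS, hz k₀ hk₀ r hrS, sub_zero]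
  · rw [hval]
    by_cases hr : r ∈ S
    · have := hk r hr
      rw [dist_comm, dist_eq_norm] at this
      exact this.le
    · rw [hz k hkV r hr, hz k₀ hk₀ r hr, sub_zero, norm_zero]
      exact hε.le

/-- Continuity for the operator norm, rather than the strong topology, is needed because it passes
to adjoints. -/
lemma continuous_creation_rightTransl (x : C_c(G, A)) :
    Continuous fun k : G => creation hα μG μN σ (rightTransl N k x) := by
  rw [continuous_iff_continuousAt]
  intro k₀
  obtain ⟨S, hS, H⟩ := continuousAt_rightTransl_uniform (N := N) x k₀
  obtain ⟨C, hC, HC⟩ := exists_norm_creation_le hα μG μN σ hS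
  refine (Metric.continuousAt_iff'
    (f := fun k : G => creation hα μG μN σ (rightTransl N k x))).2 fun ε hε => ?_
  have hpos : 0 < C + 1 := by positivity
  filter_upwards [H (ε / (C + 1)) (by positivity)] with k hk
  have h1 := HC _ _ (by positivity) hk.1 hk.2
  rw [creation_sub] at h1
  refine ((dist_eq_norm (creation hα μG μN σ (rightTransl N k x))
    (creation hα μG μN σ (rightTransl N k₀ x))).trans_le h1).trans_lt ?_
  rw [mul_div_left_comm]
  exact mul_lt_of_lt_one_right hε ((div_lt_one hpos).2 (lt_add_one _))

end RightTranslation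

end

end CDyn
namespace CDyn

noncomputable section

set_option linter.unusedSectionVars false

/-! ### The left inner product with values in C_c(G, C₀(G/N, A)) -/

section LeftInnerProduct

variable {G A : Type u} [Group G] [TopologicalSpace G] [IsTopologicalGroup G]
  [LocallyCompactSpace G] [T2Space G] [MeasurableSpace G] [BorelSpace G] [NonUnitalCStarAlgebra A]
  {α : G →* (A ≃⋆ₐ[ℂ] A)} (hα : IsContinuousAction α)
  {N : Subgroup G} [hN : IsClosed (N : Set G)]
  (μN : Measure N) [μN.IsHaarMeasure] [μN.Regular]

/-- The integrand `Δ_N(n)⁻¹ x(sn⁻¹) α_t(y(t⁻¹sn⁻¹))^*` of the left inner product. -/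
def leftIntegrand (α : G →* (A ≃⋆ₐ[ℂ] A)) (x y : C_c(G, A)) (t s : G) (n : N) : A :=
  (modularFn n)⁻¹ • (x (s * (n : G)⁻¹) * α t (star (y (t⁻¹ * (s * (n : G)⁻¹)))))

/-- `∫_N Δ_N(n)⁻¹ x(sn⁻¹) α_t(y(t⁻¹sn⁻¹))^* dn`. -/
def leftInnerFn (α : G →* (A ≃⋆ₐ[ℂ] A)) (x y : C_c(G, A)) (t s : G) : A :=
  ∫ n, leftIntegrand α x y t s n ∂μN

lemma continuous_leftIntegrand (hα : IsContinuousAction α) (x y : C_c(G, A)) :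
    Continuous fun p : (G × G) × N => leftIntegrand α x y p.1.1 p.1.2 p.2 := by
  have hx := x.continuous
  have h1 : Continuous fun p : (G × G) × N =>
      (p.1.1, star (y (p.1.1⁻¹ * (p.1.2 * (p.2 : G)⁻¹)))) := by
    have hy := y.continuous
    fun_prop
  have h2 : Continuous fun p : (G × G) × N => x (p.1.2 * (p.2 : G)⁻¹) := by fun_prop
  have h3 : Continuous fun p : (G × G) × N => (modularFn p.2)⁻¹ :=
    (continuous_modularFn.comp continuous_snd).inv₀ fun _ => (modularFn_pos _).ne'
  exact h3.smul (h2.mul (hα.continuous_uncurry.comp h1))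

lemma leftIntegrand_eq_zero_left {x y : C_c(G, A)} {t s : G} {n : N}
    (h : s * (n : G)⁻¹ ∉ tsupport x) : leftIntegrand α x y t s n = 0 := by
  rw [leftIntegrand, image_eq_zero_of_notMem_tsupport h, zero_mul, smul_zero]

lemma leftIntegrand_eq_zero_right {x y : C_c(G, A)} {t s : G} {n : N}
    (h : t⁻¹ * (s * (n : G)⁻¹) ∉ tsupport y) : leftIntegrand α x y t s n = 0 := by
  rw [leftIntegrand, image_eq_zero_of_notMem_tsupport h, star_zero, map_zero, mul_zero, smul_zero]

/-- For `s` in `S`, the left integrand is supported in this subset of `N`. -/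
def leftSet (N : Subgroup G) (x : C_c(G, A)) (S : Set G) : Set N :=
  {n : N | (n : G) ∈ (fun p : G × G => p.2⁻¹ * p.1) '' (S ×ˢ tsupport x)}

lemma isCompact_leftSet (x : C_c(G, A)) {S : Set G} (hS : IsCompact S) :
    IsCompact (leftSet N x S) :=
  isCompact_subgroup_preimage N ((hS.prod x.hasCompactSupport.isCompact).image (by fun_prop))

lemma mul_inv_notMem_of_notMem_leftSet {x : C_c(G, A)} {S : Set G} {s : G} (hs : s ∈ S) {n : N}
    (hn : n ∉ leftSet N x S) : s * (n : G)⁻¹ ∉ tsupport x := fun h =>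
  hn ⟨(s, s * (n : G)⁻¹), ⟨hs, h⟩, by simp⟩

lemma integrable_leftIntegrand (hα : IsContinuousAction α) (x y : C_c(G, A)) (t s : G) :
    Integrable (fun n => leftIntegrand α x y t s n) μN := by
  apply Continuous.integrable_of_hasCompactSupport
  · exact (continuous_leftIntegrand hα x y).comp
      (continuous_const.prodMk continuous_id : Continuous fun n : N => ((t, s), n))
  · exact HasCompactSupport.intro (isCompact_leftSet x (isCompact_singleton (x := s)))
      fun n hn => leftIntegrand_eq_zero_left (mul_inv_notMem_of_notMem_leftSet (Set.mem_singleton s) hn)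

lemma continuous_leftInnerFn (hα : IsContinuousAction α) (x y : C_c(G, A)) :
    Continuous fun p : G × G => leftInnerFn μN α x y p.1 p.2 := by
  refine continuous_integral_of_locally_supported
    (f := fun p : G × G => leftIntegrand α x y p.1 p.2) (continuous_leftIntegrand hα x y)
    fun S hS => ⟨leftSet N x (Prod.snd '' S), isCompact_leftSet x (hS.image continuous_snd),
      fun p hp n hn => ?_⟩
  exact leftIntegrand_eq_zero_left
    (mul_inv_notMem_of_notMem_leftSet (Set.mem_image_of_mem _ hp) hn)

/-- The weight Δ_N(n)⁻¹ compensates the right translation of n by m⁻¹, so the integral depends only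
on the coset of s. -/
lemma leftInnerFn_mul_coe (x y : C_c(G, A)) (t s : G) (m : N) :
    leftInnerFn μN α x y t (s * m) = leftInnerFn μN α x y t s := by
  have h := integral_mul_right_modularFn μN (fun n => leftIntegrand α x y t s n) m⁻¹
  rw [modularFn_inv, inv_inv] at h
  refine smul_right_injective A (modularFn_pos m).ne' ?_
  refine Eq.trans ?_ h
  change modularFn m • ∫ n, _ ∂μN = _
  rw [← integral_smul]
  refine integral_congr_ae (Filter.Eventually.of_forall fun n => ?_)
  change modularFn m • leftIntegrand α x y t (s * m) n = leftIntegrand α x y t s (n * m⁻¹)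
  have e : s * ((n * m⁻¹ : N) : G)⁻¹ = s * m * (n : G)⁻¹ := by
    rw [Subgroup.coe_mul, Subgroup.coe_inv, mul_inv_rev, inv_inv, mul_assoc]
  rw [leftIntegrand, leftIntegrand, e, smul_smul, modularFn_mul, modularFn_inv, mul_inv, inv_inv,
    mul_comm]

lemma leftInnerFn_eq_zero_of_coset (x y : C_c(G, A)) (t s : G)
    (h : (s : G ⧸ N) ∉ (fun s : G => (s : G ⧸ N)) '' tsupport x) :
    leftInnerFn μN α x y t s = 0 := by
  refine (integral_congr_ae (Filter.Eventually.of_forall fun n => ?_)).trans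
    (integral_zero N A)
  refine leftIntegrand_eq_zero_left fun h' => h ⟨_, h', ?_⟩
  exact QuotientGroup.mk_mul_of_mem s (N.inv_mem n.2)

lemma leftInnerFn_eq_zero (x y : C_c(G, A)) (t s : G)
    (h : t ∉ (fun p : G × G => p.1 * p.2⁻¹) '' (tsupport x ×ˢ tsupport y)) :
    leftInnerFn μN α x y t s = 0 := by
  refine (integral_congr_ae (Filter.Eventually.of_forall fun n => ?_)).trans
    (integral_zero N A)
  by_cases h1 : s * (n : G)⁻¹ ∈ tsupport x
  · refine leftIntegrand_eq_zero_right fun h2 => h ⟨(_, _), ⟨h1, h2⟩, ?_⟩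
    simp [mul_assoc]
  · exact leftIntegrand_eq_zero_left h1

lemma exists_mem_tsupport_of_coset {x : C_c(G, A)} {s : G}
    (h : (s : G ⧸ N) ∈ (fun s : G => (s : G ⧸ N)) '' tsupport x) :
    ∃ s' ∈ tsupport x, ∃ m : N, s' * m = s := by
  obtain ⟨s', hs', e⟩ := h
  exact ⟨s', hs', ⟨s'⁻¹ * s, QuotientGroup.eq.1 e⟩, mul_inv_cancel_left s' s⟩

variable [N.Normal]

/-- The value at `t` of the left inner product, as a function on `G/N`. -/
def leftInnerC0 (x y : C_c(G, A)) (t : G) : C₀(G ⧸ N, A) where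
  toFun q := Quotient.liftOn' q (fun s => (√(modularFn t))⁻¹ • leftInnerFn μN α x y t s)
    (fun s s' h => by
      have h' : s⁻¹ * s' ∈ N := QuotientGroup.leftRel_apply.1 h
      have := leftInnerFn_mul_coe (α := α) μN x y t s ⟨_, h'⟩
      rw [mul_inv_cancel_left] at this
      change _ • leftInnerFn μN α x y t s = _ • leftInnerFn μN α x y t s'
      rw [this])
  continuous_toFun := by
    refine Continuous.quotient_liftOn' ?_ _
    exact continuous_const.smul
      ((continuous_leftInnerFn μN hα x y).comp (continuous_const.prodMk continuous_id))
  zero_at_infty' := by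
    refine HasCompactSupport.is_zero_at_infty (HasCompactSupport.intro
      (x.hasCompactSupport.isCompact.image (QuotientGroup.continuous_mk (N := N))) fun q hq => ?_)
    induction q using QuotientGroup.induction_on with
    | H s =>
      change _ • leftInnerFn μN α x y t s = 0
      rw [leftInnerFn_eq_zero_of_coset μN x y t s hq, smul_zero]

lemma leftInnerC0_coe (x y : C_c(G, A)) (t s : G) :
    leftInnerC0 hα μN x y t (s : G ⧸ N) = (√(modularFn t))⁻¹ • leftInnerFn μN α x y t s := rfl

/-- Continuity into C₀(G/N, A) requires uniformity in s. The function is constant on cosets of N and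
vanishes on those missing supp x, so the supremum over G/N is controlled on the compact set supp x.
-/
lemma continuous_leftInnerC0 (x y : C_c(G, A)) : Continuous (leftInnerC0 hα μN x y) := by
  rw [continuous_iff_continuousAt]
  intro t₀
  have hcont : Continuous fun p : G × G =>
      (√(modularFn p.1))⁻¹ • leftInnerFn μN α x y p.1 p.2 := by
    have h : Continuous fun p : G × G => √(modularFn p.1) :=
      Real.continuous_sqrt.comp (continuous_modularFn.comp continuous_fst)
    have h' : Continuous fun p : G × G => (√(modularFn p.1))⁻¹ :=
      h.inv₀ fun p => (Real.sqrt_pos.2 (modularFn_pos p.1)).ne'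
    exact h'.smul (continuous_leftInnerFn μN hα x y)
  let Ψ : C(G, C(G, A)) := ContinuousMap.curry ⟨_, hcont⟩
  have hΨ : TendstoUniformlyOn (fun s r => Ψ s r) (Ψ t₀) (𝓝 t₀) (tsupport x) :=
    ContinuousMap.tendsto_iff_forall_isCompact_tendstoUniformlyOn.1 (Ψ.continuous.tendsto t₀) _
      x.hasCompactSupport.isCompact
  rw [Metric.tendstoUniformlyOn_iff] at hΨ
  rw [Metric.continuousAt_iff']
  intro ε hε
  filter_upwards [hΨ (ε / 2) (half_pos hε)] with t ht
  refine lt_of_le_of_lt ?_ (half_lt_self hε)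
  rw [← ZeroAtInftyContinuousMap.dist_toBCF_eq_dist,
    BoundedContinuousFunction.dist_le (half_pos hε).le]
  intro q
  induction q using QuotientGroup.induction_on with
  | H s =>
    change dist ((√(modularFn t))⁻¹ • leftInnerFn μN α x y t s)
      ((√(modularFn t₀))⁻¹ • leftInnerFn μN α x y t₀ s) ≤ ε / 2
    by_cases hs : (s : G ⧸ N) ∈ (fun s : G => (s : G ⧸ N)) '' tsupport x
    · obtain ⟨s', hs', m, rfl⟩ := exists_mem_tsupport_of_coset hs
      rw [leftInnerFn_mul_coe, leftInnerFn_mul_coe, dist_comm]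
      exact (ht s' hs').le
    · rw [leftInnerFn_eq_zero_of_coset μN x y t s hs, leftInnerFn_eq_zero_of_coset μN x y t₀ s hs,
        smul_zero, smul_zero, dist_self]
      exact (half_pos hε).le

/-- The left inner product on `C_c(G, A)` with values in `C_c(G, C_0(G/N, A))`:
`(t, sN) ↦ Δ_G(t)^{-1/2} ∫_N Δ_N(n)⁻¹ x(sn⁻¹) α_t(y(t⁻¹sn⁻¹))^* dn`. -/
def leftInner (x y : C_c(G, A)) : C_c(G, C₀(G ⧸ N, A)) where
  toFun := leftInnerC0 hα μN x y
  continuous_toFun := continuous_leftInnerC0 hα μN x y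
  hasCompactSupport' := by
    refine HasCompactSupport.intro ((x.hasCompactSupport.isCompact.prod
      y.hasCompactSupport.isCompact).image (f := fun p : G × G => p.1 * p.2⁻¹) (by fun_prop))
      fun t ht => ?_
    ext q
    induction q using QuotientGroup.induction_on with
    | H s =>
      rw [leftInnerC0_coe, leftInnerFn_eq_zero μN x y t s ht, smul_zero]
      rfl

lemma leftInner_apply_coe (x y : C_c(G, A)) (t s : G) :
    leftInner hα μN x y t (s : G ⧸ N) = (√(modularFn t))⁻¹ • leftInnerFn μN α x y t s := rfl

/-- The product of the two factors c(k) is the inverse modulus, cancelling the Jacobian of n ↦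
k⁻¹nk; the arguments match since sk(k⁻¹nk)⁻¹ = sn⁻¹k. -/
lemma leftInnerFn_rightTransl (x y : C_c(G, A)) (k t s : G) :
    leftInnerFn μN α (rightTransl N k x) (rightTransl N k y) t s =
      leftInnerFn μN α x y t (s * k) := by
  have h := integral_conjEquiv μN (fun n => leftIntegrand α x y t (s * k) n) k
  have e : ∀ n, leftIntegrand α (rightTransl N k x) (rightTransl N k y) t s n =
      (conjMod N k)⁻¹ • leftIntegrand α x y t (s * k) (conjEquiv N k n) := by
    intro n
    have e1 : s * k * (conjEquiv N k n : G)⁻¹ = s * (n : G)⁻¹ * k := by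
      rw [coe_conjEquiv]; group
    have e2 : ∀ a, star (conjWt N k • a) = conjWt N k • star a := fun a : A =>
      (star_smul _ _).trans (by rw [star_trivial])
    have e3 : ∀ a, α t (conjWt N k • a) = conjWt N k • α t a := fun a => by
      have := map_smul (α t) ((conjWt N k : ℝ) : ℂ) a
      simpa only [Complex.coe_smul] using this
    rw [leftIntegrand, leftIntegrand, modularFn_conjEquiv k n, e1, rightTransl_apply,
      rightTransl_apply, e2, e3, smul_mul_smul_comm, conjWt_mul_self, smul_comm, mul_assoc t⁻¹]
  rw [leftInnerFn, funext e, integral_smul, h, smul_smul, inv_mul_cancel₀ (conjMod_pos k).ne',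
    one_smul]
  rfl

/-- In the crossed product this reads β_k(E(x, y)) = E(x·k, y·k), the equivariance from which V_k is
later extracted. -/
lemma mapCc_leftInner (x y : C_c(G, A)) (k : G) :
    mapCc (idRt A N (k : G ⧸ N)) (leftInner hα μN x y) =
      leftInner hα μN (rightTransl N k x) (rightTransl N k y) := by
  ext t q
  induction q using QuotientGroup.induction_on with
  | H s =>
    rw [leftInner_apply_coe, leftInnerFn_rightTransl]
    rfl

end LeftInnerProduct

end

end CDyn
namespace CDyn

noncomputable section

set_option linter.unusedSectionVars false

/-! ### Fubini for triple integrals of continuous compactly supported functions -/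

section TripleIntegrals

variable {X Y Z E : Type*} [TopologicalSpace X] [TopologicalSpace Y] [TopologicalSpace Z]
  [T2Space X] [T2Space Y] [T2Space Z]
  [MeasurableSpace X] [MeasurableSpace Y] [MeasurableSpace Z]
  [OpensMeasurableSpace X] [OpensMeasurableSpace Y] [OpensMeasurableSpace Z]
  [NormedAddCommGroup E] [NormedSpace ℝ E]
  {μ : Measure X} {ν : Measure Y} {ρ : Measure Z}
  [IsFiniteMeasureOnCompacts μ] [IsFiniteMeasureOnCompacts ν] [IsFiniteMeasureOnCompacts ρ]

lemma integral_swap_fst_snd {f : X → Y → Z → E}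
    (hf : Continuous fun p : (X × Y) × Z => f p.1.1 p.1.2 p.2)
    (h : HasCompactSupport fun p : (X × Y) × Z => f p.1.1 p.1.2 p.2) :
    ∫ x, ∫ y, ∫ z, f x y z ∂ρ ∂ν ∂μ = ∫ y, ∫ x, ∫ z, f x y z ∂ρ ∂μ ∂ν :=
  integral_integral_swap_of_hasCompactSupport (f := fun x y => ∫ z, f x y z ∂ρ)
    (continuous_integral_of_hasCompactSupport (f := fun p : X × Y => f p.1 p.2) hf h)
    (hasCompactSupport_integral (f := fun p : X × Y => f p.1 p.2) h)

lemma integral_swap_snd_thd {f : X → Y → Z → E}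
    (hf : Continuous fun p : (X × Y) × Z => f p.1.1 p.1.2 p.2)
    (h : HasCompactSupport fun p : (X × Y) × Z => f p.1.1 p.1.2 p.2) :
    ∫ x, ∫ y, ∫ z, f x y z ∂ρ ∂ν ∂μ = ∫ x, ∫ z, ∫ y, f x y z ∂ν ∂ρ ∂μ := by
  refine integral_congr_ae (Filter.Eventually.of_forall fun x => ?_)
  refine integral_integral_swap_of_hasCompactSupport (f := f x) ?_ ?_
  · exact hf.comp (((continuous_const (y := x)).prodMk continuous_fst).prodMk continuous_snd)
  · refine HasCompactSupport.intro (h.isCompact.image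
      (f := fun p : (X × Y) × Z => (p.1.2, p.2)) (by fun_prop)) ?_
    rintro ⟨y, z⟩ hp
    by_contra hne
    exact hp ⟨((x, y), z), subset_tsupport _ hne, rfl⟩

lemma integral_reverse {f : X → Y → Z → E}
    (hf : Continuous fun p : (X × Y) × Z => f p.1.1 p.1.2 p.2)
    (h : HasCompactSupport fun p : (X × Y) × Z => f p.1.1 p.1.2 p.2) :
    ∫ x, ∫ y, ∫ z, f x y z ∂ρ ∂ν ∂μ = ∫ z, ∫ y, ∫ x, f x y z ∂μ ∂ν ∂ρ := by
  -- Reversal is a product of three adjacent swaps; `e` and `e'` transport continuity and compact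
  -- support to the two intermediate orders.
  let e : (X × Z) × Y ≃ₜ (X × Y) × Z :=
    { toFun := fun p => ((p.1.1, p.2), p.1.2)
      invFun := fun p => ((p.1.1, p.2), p.1.2)
      continuous_toFun := by fun_prop
      continuous_invFun := by fun_prop }
  let e' : (Z × X) × Y ≃ₜ (X × Y) × Z :=
    { toFun := fun p => ((p.1.2, p.2), p.1.1)
      invFun := fun p => ((p.2, p.1.1), p.1.2)
      continuous_toFun := by fun_prop
      continuous_invFun := by fun_prop }
  rw [integral_swap_snd_thd hf h,
    integral_swap_fst_snd (f := fun x z y => f x y z) (hf.comp e.continuous)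
      (h.comp_homeomorph e),
    integral_swap_snd_thd (f := fun z x y => f x y z) (hf.comp e'.continuous)
      (h.comp_homeomorph e')]

end TripleIntegrals

/-! ### The left inner product acts by rank-one operators -/

section RankOne

variable {G A : Type u} [Group G] [TopologicalSpace G] [IsTopologicalGroup G]
  [LocallyCompactSpace G] [T2Space G] [MeasurableSpace G] [BorelSpace G] [NonUnitalCStarAlgebra A]
  {α : G →* (A ≃⋆ₐ[ℂ] A)} (hα : IsContinuousAction α)
  {N : Subgroup G} [hN : IsClosed (N : Set G)]
  (μG : Measure G) [μG.IsHaarMeasure] [μG.Regular]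
  (μN : Measure N) [μN.IsHaarMeasure] [μN.Regular]
  (σ : CovRep (α.comp N.subtype))

/-- Putting the fibre integral on the test vector leaves the other vector, on which the crossed
product acts, as a plain function of t. -/
lemma form_eq_integral_fibInt_left (ξ η : C_c(G, σ.H)) :
    form μG μN σ ξ η = ∫ t, inner ℂ (fibInt μN σ ξ t) (η t) ∂μG.inv := by
  rw [← form_conj, form, ← integral_conj]
  simp only [inner_conj_symm]

/-- The integrand of the pairing of `F` with `E(x, y) · (z ⊗ h)`, `E(x, y)` being the left inner
product. -/
def leftPairing (F : G → σ.H) (x y z : C_c(G, A)) (h : σ.H) (n : N) (s t : G) : ℂ :=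
  inner ℂ (F s) (σ.π (α s⁻¹ (leftIntegrand α x y t s n * α t (z (t⁻¹ * s)))) h)

/-- The integrand of the pairing of `F` with `x ⊗ (π ⋊ U)(⟨y, z⟩) h`. -/
def rightPairing (F : G → σ.H) (x y z : C_c(G, A)) (h : σ.H) (n : N) (s t : G) : ℂ :=
  inner ℂ (F s) (σ.π (α s⁻¹ (x s))
    (σ.π (wt n • greenIntegrand α y z n t) ((σ.U n : σ.H →L[ℂ] σ.H) h)))

include hα in
lemma integral_leftPairing (F : G → σ.H) (x y z : C_c(G, A)) (h : σ.H) (s t : G) :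
    ∫ n, leftPairing σ F x y z h n s t ∂μN =
      inner ℂ (F s) (σ.π (α s⁻¹ (leftInnerFn μN α x y t s * α t (z (t⁻¹ * s)))) h) := by
  let φ : A →L[ℂ] A :=
    { toFun := α s⁻¹
      map_add' := map_add _
      map_smul' := map_smul _
      cont := continuous_starAlgEquiv _ }
  let T : A →L[ℂ] ℂ := (innerSL ℂ (F s)).comp
    ((σ.orbit (σ.π (α s⁻¹ (α t (z (t⁻¹ * s)))) h)).comp φ)
  have hT : ∀ a, T a = inner ℂ (F s) (σ.π (α s⁻¹ (a * α t (z (t⁻¹ * s)))) h) := by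
    intro a
    rw [map_mul (α s⁻¹), CovRep.π_mul_apply]
    rfl
  have := T.integral_comp_comm (integrable_leftIntegrand μN hα x y t s)
  simp only [hT] at this
  exact this

lemma integral_rightPairing (F : G → σ.H) (x y z : C_c(G, A)) (h : σ.H) (s : G) :
    ∫ n, ∫ t, rightPairing σ F x y z h n s t ∂μG ∂μN =
      inner ℂ (F s) (σ.π (α s⁻¹ (x s))
        (σ.integratedForm μN (toCrossedProduct _ μN (greenInner hα μG y z)) h)) := by
  let T : σ.H →L[ℂ] ℂ := (innerSL ℂ (F s)).comp (σ.π (α s⁻¹ (x s)))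
  have h1 : ∀ n, ∫ t, rightPairing σ F x y z h n s t ∂μG =
      T (σ.π (greenInner hα μG y z n) ((σ.U n : σ.H →L[ℂ] σ.H) h)) := by
    intro n
    rw [π_greenInner]
    exact T.integral_comp_comm (integrable_π_greenIntegrand μG σ hα y z _ n)
  refine (integral_congr_ae (Filter.Eventually.of_forall h1)).trans ?_
  exact T.integral_comp_comm (σ.integrable μN (greenInner hα μG y z) h)

set_option maxHeartbeats 800000 in
-- The equivariance of F produces a factor `wt n` and an operator U_n. The factor joins the `wt n`
-- of Green's inner product to give the weight Δ_N(n)⁻¹ of the left inner product. The operator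
-- cancels the U_n acting on h once the latter has been moved to the left of both π's.
lemma rightPairing_substitution (F : G → σ.H)
    (hF : ∀ s (n : N), F (s * (n : G)⁻¹) = wt n • (σ.U n : σ.H →L[ℂ] σ.H) (F s))
    (x y z : C_c(G, A)) (h : σ.H) (n : N) (s t : G) :
    rightPairing σ F x y z h n (s * (n : G)⁻¹) ((s * (n : G)⁻¹)⁻¹ * t) =
      leftPairing σ F x y z h n s t := by
  -- Both arguments of π are exhibited as α_n of something, the form in which U_n can be pulled out.
  have e1 : α (s * (n : G)⁻¹)⁻¹ (x (s * (n : G)⁻¹)) =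
      (α.comp N.subtype) n (α s⁻¹ (x (s * (n : G)⁻¹))) := by
    change _ = α (n : G) _
    rw [← action_apply_mul, mul_inv_rev, inv_inv]
  have e2 : wt n • greenIntegrand α y z n ((s * (n : G)⁻¹)⁻¹ * t) =
      (α.comp N.subtype) n (wt n • α s⁻¹ (α t (star (y (t⁻¹ * (s * (n : G)⁻¹))) *
        z (t⁻¹ * s)))) := by
    have h1 : ∀ a, α (n : G) (wt n • a) = wt n • α (n : G) a := fun a => by
      have := map_smul (α (n : G)) ((wt n : ℝ) : ℂ) a
      simpa only [Complex.coe_smul] using this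
    change _ = α (n : G) _
    rw [h1, greenIntegrand, ← action_apply_mul, ← action_apply_mul, mul_inv_rev (s * (n : G)⁻¹)⁻¹,
      inv_inv]
    simp only [mul_assoc, inv_mul_cancel, mul_one, mul_inv_rev, inv_inv]
  have e3 : α s⁻¹ (leftIntegrand α x y t s n * α t (z (t⁻¹ * s))) =
      (modularFn n)⁻¹ • (α s⁻¹ (x (s * (n : G)⁻¹)) *
        α s⁻¹ (α t (star (y (t⁻¹ * (s * (n : G)⁻¹))) * z (t⁻¹ * s)))) := by
    have h1 := map_smul (α s⁻¹) (((modularFn n)⁻¹ : ℝ) : ℂ) (x (s * (n : G)⁻¹) *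
      α t (star (y (t⁻¹ * (s * (n : G)⁻¹))) * z (t⁻¹ * s)))
    simp only [Complex.coe_smul] at h1
    rw [leftIntegrand, smul_mul_assoc, mul_assoc, ← map_mul (α t), h1, map_mul (α s⁻¹)]
  have congr_pairing : ∀ {v v' : σ.H} {a a' b b' : A}, v = v' → a = a' → b = b' →
      inner ℂ v (σ.π a (σ.π b ((σ.U n : σ.H →L[ℂ] σ.H) h))) =
        inner ℂ v' (σ.π a' (σ.π b' ((σ.U n : σ.H →L[ℂ] σ.H) h))) := by
    rintro v _ a _ b _ rfl rfl rfl
    rfl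
  refine (congr_pairing (hF s n) e1 e2).trans ?_
  rw [← σ.U_π, ← σ.U_π, inner_smul_left_eq_smul, σ.inner_U, CovRep.π_real_smul]
  refine Eq.trans ?_ (congrArg (fun a => inner ℂ (F s) (σ.π a h)) e3.symm)
  rw [CovRep.π_real_smul, ← wt_mul_self, smul_apply, smul_apply,
    CovRep.π_mul_apply, ContinuousLinearMap.map_smul_of_tower, inner_smul_right_eq_smul,
    inner_smul_right_eq_smul, smul_smul]

lemma continuous_action_comp (hα : IsContinuousAction α) {X : Type*} [TopologicalSpace X]
    {g : X → G} {a : X → A} (hg : Continuous g) (ha : Continuous a) :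
    Continuous fun p => α (g p) (a p) :=
  hα.continuous_uncurry.comp (hg.prodMk ha)

lemma continuous_leftPairing (hα : IsContinuousAction α) {F : G → σ.H} (hF : Continuous F)
    (x y z : C_c(G, A)) (h : σ.H) :
    Continuous fun p : (N × G) × G => leftPairing σ F x y z h p.1.1 p.1.2 p.2 := by
  have h1 : Continuous fun p : (N × G) × G => leftIntegrand α x y p.2 p.1.2 p.1.1 :=
    (continuous_leftIntegrand hα x y).comp
      (by fun_prop : Continuous fun p : (N × G) × G => ((p.2, p.1.2), p.1.1))
  have h2 : Continuous fun p : (N × G) × G => z (p.2⁻¹ * p.1.2) := by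
    have := z.continuous
    fun_prop
  have h3 := continuous_action_comp hα (continuous_snd (X := N × G)) h2
  have h4 : Continuous fun p : (N × G) × G => p.1.2⁻¹ := by fun_prop
  have h5 : Continuous fun p : (N × G) × G => F p.1.2 := by fun_prop
  exact h5.inner ((σ.continuous_π.comp
    (continuous_action_comp hα h4 (h1.mul h3))).clm_apply continuous_const)

lemma continuous_rightPairing (hα : IsContinuousAction α) {F : G → σ.H} (hF : Continuous F)
    (x y z : C_c(G, A)) (h : σ.H) :
    Continuous fun p : (N × G) × G => rightPairing σ F x y z h p.1.1 p.1.2 p.2 := by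
  have h1 : Continuous fun p : (N × G) × G =>
      σ.π (wt p.1.1 • greenIntegrand α y z p.1.1 p.2) ((σ.U p.1.1 : σ.H →L[ℂ] σ.H) h) :=
    (continuous_π_greenIntegrand σ hα y z h).comp
      (by fun_prop : Continuous fun p : (N × G) × G => (p.1.1, p.2))
  have h2 : Continuous fun p : (N × G) × G => x p.1.2 := by
    have := x.continuous
    fun_prop
  have h4 : Continuous fun p : (N × G) × G => p.1.2⁻¹ := by fun_prop
  have h5 : Continuous fun p : (N × G) × G => F p.1.2 := by fun_prop
  exact h5.inner ((σ.continuous_π.comp (continuous_action_comp hα h4 h2)).clm_apply h1)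

/-- F need not have compact support. The factors x and y confine t to supp x (supp y)⁻¹, then z
confines s to t supp z, and x confines n to (supp x)⁻¹ s. -/
lemma hasCompactSupport_leftPairing (F : G → σ.H) (x y z : C_c(G, A)) (h : σ.H) :
    HasCompactSupport fun p : (N × G) × G => leftPairing σ F x y z h p.1.1 p.1.2 p.2 := by
  let T : Set G := (fun p : G × G => p.1 * p.2⁻¹) '' (tsupport x ×ˢ tsupport y)
  have hT : IsCompact T := (x.hasCompactSupport.isCompact.prod
    y.hasCompactSupport.isCompact).image (by fun_prop)
  let S : Set G := (fun p : G × G => p.1 * p.2) '' (T ×ˢ tsupport z)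
  have hS : IsCompact S := (hT.prod z.hasCompactSupport.isCompact).image (by fun_prop)
  refine HasCompactSupport.intro (((isCompact_leftSet (N := N) x hS).prod hS).prod hT) ?_
  rintro ⟨⟨n, s⟩, t⟩ hp
  by_contra hne
  have hx : s * (n : G)⁻¹ ∈ tsupport x := by
    by_contra h'
    simp [leftPairing, leftIntegrand_eq_zero_left h'] at hne
  have hy : t⁻¹ * (s * (n : G)⁻¹) ∈ tsupport y := by
    by_contra h'
    simp [leftPairing, leftIntegrand_eq_zero_right h'] at hne
  have hz : t⁻¹ * s ∈ tsupport z := by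
    by_contra h'
    simp [leftPairing, image_eq_zero_of_notMem_tsupport h'] at hne
  have ht : t ∈ T := ⟨(_, _), ⟨hx, hy⟩, by simp [mul_assoc]⟩
  have hs : s ∈ S := ⟨(t, _), ⟨ht, hz⟩, mul_inv_cancel_left t s⟩
  exact hp ⟨⟨⟨(s, s * (n : G)⁻¹), ⟨hs, hx⟩, by simp⟩, hs⟩, ht⟩

lemma hasCompactSupport_rightPairing (F : G → σ.H) (x y z : C_c(G, A)) (h : σ.H) :
    HasCompactSupport fun p : (N × G) × G => rightPairing σ F x y z h p.1.1 p.1.2 p.2 := by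
  refine HasCompactSupport.intro (((isCompact_greenSet (N := N) y z).prod
    x.hasCompactSupport.isCompact).prod (isCompact_greenSupp y)) ?_
  rintro ⟨⟨n, s⟩, t⟩ hp
  by_contra hne
  refine hp ⟨⟨?_, ?_⟩, ?_⟩ <;> by_contra h'
  · simp [rightPairing, greenIntegrand_eq_zero_right (α := α) y z n t h'] at hne
  · simp [rightPairing, image_eq_zero_of_notMem_tsupport h'] at hne
  · simp [rightPairing, greenIntegrand_eq_zero_left (α := α) y z n t h'] at hne

/-- Fubini brings both sides to the order n, s, t from the outside in. For fixed n the substitution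
uses right invariance of `μG.inv` in s and left invariance of `μG` in t. -/
lemma integral_leftPairing_eq (hα : IsContinuousAction α) {F : G → σ.H} (hFc : Continuous F)
    (hF : ∀ s (n : N), F (s * (n : G)⁻¹) = wt n • (σ.U n : σ.H →L[ℂ] σ.H) (F s))
    (x y z : C_c(G, A)) (h : σ.H) :
    ∫ t, ∫ s, ∫ n, leftPairing σ F x y z h n s t ∂μN ∂μG.inv ∂μG =
      ∫ s, ∫ n, ∫ t, rightPairing σ F x y z h n s t ∂μG ∂μN ∂μG.inv := by
  rw [← integral_reverse (continuous_leftPairing σ hα hFc x y z h)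
    (hasCompactSupport_leftPairing σ F x y z h),
    ← integral_swap_fst_snd (continuous_rightPairing σ hα hFc x y z h)
    (hasCompactSupport_rightPairing σ F x y z h)]
  refine integral_congr_ae (Filter.Eventually.of_forall fun n => ?_)
  refine Eq.trans ?_ (integral_mul_right_eq_self (μ := μG.inv)
    (fun s => ∫ t, rightPairing σ F x y z h n s t ∂μG) (n : G)⁻¹)
  refine integral_congr_ae (Filter.Eventually.of_forall fun s => ?_)
  refine Eq.trans ?_ (integral_mul_left_eq_self (μ := μG)
    (fun t => rightPairing σ F x y z h n (s * (n : G)⁻¹) t) (s * (n : G)⁻¹)⁻¹)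
  exact integral_congr_ae (Filter.Eventually.of_forall fun t =>
    (rightPairing_substitution σ F hF x y z h n s t).symm)

variable [N.Normal]

/-- The factor Δ_G(t)^{-1/2} in `leftInner` is there to cancel the Δ_G(t)^{1/2} of the left
translation. -/
lemma greenVec_leftInner (x y z : C_c(G, A)) (h : σ.H) (t s : G) :
    greenVec hα σ (leftMul (leftInner hα μN x y t) (leftTransl hα t z)) h s =
      σ.π (α s⁻¹ (leftInnerFn μN α x y t s * α t (z (t⁻¹ * s)))) h := by
  rw [greenVec_apply, leftMul_apply, leftInner_apply_coe, leftTransl_apply, smul_mul_smul_comm,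
    inv_mul_cancel₀ (Real.sqrt_pos.2 (modularFn_pos t)).ne', one_smul]

/-- The left inner product of `x` and `y` acts as the rank-one operator
`z ⊗ h ↦ x ⊗ (π ⋊ U)(⟨y, z⟩) h`. -/
lemma greenInd_leftInner (x y : C_c(G, A)) :
    greenInd hα μG μN σ (toCrossedProduct (alphaLt α N) μG (leftInner hα μN x y)) =
      creation hα μG μN σ x ∘L (creation hα μG μN σ y).adjoint := by
  refine GreenSpace.ext_creation hα μG μN σ fun z h => ?_
  rw [ContinuousLinearMap.comp_apply, adjoint_creation_creation]
  refine ext_inner_left ℂ fun v => ?_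
  refine GreenSpace.induction hα μG μN σ v (isClosed_eq (continuous_id'.inner continuous_const)
    (continuous_id'.inner continuous_const)) fun w => ?_
  induction w with
  | zero => rw [map_zero, inner_zero_left, inner_zero_left]
  | add w w' hw hw' => rw [map_add, inner_add_left, inner_add_left, hw, hw']
  | tmul w k =>
    -- The test vector w ⊗ k enters only through F, of which continuity and N-equivariance are all
    -- that is needed.
    let F : G → σ.H := fibInt μN σ (greenVec hα σ w k)
    have hFc : Continuous F := continuous_fibInt μN σ _
    have hF : ∀ s (n : N), F (s * (n : G)⁻¹) = wt n • (σ.U n : σ.H →L[ℂ] σ.H) (F s) :=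
      fibInt_mul_inv μN σ _
    have hR : inner ℂ (GreenSpace.of hα μG μN σ (w ⊗ₜ k)) (creation hα μG μN σ x
        (σ.integratedForm μN (toCrossedProduct _ μN (greenInner hα μG y z)) h)) =
        ∫ s, ∫ n, ∫ t, rightPairing σ F x y z h n s t ∂μG ∂μN ∂μG.inv := by
      refine (inner_creation hα μG μN σ w x k _).trans ?_
      rw [form_eq_integral_fibInt_left]
      exact integral_congr_ae (Filter.Eventually.of_forall fun s =>
        (integral_rightPairing hα μG μN σ F x y z h s).symm)
    have hL : inner ℂ (GreenSpace.of hα μG μN σ (w ⊗ₜ k))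
        (greenInd hα μG μN σ (toCrossedProduct (alphaLt α N) μG (leftInner hα μN x y))
          (creation hα μG μN σ z h)) =
        ∫ t, ∫ s, ∫ n, leftPairing σ F x y z h n s t ∂μN ∂μG.inv ∂μG := by
      have h1 := integral_inner (𝕜 := ℂ) ((greenCovRep hα μG μN σ).integrable μG
        (leftInner hα μN x y) (creation hα μG μN σ z h)) (GreenSpace.of hα μG μN σ (w ⊗ₜ k))
      refine h1.symm.trans ?_
      refine integral_congr_ae (Filter.Eventually.of_forall fun t => ?_)
      have h2 : mulOp hα μG μN σ (leftInner hα μN x y t)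
          (translOp hα μG μN σ t (creation hα μG μN σ z h)) =
          creation hα μG μN σ (leftMul (leftInner hα μN x y t) (leftTransl hα t z)) h :=
        (congrArg (mulOp hα μG μN σ (leftInner hα μN x y t))
          (translOp_tmul hα μG μN σ t z h)).trans (mulOp_tmul hα μG μN σ _ _ h)
      refine (congrArg (fun u => inner ℂ (GreenSpace.of hα μG μN σ (w ⊗ₜ k)) u) h2).trans ?_
      refine (inner_creation hα μG μN σ w _ k h).trans ?_
      rw [form_eq_integral_fibInt_left]
      refine integral_congr_ae (Filter.Eventually.of_forall fun s => ?_)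
      refine Eq.trans ?_ (integral_leftPairing hα μN σ F x y z h s t).symm
      exact congrArg (fun u => inner ℂ (F s) u) (greenVec_leftInner hα μN σ x y z h t s)
    rw [hL, hR]
    exact integral_leftPairing_eq μG μN σ hα hFc hF x y z h

end RankOne

end

end CDyn
namespace CDyn

noncomputable section

set_option linter.unusedSectionVars false

/-! ### Strong continuity from a dense set of vectors -/

section Orbits

variable {Y E : Type*} [TopologicalSpace Y] [NormedAddCommGroup E] [NormedSpace ℂ E]

/-- Contractivity makes approximation of v uniform over the orbit, and uniform limits of continuous
functions are continuous. -/
lemma isClosed_setOf_continuous_orbit (W : Y → E →L[ℂ] E) (hW : ∀ y v, ‖W y v‖ ≤ ‖v‖) :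
    IsClosed {v : E | Continuous fun y => W y v} := by
  refine isClosed_of_closure_subset fun v hv => ?_
  refine continuous_of_uniform_approx_of_continuous fun u hu => ?_
  obtain ⟨ε, hε, hεu⟩ := Metric.mem_uniformity_dist.1 hu
  obtain ⟨w, hw, hd⟩ := Metric.mem_closure_iff.1 hv ε hε
  refine ⟨fun y => W y w, hw, fun y => hεu ?_⟩
  rw [dist_eq_norm, ← map_sub]
  exact (hW y _).trans_lt (by rwa [← dist_eq_norm])

lemma continuous_orbit_of_span_dense (W : Y → E →L[ℂ] E) (hW : ∀ y v, ‖W y v‖ ≤ ‖v‖)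
    {s : Set E} (hs : (Submodule.span ℂ s).topologicalClosure = ⊤)
    (h : ∀ v ∈ s, Continuous fun y => W y v) (v : E) : Continuous fun y => W y v := by
  have hv : v ∈ (Submodule.span ℂ s).topologicalClosure := hs ▸ Submodule.mem_top
  refine closure_minimal (fun w hw => ?_) (isClosed_setOf_continuous_orbit W hW) hv
  change Continuous fun y => W y w
  induction hw using Submodule.span_induction with
  | mem w hw => exact h w hw
  | zero => simpa only [map_zero] using continuous_const
  | add w w' _ _ hw hw' => simp only [map_add]; exact hw.add hw'
  | smul c w _ hw => simp only [map_smul]; exact hw.const_smul c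

end Orbits

/-! ### Approximate units in nondegenerate representations -/

section Nondegenerate

variable {B H : Type*} [NonUnitalCStarAlgebra B] [NormedAddCommGroup H] [InnerProductSpace ℂ H]
  [CompleteSpace H]

/-- An approximate unit converges strongly to the identity on the span of the vectors π(b)h, and
contractivity carries this to the closure. -/
lemma exists_approx_unit_vector (π : B →⋆ₙₐ[ℂ] (H →L[ℂ] H))
    (hπ : (Submodule.span ℂ {v : H | ∃ (b : B) (h : H), π b h = v}).topologicalClosure = ⊤)
    (v : H) {ε : ℝ} (hε : 0 < ε) : ∃ e : B, ‖e‖ ≤ 1 ∧ ‖π e v - v‖ ≤ ε := by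
  let _ := CStarAlgebra.spectralOrder B
  let _ := CStarAlgebra.spectralOrderedRing B
  have hu := CStarAlgebra.increasingApproximateUnit B
  have hle : ∀ b, ‖π b‖ ≤ ‖b‖ := NonUnitalStarAlgHom.norm_apply_le π
  have hcont : Continuous π :=
    AddMonoidHomClass.continuous_of_bound π 1 fun b => by simpa using hle b
  have hspan : ∀ w ∈ Submodule.span ℂ {v : H | ∃ (b : B) (h : H), π b h = v},
      Filter.Tendsto (fun e => π e w) (CStarAlgebra.approximateUnit B) (𝓝 w) := by
    intro w hw
    induction hw using Submodule.span_induction with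
    | mem w hw =>
      obtain ⟨b, h, rfl⟩ := hw
      have h1 := ((hcont.clm_apply (continuous_const (y := h))).tendsto b).comp
        (hu.tendsto_mul_right b)
      refine h1.congr fun e => ?_
      rw [Function.comp_apply, map_mul]
      rfl
    | zero => simpa only [map_zero] using tendsto_const_nhds
    | add w w' _ _ hw hw' => simpa only [map_add] using hw.add hw'
    | smul c w _ hw => simpa only [map_smul] using hw.const_smul c
  have hv : v ∈ closure (Submodule.span ℂ {v : H | ∃ (b : B) (h : H), π b h = v} : Set H) := by
    rw [← Submodule.topologicalClosure_coe, hπ]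
    trivial
  obtain ⟨w, hw, hd⟩ := Metric.mem_closure_iff.1 hv (ε / 3) (by positivity)
  rw [dist_eq_norm] at hd
  obtain ⟨e, he1, he2⟩ := ((Metric.tendsto_nhds.1 (hspan w hw) (ε / 3) (by positivity)).and
    hu.eventually_norm).exists
  rw [dist_eq_norm] at he1
  refine ⟨e, he2, ?_⟩
  have h1 : ‖π e (v - w)‖ ≤ ‖v - w‖ := ((π e).le_opNorm _).trans
    (mul_le_of_le_one_left (norm_nonneg _) ((hle e).trans he2))
  have e1 : π e v - v = π e (v - w) + (π e w - w) - (v - w) := by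
    rw [map_sub]; abel
  rw [e1]
  have h2 := norm_sub_le (π e (v - w) + (π e w - w)) (v - w)
  have h3 := norm_add_le (π e (v - w)) (π e w - w)
  linarith

/-- The norm of v is thus determined by the norms ‖π(e)v‖ with e in the unit ball, which is how it
is recovered below. -/
lemma norm_le_of_forall_norm_apply_le (π : B →⋆ₙₐ[ℂ] (H →L[ℂ] H))
    (hπ : (Submodule.span ℂ {v : H | ∃ (b : B) (h : H), π b h = v}).topologicalClosure = ⊤)
    {v : H} {C : ℝ} (h : ∀ e : B, ‖e‖ ≤ 1 → ‖π e v‖ ≤ C) : ‖v‖ ≤ C := by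
  refine le_of_forall_pos_le_add fun ε hε => ?_
  obtain ⟨e, he, hd⟩ := exists_approx_unit_vector π hπ v hε
  have h1 := norm_sub_norm_le v (π e v)
  rw [norm_sub_rev] at h1
  linarith [h e he]

end Nondegenerate

/-! ### Recovering the norm of v from the norms of the vectors x ⊗ v -/

section Recovery

variable {G A : Type u} [Group G] [TopologicalSpace G] [IsTopologicalGroup G]
  [LocallyCompactSpace G] [T2Space G] [MeasurableSpace G] [BorelSpace G] [NonUnitalCStarAlgebra A]
  {α : G →* (A ≃⋆ₐ[ℂ] A)} (hα : IsContinuousAction α)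
  {N : Subgroup G} [hN : IsClosed (N : Set G)]
  (μG : Measure G) [μG.IsHaarMeasure] [μG.Regular]
  (μN : Measure N) [μN.IsHaarMeasure] [μN.Regular]
  (σ : CovRep (α.comp N.subtype))

/-- The weight `Δ_N(n)^{-1/2} φ(t) φ(tn)`. -/
def bumpWt (φ : C_c(G, ℝ)) (t : G) (n : N) : ℝ := wt n * (φ t * φ (t * (n : G)))

lemma continuous_bumpIntegrand {E : Type*} [NormedAddCommGroup E] [NormedSpace ℝ E]
    (φ : C_c(G, ℝ)) {q : G → N → E} (hq : Continuous q.uncurry) :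
    Continuous fun p : G × N => bumpWt φ p.1 p.2 • q p.1 p.2 := by
  have hφ := φ.continuous
  have h1 : Continuous fun p : G × N => φ p.1 * φ (p.1 * (p.2 : G)) := by fun_prop
  exact ((continuous_wt.comp continuous_snd).mul h1).smul hq

lemma hasCompactSupport_bumpIntegrand {E : Type*} [NormedAddCommGroup E] [NormedSpace ℝ E]
    (φ : C_c(G, ℝ)) (q : G → N → E) :
    HasCompactSupport fun p : G × N => bumpWt φ p.1 p.2 • q p.1 p.2 := by
  have hc := φ.hasCompactSupport.isCompact
  refine HasCompactSupport.intro (hc.prod (isCompact_subgroup_preimage N ((hc.prod hc).image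
    (f := fun p : G × G => p.1⁻¹ * p.2) (by fun_prop)))) ?_
  rintro ⟨t, n⟩ hp
  by_contra hne
  have h1 : t ∈ tsupport φ := by
    by_contra h'
    simp [bumpWt, image_eq_zero_of_notMem_tsupport h'] at hne
  have h2 : t * (n : G) ∈ tsupport φ := by
    by_contra h'
    simp [bumpWt, image_eq_zero_of_notMem_tsupport h'] at hne
  exact hp ⟨h1, (t, t * (n : G)), ⟨h1, h2⟩, inv_mul_cancel_left t n⟩

lemma hasCompactSupport_bumpIntegrand_right {E : Type*} [NormedAddCommGroup E] [NormedSpace ℝ E]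
    (φ : C_c(G, ℝ)) (q : G → N → E) (t : G) :
    HasCompactSupport fun n : N => bumpWt φ t n • q t n := by
  have hs := hasCompactSupport_bumpIntegrand φ q
  refine HasCompactSupport.intro (hs.isCompact.image continuous_snd) fun n hn => ?_
  exact eq_zero_of_notMem_image_snd (f := fun t n => bumpWt φ t n • q t n) hn t

lemma integrable_bumpIntegrand_right {E : Type*} [NormedAddCommGroup E] [NormedSpace ℝ E]
    (φ : C_c(G, ℝ)) {q : G → N → E} (hq : Continuous q.uncurry) (t : G) :
    Integrable (fun n : N => bumpWt φ t n • q t n) μN :=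
  Continuous.integrable_of_hasCompactSupport ((continuous_bumpIntegrand φ hq).comp
    (continuous_const.prodMk continuous_id : Continuous fun n : N => (t, n)))
    (hasCompactSupport_bumpIntegrand_right φ q t)

lemma integrable_integral_bumpIntegrand {E : Type*} [NormedAddCommGroup E] [NormedSpace ℝ E]
    (φ : C_c(G, ℝ)) {q : G → N → E} (hq : Continuous q.uncurry) :
    Integrable (fun t => ∫ n, bumpWt φ t n • q t n ∂μN) μG.inv :=
  Continuous.integrable_of_hasCompactSupport
    (continuous_integral_of_hasCompactSupport (f := fun t n => bumpWt φ t n • q t n)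
      (continuous_bumpIntegrand φ hq) (hasCompactSupport_bumpIntegrand φ q))
    (hasCompactSupport_integral (hasCompactSupport_bumpIntegrand φ q))

/-- If q(1, 1) > 0, choose φ supported close to 1. Then φ(t)φ(tn) ≠ 0 forces t, and also n =
t⁻¹(tn), to be near the identity, where q is positive; so the integral is positive. -/
lemma nonpos_of_forall_bump_integral_eq_zero {q : G → N → ℝ} (hq : Continuous q.uncurry)
    (h : ∀ φ : C_c(G, ℝ),
      ∫ t, ∫ n, bumpWt φ t n • q t n ∂μN ∂μG.inv = 0) : q 1 1 ≤ 0 := by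
  by_contra! hpos
  have hU : q.uncurry ⁻¹' Set.Ioi 0 ∈ 𝓝 ((1, 1) : G × N) :=
    hq.continuousAt.preimage_mem_nhds (Ioi_mem_nhds hpos)
  obtain ⟨U₁, hU₁, U₂, hU₂, hU⟩ := mem_nhds_prod_iff.1 hU
  obtain ⟨U₃, hU₃, hU₃₂⟩ := mem_nhds_subtype (N : Set G) 1 U₂ |>.1 hU₂
  have hdiv : Filter.Tendsto (fun p : G × G => p.1⁻¹ * p.2) (𝓝 (1, 1)) (𝓝 1) := by
    have : Continuous fun p : G × G => p.1⁻¹ * p.2 := by fun_prop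
    simpa using this.tendsto (1, 1)
  obtain ⟨V₁, hV₁, V₂, hV₂, hV⟩ := mem_nhds_prod_iff.1 (hdiv hU₃)
  have hO : U₁ ∩ (V₁ ∩ V₂) ∈ 𝓝 (1 : G) :=
    Filter.inter_mem hU₁ (Filter.inter_mem hV₁ hV₂)
  obtain ⟨f, hf1, hf0, hfc, hf⟩ := exists_continuous_one_zero_of_isCompact
    (isCompact_singleton (x := (1 : G))) (isOpen_interior (s := U₁ ∩ (V₁ ∩ V₂))).isClosed_compl
    (Set.disjoint_singleton_left.2 fun h' => h' (mem_interior_iff_mem_nhds.2 hO))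
  let φ : C_c(G, ℝ) := ⟨f, hfc⟩
  have hsupp : ∀ t, φ t ≠ 0 → t ∈ U₁ ∩ (V₁ ∩ V₂) := by
    intro t ht
    by_contra h'
    exact ht (hf0 fun h'' => h' (interior_subset h''))
  have hφ1 : φ 1 = 1 := hf1 rfl
  have hnn : ∀ t n, 0 ≤ bumpWt φ t n • q t n := by
    intro t n
    by_cases h1 : φ t = 0
    · rw [bumpWt, h1, zero_mul, mul_zero, zero_smul]
    by_cases h2 : φ (t * (n : G)) = 0
    · rw [bumpWt, h2, mul_zero, mul_zero, zero_smul]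
    have hn : n ∈ U₂ := by
      refine hU₃₂ ?_
      have := hV (Set.mk_mem_prod (hsupp t h1).2.1 (hsupp _ h2).2.2)
      simpa using this
    have hq0 : 0 < q t n := hU (Set.mk_mem_prod (hsupp t h1).1 hn)
    exact mul_nonneg (mul_nonneg (wt_pos n).le (mul_nonneg (hf t).1 (hf _).1)) hq0.le
  have hc := continuous_bumpIntegrand φ hq
  have hs := hasCompactSupport_bumpIntegrand φ q
  -- Positivity is used twice: at n = 1 for the inner integral with t = 1, then at t = 1 for the
  -- outer one.
  have hpos1 : 0 < ∫ n, bumpWt φ 1 n • q 1 n ∂μN := by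
    refine Continuous.integral_pos_of_hasCompactSupport_nonneg_nonzero (x := 1)
      (hc.comp (continuous_const.prodMk continuous_id : Continuous fun n : N => ((1 : G), n)))
      (hasCompactSupport_bumpIntegrand_right φ q 1) (hnn 1) ?_
    rw [bumpWt, OneMemClass.coe_one, mul_one, hφ1, mul_one, mul_one]
    exact (mul_pos (wt_pos _) hpos).ne'
  refine (Continuous.integral_pos_of_hasCompactSupport_nonneg_nonzero (μ := μG.inv) (x := 1)
    (continuous_integral_of_hasCompactSupport
      (f := fun t n => bumpWt φ t n • q t n) hc hs)
    (hasCompactSupport_integral hs) (fun t => integral_nonneg (hnn t)) hpos1.ne').ne' (h φ)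

/-- The sign argument is applied to Re q and to −Re q. The real part suffices, since the values to
be compared at (1, 1) have squared norms as real parts. -/
lemma eq_zero_of_forall_bump_integral_eq_zero {q : G → N → ℂ} (hq : Continuous q.uncurry)
    (h : ∀ φ : C_c(G, ℝ),
      ∫ t, ∫ n, bumpWt φ t n • q t n ∂μN ∂μG.inv = 0) : (q 1 1).re = 0 := by
  have hre : ∀ φ : C_c(G, ℝ),
      ∫ t, ∫ n, bumpWt φ t n • (q t n).re ∂μN ∂μG.inv = 0 := by
    intro φ
    have h1 : ∀ t, ∫ n, bumpWt φ t n • (q t n).re ∂μN =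
        Complex.reCLM (∫ n, bumpWt φ t n • q t n ∂μN) := by
      intro t
      rw [← ContinuousLinearMap.integral_comp_comm _ (integrable_bumpIntegrand_right μN φ hq t)]
      simp only [map_smul, Complex.reCLM_apply]
    rw [integral_congr_ae (Filter.Eventually.of_forall h1), ContinuousLinearMap.integral_comp_comm _
      (integrable_integral_bumpIntegrand μG μN φ hq), h φ, map_zero]
  refine le_antisymm (nonpos_of_forall_bump_integral_eq_zero μG μN
    (q := fun t n => (q t n).re) (Complex.continuous_re.comp hq) hre) ?_
  have := nonpos_of_forall_bump_integral_eq_zero μG μN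
    (q := fun t n => -(q t n).re) (Complex.continuous_re.comp hq).neg (fun φ => by
      simp only [smul_neg, integral_neg, hre φ, neg_zero])
  linarith

/-- The function `s ↦ φ(s) a`. -/
def bumpMul (φ : C_c(G, ℝ)) (a : A) : C_c(G, A) where
  toFun s := φ s • a
  continuous_toFun := φ.continuous.smul continuous_const
  hasCompactSupport' := by
    refine φ.hasCompactSupport.mono fun s hs h => hs ?_
    change φ s • a = 0
    rw [show φ s = 0 from h, zero_smul]

lemma bumpMul_apply (φ : C_c(G, ℝ)) (a : A) (s : G) : bumpMul φ a s = φ s • a := rfl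

variable [N.Normal]

/-- The pairing that governs the norm of `(φ a · k) ⊗ v` for bump functions `φ`. -/
def bumpPairing (k : G) (a : A) (v : σ.H) (t : G) (n : N) : ℂ :=
  inner ℂ (σ.π (α (k * t⁻¹) a) v)
    (σ.π (α (k * t⁻¹) a) ((σ.U (conjEquiv N k⁻¹ n) : σ.H →L[ℂ] σ.H) v))

lemma continuous_bumpPairing (hα : IsContinuousAction α) (k : G) (a : A) (v : σ.H) :
    Continuous (bumpPairing σ k a v).uncurry := by
  have h1 : Continuous fun p : G × N => σ.π (α (k * p.1⁻¹) a) :=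
    σ.continuous_π.comp (continuous_action_comp hα (by fun_prop) continuous_const)
  have h2 : Continuous fun p : G × N => (σ.U (conjEquiv N k⁻¹ p.2) : σ.H →L[ℂ] σ.H) v :=
    (σ.isCovariant.continuous v).comp
      ((conjEquiv N k⁻¹).continuous.comp continuous_snd)
  exact (h1.clm_apply continuous_const).inner (h1.clm_apply h2)

lemma bumpPairing_one_one (k : G) (a : A) (v : σ.H) :
    (bumpPairing σ k a v 1 1).re = ‖σ.π (α k a) v‖ ^ 2 := by
  rw [bumpPairing, map_one, σ.U_one, inv_one, mul_one]
  exact (norm_sq_eq_re_inner (𝕜 := ℂ) _).symm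

lemma conjEquiv_inv_conjEquiv (k : G) (n : N) : conjEquiv N k⁻¹ (conjEquiv N k n) = n := by
  ext
  rw [coe_conjEquiv, coe_conjEquiv]
  group

set_option maxHeartbeats 1000000 in
-- The right side is evaluated at (tk, k⁻¹nk) so that, after substitution, φ is centred at the
-- identity for every k. The conjugation by k⁻¹ built into `bumpPairing` restores U_n.
lemma inner_greenVec_bump (k : G) (φ : C_c(G, ℝ)) (a : A) (v : σ.H) (t : G) (n : N) :
    inner ℂ (greenVec hα σ (rightTransl N k (bumpMul φ a)) v t)
      (fibIntegrand σ (greenVec hα σ (rightTransl N k (bumpMul φ a)) v) t n) =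
    (conjMod N k)⁻¹ • (bumpWt φ (t * k) (conjEquiv N k n) •
      bumpPairing σ k a v (t * k) (conjEquiv N k n)) := by
  have e1 : ∀ s : G, greenVec hα σ (rightTransl N k (bumpMul φ a)) v s =
      (conjWt N k * φ (s * k)) • σ.π (α s⁻¹ a) v := by
    intro s
    have h := map_smul (α s⁻¹) ((conjWt N k * φ (s * k) : ℝ) : ℂ) a
    simp only [Complex.coe_smul] at h
    rw [greenVec_apply, rightTransl_apply, bumpMul_apply, smul_smul, h, CovRep.π_real_smul]
    rfl
  have e2 : fibIntegrand σ (greenVec hα σ (rightTransl N k (bumpMul φ a)) v) t n =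
      (wt n * (conjWt N k * φ (t * n * k))) •
        σ.π (α t⁻¹ a) ((σ.U n : σ.H →L[ℂ] σ.H) v) := by
    have h := σ.U_π_translate a v t⁻¹ n
    rw [inv_inv] at h
    refine (congrArg (fun u => wt n • (σ.U n : σ.H →L[ℂ] σ.H) u) (e1 (t * n))).trans ?_
    rw [ContinuousLinearMap.map_smul_of_tower, smul_smul]
    exact congrArg (fun u => (wt n * (conjWt N k * φ (t * n * k))) • u) h
  have e3 : bumpPairing σ k a v (t * k) (conjEquiv N k n) =
      inner ℂ (σ.π (α t⁻¹ a) v) (σ.π (α t⁻¹ a) ((σ.U n : σ.H →L[ℂ] σ.H) v)) :=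
    congrArg₂ (fun s m => inner ℂ (σ.π (α s a) v) (σ.π (α s a) ((σ.U m : σ.H →L[ℂ] σ.H) v)))
      (by group : k * (t * k)⁻¹ = t⁻¹) (conjEquiv_inv_conjEquiv k n)
  have e4 : bumpWt φ (t * k) (conjEquiv N k n) = wt n * (φ (t * k) * φ (t * n * k)) :=
    congrArg₂ (fun r s => r * (φ (t * k) * φ s)) (wt_conjEquiv k n) (mul_conjEquiv t k n)
  refine (congrArg₂ (fun u w => inner ℂ u w) (e1 t) e2).trans ?_
  rw [e3, e4, ← conjWt_mul_self, inner_smul_left_eq_smul, inner_smul_right_eq_smul, smul_smul,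
    smul_smul]
  congr 1
  ring

/-- The shift t ↦ tk preserves the right Haar measure, and the Jacobian of n ↦ k⁻¹nk cancels the
factor c(k)². -/
lemma form_bump (k : G) (φ : C_c(G, ℝ)) (a : A) (v : σ.H) :
    form μG μN σ (greenVec hα σ (rightTransl N k (bumpMul φ a)) v)
      (greenVec hα σ (rightTransl N k (bumpMul φ a)) v) =
    ∫ t, ∫ n, bumpWt φ t n • bumpPairing σ k a v t n ∂μN ∂μG.inv := by
  rw [form, ← integral_mul_right_eq_self (μ := μG.inv) (fun t => ∫ n,
    bumpWt φ t n • bumpPairing σ k a v t n ∂μN) k]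
  refine integral_congr_ae (Filter.Eventually.of_forall fun t => ?_)
  change inner ℂ _ (∫ n, fibIntegrand σ _ t n ∂μN) = _
  rw [← integral_inner (integrable_fibIntegrand μN σ _ t)]
  refine (integral_congr_ae (Filter.Eventually.of_forall fun n =>
    inner_greenVec_bump hα σ k φ a v t n)).trans ?_
  have h := integral_conjEquiv μN (fun n => bumpWt φ (t * k) n •
    bumpPairing σ k a v (t * k) n) k
  rw [integral_smul, h, smul_smul, inv_mul_cancel₀ (conjMod_pos k).ne', one_smul]

lemma form_greenVec_self (x : C_c(G, A)) (v : σ.H) :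
    form μG μN σ (greenVec hα σ x v) (greenVec hα σ x v) =
      ((‖creation hα μG μN σ x v‖ ^ 2 : ℝ) : ℂ) := by
  rw [← inner_creation, inner_self_eq_norm_sq_to_K]
  push_cast
  rfl

/-- The vectors `x ⊗ v`, `x ∈ C_c(G, A)`, determine the norm of `v`. -/
lemma norm_eq_of_forall_norm_creation_eq (k : G) {v w : σ.H}
    (h : ∀ x, ‖creation hα μG μN σ x v‖ = ‖creation hα μG μN σ (rightTransl N k x) w‖) :
    ‖v‖ = ‖w‖ := by
  -- The hypothesis for x = φa, with all φ, says that two continuous pairings have equal integrals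
  -- against every bump weight, so their real parts agree at (1, 1).
  have key : ∀ a, ‖σ.π a v‖ = ‖σ.π (α k a) w‖ := by
    intro a
    have h0 := eq_zero_of_forall_bump_integral_eq_zero μG μN
      (q := fun t n => bumpPairing σ 1 a v t n - bumpPairing σ k a w t n)
      ((continuous_bumpPairing σ hα 1 a v).sub (continuous_bumpPairing σ hα k a w)) fun φ => by
        have h1 := form_bump hα μG μN σ 1 φ a v
        have h2 := form_bump hα μG μN σ k φ a w
        rw [form_greenVec_self, rightTransl_one] at h1
        rw [form_greenVec_self, ← h, h1] at h2
        simp only [smul_sub]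
        have hv := continuous_bumpPairing σ hα 1 a v
        have hw := continuous_bumpPairing σ hα k a w
        rw [integral_congr_ae (Filter.Eventually.of_forall fun t =>
          integral_sub (integrable_bumpIntegrand_right μN φ hv t)
            (integrable_bumpIntegrand_right μN φ hw t)),
          integral_sub (integrable_integral_bumpIntegrand μG μN φ hv)
            (integrable_integral_bumpIntegrand μG μN φ hw), h2, sub_self]
    rw [Complex.sub_re, bumpPairing_one_one, bumpPairing_one_one, sub_eq_zero, map_one] at h0
    exact (sq_eq_sq₀ (norm_nonneg _) (norm_nonneg _)).1 h0
  refine le_antisymm ?_ ?_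
  · refine norm_le_of_forall_norm_apply_le σ.π σ.isCovariant.nondegenerate fun e he => ?_
    rw [key]
    refine ((σ.π _).le_opNorm w).trans (mul_le_of_le_one_left (norm_nonneg _) ?_)
    exact (σ.norm_π_le _).trans ((norm_starAlgEquiv _ _).trans_le he)
  · refine norm_le_of_forall_norm_apply_le σ.π σ.isCovariant.nondegenerate fun e he => ?_
    -- For the reverse bound, testing with α_k⁻¹(e) places e itself next to w.
    have := key (α k⁻¹ e)
    rw [action_apply_inv] at this
    rw [← this]
    refine ((σ.π _).le_opNorm v).trans (mul_le_of_le_one_left (norm_nonneg _) ?_)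
    exact (σ.norm_π_le _).trans ((norm_starAlgEquiv _ _).trans_le he)

end Recovery

end

end CDyn
namespace CDyn

noncomputable section

set_option linter.unusedSectionVars false

/-! ### From a unitary on X ⊗ H to a unitary on H -/

section Intertwiner

variable {G A : Type u} [Group G] [TopologicalSpace G] [IsTopologicalGroup G]
  [LocallyCompactSpace G] [T2Space G] [MeasurableSpace G] [BorelSpace G] [NonUnitalCStarAlgebra A]
  {α : G →* (A ≃⋆ₐ[ℂ] A)} (hα : IsContinuousAction α)
  {N : Subgroup G} [hN : IsClosed (N : Set G)] [N.Normal]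
  (μG : Measure G) [μG.IsHaarMeasure] [μG.Regular]
  (μN : Measure N) [μN.IsHaarMeasure] [μN.Regular]
  (σ : CovRep (α.comp N.subtype))

/-- Norm recovery with k = 1, comparing v − w with 0. -/
lemma eq_of_forall_creation_eq {v w : σ.H}
    (h : ∀ x, creation hα μG μN σ x v = creation hα μG μN σ x w) : v = w := by
  have := norm_eq_of_forall_norm_creation_eq hα μG μN σ 1 (v := v - w) (w := 0) fun x => by
    rw [map_sub, h, sub_self, map_zero]
  rwa [norm_zero, norm_eq_zero, sub_eq_zero] at this

/-- If v is orthogonal to every y^* z, taking z = y ⊗ v gives ‖y ⊗ v‖ = 0 for all y, hence v = 0. -/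
lemma span_adjoint_creation_dense :
    (Submodule.span ℂ {v : σ.H | ∃ (y : C_c(G, A)) (z : GreenSpace hα μG μN σ),
      (creation hα μG μN σ y).adjoint z = v}).topologicalClosure = ⊤ := by
  rw [Submodule.topologicalClosure_eq_top_iff, Submodule.eq_bot_iff]
  intro v hv
  refine eq_of_forall_creation_eq hα μG μN σ fun x => ?_
  rw [map_zero, ← inner_self_eq_zero (𝕜 := ℂ), ← ContinuousLinearMap.adjoint_inner_left]
  exact (Submodule.mem_orthogonal _ v).1 hv _ (Submodule.subset_span ⟨x, _, rfl⟩)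

lemma span_creation_dense :
    (Submodule.span ℂ {w : GreenSpace hα μG μN σ | ∃ (x : C_c(G, A)) (h : σ.H),
      creation hα μG μN σ x h = w}).topologicalClosure = ⊤ := by
  rw [eq_top_iff]
  rintro z -
  refine GreenSpace.induction hα μG μN σ z (Submodule.isClosed_topologicalClosure _) fun v => ?_
  refine Submodule.le_topologicalClosure _ ?_
  induction v with
  | zero => rw [map_zero]; exact Submodule.zero_mem _
  | tmul x h => exact Submodule.subset_span ⟨x, h, rfl⟩
  | add v w hv hw => rw [map_add]; exact Submodule.add_mem _ hv hw

variable (T : GreenSpace hα μG μN σ ≃ₗᵢ[ℂ] GreenSpace hα μG μN σ) (k : G)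

/-- The pairs `(v, w)` with `T (x ⊗ v) = (x · k) ⊗ w` for all `x`. -/
def intertwinerGraph : Submodule ℂ (σ.H × σ.H) where
  carrier := {p | ∀ x, T (creation hα μG μN σ x p.1) =
    creation hα μG μN σ (rightTransl N k x) p.2}
  add_mem' hp hq x := by
    rw [Prod.fst_add, Prod.snd_add, map_add, map_add, map_add, hp x, hq x]
  zero_mem' x := by rw [Prod.fst_zero, Prod.snd_zero, map_zero, map_zero, map_zero]
  smul_mem' c p hp x := by
    rw [Prod.smul_fst, Prod.smul_snd, map_smul, map_smul, map_smul, hp x]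

lemma mem_intertwinerGraph {p : σ.H × σ.H} : p ∈ intertwinerGraph hα μG μN σ T k ↔
    ∀ x, T (creation hα μG μN σ x p.1) = creation hα μG μN σ (rightTransl N k x) p.2 := Iff.rfl

lemma isClosed_intertwinerGraph :
    IsClosed (intertwinerGraph hα μG μN σ T k : Set (σ.H × σ.H)) := by
  have : (intertwinerGraph hα μG μN σ T k : Set (σ.H × σ.H)) =
      ⋂ x, {p | T (creation hα μG μN σ x p.1) =
        creation hα μG μN σ (rightTransl N k x) p.2} := by
    ext p
    rw [Set.mem_iInter]
    rfl
  rw [this]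
  exact isClosed_iInter fun x => isClosed_eq
    (T.continuous.comp ((creation hα μG μN σ x).continuous.comp continuous_fst))
    ((creation hα μG μN σ (rightTransl N k x)).continuous.comp continuous_snd)

/-- T preserves norms, so norm recovery applies. This makes the relation single-valued in both
directions. -/
lemma norm_eq_of_mem_intertwinerGraph {p : σ.H × σ.H}
    (hp : p ∈ intertwinerGraph hα μG μN σ T k) : ‖p.1‖ = ‖p.2‖ :=
  norm_eq_of_forall_norm_creation_eq hα μG μN σ k fun x => by
    rw [← (mem_intertwinerGraph hα μG μN σ T k).1 hp x, LinearIsometryEquiv.norm_map]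

instance : CompleteSpace (intertwinerGraph hα μG μN σ T k) :=
  (isClosed_intertwinerGraph hα μG μN σ T k).completeSpace_coe

/-- The first projection of the graph. -/
def intertwinerFst : intertwinerGraph hα μG μN σ T k →ₗᵢ[ℂ] σ.H where
  toLinearMap := (LinearMap.fst ℂ σ.H σ.H).comp (intertwinerGraph hα μG μN σ T k).subtype
  norm_map' p := by
    have := norm_eq_of_mem_intertwinerGraph hα μG μN σ T k p.2
    -- The product norm is the maximum, here of two equal numbers, so the projection is isometric.
    change ‖p.1.1‖ = max ‖p.1.1‖ ‖p.1.2‖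
    rw [this, max_self]

/-- The second projection of the graph. -/
def intertwinerSnd : intertwinerGraph hα μG μN σ T k →ₗᵢ[ℂ] σ.H where
  toLinearMap := (LinearMap.snd ℂ σ.H σ.H).comp (intertwinerGraph hα μG μN σ T k).subtype
  norm_map' p := by
    have := norm_eq_of_mem_intertwinerGraph hα μG μN σ T k p.2
    change ‖p.1.2‖ = max ‖p.1.1‖ ‖p.1.2‖
    rw [this, max_self]

/-- The range of an isometry from a complete space is closed. -/
lemma surjective_of_span_dense {E F : Type*} [NormedAddCommGroup E] [NormedSpace ℂ E]
    [CompleteSpace E] [NormedAddCommGroup F] [NormedSpace ℂ F] (f : E →ₗᵢ[ℂ] F) {s : Set F}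
    (hs : (Submodule.span ℂ s).topologicalClosure = ⊤) (h : ∀ v ∈ s, ∃ u, f u = v) :
    Function.Surjective f := by
  have hc : IsClosed (f.toLinearMap.range : Set F) := by
    rw [LinearMap.coe_range]
    exact f.isometry.isClosedEmbedding.isClosed_range
  have hle : (Submodule.span ℂ s).topologicalClosure ≤ f.toLinearMap.range :=
    Submodule.topologicalClosure_minimal _ (Submodule.span_le.2 h) hc
  intro v
  exact hle (hs ▸ Submodule.mem_top)

/-- A unitary `T` that intertwines the rank-one operators of Green's bimodule with their right
translates by `k` comes from a unitary on `H`. -/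
lemma exists_intertwiner
    (hT : ∀ x y z, T (creation hα μG μN σ x ((creation hα μG μN σ y).adjoint z)) =
      creation hα μG μN σ (rightTransl N k x)
        ((creation hα μG μN σ (rightTransl N k y)).adjoint (T z))) :
    ∃ V : σ.H ≃ₗᵢ[ℂ] σ.H, ∀ x v, T (creation hα μG μN σ x v) =
      creation hα μG μN σ (rightTransl N k x) (V v) := by
  have hmem : ∀ y z, ((creation hα μG μN σ y).adjoint z,
      (creation hα μG μN σ (rightTransl N k y)).adjoint (T z)) ∈
        intertwinerGraph hα μG μN σ T k := fun y z x => hT x y z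
  have h1 : Function.Surjective (intertwinerFst hα μG μN σ T k) := by
    refine surjective_of_span_dense _ (span_adjoint_creation_dense hα μG μN σ) ?_
    rintro _ ⟨y, z, rfl⟩
    exact ⟨⟨_, hmem y z⟩, rfl⟩
  have h2 : Function.Surjective (intertwinerSnd hα μG μN σ T k) := by
    refine surjective_of_span_dense _ (span_adjoint_creation_dense hα μG μN σ) ?_
    rintro _ ⟨y, z, rfl⟩
    -- Undoing both the translation and T makes the second coordinate equal to y^* z.
    refine ⟨⟨_, hmem (rightTransl N k⁻¹ y) (T.symm z)⟩, ?_⟩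
    change (creation hα μG μN σ (rightTransl N k (rightTransl N k⁻¹ y))).adjoint
      (T (T.symm z)) = _
    rw [rightTransl_inv_self, LinearIsometryEquiv.apply_symm_apply]
  let e1 := LinearIsometryEquiv.ofSurjective _ h1
  let e2 := LinearIsometryEquiv.ofSurjective _ h2
  refine ⟨e1.symm.trans e2, fun x v => ?_⟩
  have h3 : (e1.symm v).1.1 = v := e1.apply_symm_apply v
  have h4 := (mem_intertwinerGraph hα μG μN σ T k).1 (e1.symm v).2 x
  rw [h3] at h4
  exact h4

end Intertwiner

/-! ### Constructing the extension of (π, U) to K -/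

section Extension

variable {G A : Type u} [Group G] [TopologicalSpace G] [IsTopologicalGroup G]
  [LocallyCompactSpace G] [T2Space G] [MeasurableSpace G] [BorelSpace G] [NonUnitalCStarAlgebra A]
  {α : G →* (A ≃⋆ₐ[ℂ] A)} (hα : IsContinuousAction α)
  {N : Subgroup G} [hN : IsClosed (N : Set G)] [N.Normal] {K : Subgroup G}
  (μG : Measure G) [μG.IsHaarMeasure] [μG.Regular]
  (μN : Measure N) [μN.IsHaarMeasure] [μN.Regular]
  (σ : CovRep (α.comp N.subtype))

lemma betaRestrict_toCrossedProduct_leftInner (x y : C_c(G, A)) (k : K) :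
    betaRestrict α N μG K (k : K ⧸ N.subgroupOf K)
      (toCrossedProduct (alphaLt α N) μG (leftInner hα μN x y)) =
    toCrossedProduct (alphaLt α N) μG
      (leftInner hα μN (rightTransl N (k : G) x) (rightTransl N (k : G) y)) := by
  rw [← mapCc_leftInner]
  rfl

set_option maxHeartbeats 1600000 in
/-- A representation of `K/N` that is covariant for the induced representation yields an extension
of `(π, U)` to `K`. -/
lemma exists_extension_of_isCovariant (hNK : N ≤ K)
    (T : (K ⧸ N.subgroupOf K) →*
      unitary (GreenSpace hα μG μN σ →L[ℂ] GreenSpace hα μG μN σ))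
    (hT : IsCovariant (betaRestrict α N μG K) (greenInd hα μG μN σ) T) :
    ∃ V : K →* unitary (σ.H →L[ℂ] σ.H), IsCovariant (α.comp K.subtype) σ.π V ∧
      ∀ n : N, V ⟨n, hNK n.2⟩ = σ.U n := by
  let T' : K → GreenSpace hα μG μN σ →L[ℂ] GreenSpace hα μG μN σ := fun k =>
    T (k : K ⧸ N.subgroupOf K)
  -- Covariance is applied to the rank-one element E(x, y) and evaluated at T_k z, where T_k^*
  -- cancels.
  have hrank : ∀ (k : K) x y z,
      T' k (creation hα μG μN σ x ((creation hα μG μN σ y).adjoint z)) =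
        creation hα μG μN σ (rightTransl N (k : G) x)
          ((creation hα μG μN σ (rightTransl N (k : G) y)).adjoint (T' k z)) := by
    intro k x y z
    have h1 := hT.covariant (k : K ⧸ N.subgroupOf K)
      (toCrossedProduct (alphaLt α N) μG (leftInner hα μN x y))
    rw [betaRestrict_toCrossedProduct_leftInner, greenInd_leftInner, greenInd_leftInner] at h1
    have h2 := congrArg (fun S : GreenSpace hα μG μN σ →L[ℂ] GreenSpace hα μG μN σ =>
      S (T' k z)) h1
    have h3 : star (T (k : K ⧸ N.subgroupOf K) :
        GreenSpace hα μG μN σ →L[ℂ] GreenSpace hα μG μN σ) (T' k z) = z :=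
      congrArg (fun S : GreenSpace hα μG μN σ →L[ℂ] GreenSpace hα μG μN σ => S z)
        (Unitary.coe_star_mul_self (T (k : K ⧸ N.subgroupOf K)))
    refine Eq.trans ?_ h2.symm
    change _ = T' k (creation hα μG μN σ x ((creation hα μG μN σ y).adjoint
      (star (T (k : K ⧸ N.subgroupOf K) :
        GreenSpace hα μG μN σ →L[ℂ] GreenSpace hα μG μN σ) (T' k z))))
    rw [h3]
  have hex : ∀ k : K, ∃ V : unitary (σ.H →L[ℂ] σ.H), ∀ x v,
      T' k (creation hα μG μN σ x v) =
        creation hα μG μN σ (rightTransl N (k : G) x) ((V : σ.H →L[ℂ] σ.H) v) := by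
    intro k
    obtain ⟨V, hV⟩ := exists_intertwiner hα μG μN σ
      (Unitary.linearIsometryEquiv (T (k : K ⧸ N.subgroupOf K))) (k : G) (hrank k)
    exact ⟨Unitary.linearIsometryEquiv.symm V, hV⟩
  choose V hV using hex
  -- The translates x·k exhaust `C_c(G, A)`, so T_k determines V_k. Each remaining algebraic
  -- property is then tested after applying `creation` of x·k.
  have huniq : ∀ (k : G) {v w : σ.H},
      (∀ x, creation hα μG μN σ (rightTransl N k x) v =
        creation hα μG μN σ (rightTransl N k x) w) → v = w := by
    intro k v w h
    refine eq_of_forall_creation_eq hα μG μN σ fun x => ?_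
    have := h (rightTransl N k⁻¹ x)
    rwa [rightTransl_inv_self] at this
  have hmul : ∀ k l : K, V (k * l) = V k * V l := by
    intro k l
    refine Subtype.ext (ContinuousLinearMap.ext fun v => huniq ((k * l : K) : G) fun x => ?_)
    rw [← hV (k * l) x v]
    have h1 : T' (k * l) = T' k * T' l := by
      change ((T ((k : K ⧸ N.subgroupOf K) * (l : K ⧸ N.subgroupOf K)) :
        unitary (GreenSpace hα μG μN σ →L[ℂ] GreenSpace hα μG μN σ)) :
          GreenSpace hα μG μN σ →L[ℂ] GreenSpace hα μG μN σ) = _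
      rw [map_mul]
      rfl
    rw [h1, mul_apply_eq_comp, hV, hV, Subgroup.coe_mul, rightTransl_mul]
    rfl
  -- π(a) is absorbed into x as a right multiplication, translated by k, and released as π(α_k(a)).
  have hcov : ∀ (k : K) (a : A) (v : σ.H), (V k : σ.H →L[ℂ] σ.H) (σ.π a v) =
      σ.π (α (k : G) a) ((V k : σ.H →L[ℂ] σ.H) v) := by
    intro k a v
    refine huniq (k : G) fun x => ?_
    rw [← hV, creation_π, creation_π, hV, rightTransl_rightMul]
  -- On the dense span of the vectors y^* z one has V_k(y^* z) = (y·k)^* T_k z, a norm continuous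
  -- family applied to a continuous one.
  have hcont : ∀ v : σ.H, Continuous fun k : K => (V k : σ.H →L[ℂ] σ.H) v := by
    refine continuous_orbit_of_span_dense (fun k : K => (V k : σ.H →L[ℂ] σ.H))
      (fun k v => (norm_unitary_apply (V k) v).le) (span_adjoint_creation_dense hα μG μN σ) ?_
    rintro _ ⟨y, z, rfl⟩
    have h1 : ∀ k : K, (V k : σ.H →L[ℂ] σ.H) ((creation hα μG μN σ y).adjoint z) =
        (creation hα μG μN σ (rightTransl N (k : G) y)).adjoint (T' k z) := fun k =>
      huniq (k : G) fun x => by rw [← hV, hrank]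
    rw [funext h1]
    have h2 : Continuous fun k : K => T' k z :=
      (hT.continuous z).comp QuotientGroup.continuous_mk
    have h3 : Continuous fun k : K => (creation hα μG μN σ (rightTransl N (k : G) y)).adjoint :=
      ContinuousLinearMap.adjoint.continuous.comp
        ((continuous_creation_rightTransl hα μG μN σ y).comp continuous_subtype_val)
    exact h3.clm_apply h2
  refine ⟨MonoidHom.mk' V hmul, ⟨σ.isCovariant.nondegenerate, hcont, fun k a => ?_⟩, fun n => ?_⟩
  · change σ.π (α (k : G) a) = (V k : σ.H →L[ℂ] σ.H) * σ.π a * star (V k : σ.H →L[ℂ] σ.H)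
    have h1 : (V k : σ.H →L[ℂ] σ.H) * σ.π a = σ.π (α (k : G) a) * (V k : σ.H →L[ℂ] σ.H) :=
      ContinuousLinearMap.ext (hcov k a)
    have h2 : (V k : σ.H →L[ℂ] σ.H) * star (V k : σ.H →L[ℂ] σ.H) = 1 :=
      Unitary.coe_mul_star_self (V k)
    rw [h1, mul_assoc, h2, mul_one]
  -- T is trivial on the coset of n, and balancing over N shows that U_n satisfies the equation
  -- determining V_n.
  · refine Subtype.ext (ContinuousLinearMap.ext fun v => huniq (n : G) fun x => ?_)
    have h1 : T' ⟨n, hNK n.2⟩ = 1 := by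
      have : ((⟨n, hNK n.2⟩ : K) : K ⧸ N.subgroupOf K) = 1 :=
        (QuotientGroup.eq_one_iff _).2 n.2
      change ((T ((⟨n, hNK n.2⟩ : K) : K ⧸ N.subgroupOf K) :
        unitary (GreenSpace hα μG μN σ →L[ℂ] GreenSpace hα μG μN σ)) :
          GreenSpace hα μG μN σ →L[ℂ] GreenSpace hα μG μN σ) = 1
      rw [this, map_one]
      rfl
    rw [creation_rightTransl_coe]
    refine (hV ⟨n, hNK n.2⟩ x v).symm.trans ?_
    rw [h1]
    rfl

end Extension

end

end CDyn
namespace CDyn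

noncomputable section

set_option linter.unusedSectionVars false

/-! ### Homomorphisms on the crossed product are determined on C_c(G, B) -/

section CrossedProductExt

variable {G B : Type u} [Group G] [TopologicalSpace G]
  [MeasurableSpace G] [BorelSpace G] [NonUnitalCStarAlgebra B]
  (γ : G →* (B ≃⋆ₐ[ℂ] B)) (μ : Measure G) [IsFiniteMeasureOnCompacts μ]

/-- Two `*`-homomorphisms on the crossed product agree if they agree on `C_c(G, B)`. -/
lemma crossedProduct_hom_ext {D : Type*} [NonUnitalCStarAlgebra D]
    {φ ψ : CrossedProduct γ μ →⋆ₙₐ[ℂ] D}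
    (h : ∀ f, φ (toCrossedProduct γ μ f) = ψ (toCrossedProduct γ μ f)) : φ = ψ := by
  -- The generated algebra lives in `UniversalAlgebra`, so the equalizer is pushed forward there for
  -- the comparison.
  have hadj : NonUnitalStarAlgebra.adjoin ℂ (Set.range (universalRep γ μ)) ≤
      (NonUnitalStarAlgHom.equalizer φ ψ).map (CrossedProduct.incl γ μ) := by
    refine NonUnitalStarAlgebra.adjoin_le ?_
    rintro _ ⟨f, rfl⟩
    exact ⟨toCrossedProduct γ μ f, h f, rfl⟩
  refine NonUnitalStarAlgHom.ext fun c => ?_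
  refine eq_of_forall_dist_le fun ε hε => ?_
  have hc : c.1 ∈ closure
      (NonUnitalStarAlgebra.adjoin ℂ (Set.range (universalRep γ μ)) :
        Set (UniversalAlgebra γ)) := c.2
  obtain ⟨c', hc', hd⟩ := Metric.mem_closure_iff.1 hc (ε / 2) (half_pos hε)
  obtain ⟨d, hd', rfl⟩ := hadj hc'
  have hd' : φ d = ψ d := hd'
  have hn : ‖c - d‖ < ε / 2 := by
    rw [dist_eq_norm] at hd
    exact hd
  -- The two maps agree at d and are contractive, so their values at c differ by at most 2‖c − d‖ <
  -- ε.
  have h1 : φ c - ψ c = φ (c - d) - ψ (c - d) := by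
    rw [map_sub, map_sub, hd']
    abel
  rw [dist_eq_norm, h1]
  have h2 := norm_sub_le (φ (c - d)) (ψ (c - d))
  have h3 := NonUnitalStarAlgHom.norm_apply_le φ (c - d)
  have h4 := NonUnitalStarAlgHom.norm_apply_le ψ (c - d)
  linarith

end CrossedProductExt

/-! ### The representation of K/N defined by an extension -/

section Induced

variable {G A : Type u} [Group G] [TopologicalSpace G] [IsTopologicalGroup G]
  [LocallyCompactSpace G] [T2Space G] [MeasurableSpace G] [BorelSpace G] [NonUnitalCStarAlgebra A]
  {α : G →* (A ≃⋆ₐ[ℂ] A)} (hα : IsContinuousAction α)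
  {N : Subgroup G} [hN : IsClosed (N : Set G)] [N.Normal] {K : Subgroup G} (hNK : N ≤ K)
  (μG : Measure G) [μG.IsHaarMeasure] [μG.Regular]
  (μN : Measure N) [μN.IsHaarMeasure] [μN.Regular]
  (σ : CovRep (α.comp N.subtype))
  {V : K →* unitary (σ.H →L[ℂ] σ.H)} (hV : IsCovariant (α.comp K.subtype) σ.π V)
  (hVN : ∀ n : N, V ⟨n, hNK n.2⟩ = σ.U n)

/-- E(x, y) sends z to x ⊗ y^* z, and the vectors y^* z have dense span in H; continuity of
`creation` x then puts every x ⊗ h in the closure. -/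
lemma greenInd_nondegenerate :
    (Submodule.span ℂ {v : GreenSpace hα μG μN σ | ∃ (c : CrossedProduct (alphaLt α N) μG)
      (w : GreenSpace hα μG μN σ), greenInd hα μG μN σ c w = v}).topologicalClosure = ⊤ := by
  set S := Submodule.span ℂ {v : GreenSpace hα μG μN σ | ∃ (c : CrossedProduct (alphaLt α N) μG)
      (w : GreenSpace hα μG μN σ), greenInd hα μG μN σ c w = v}
  rw [eq_top_iff, ← span_creation_dense hα μG μN σ]
  refine Submodule.topologicalClosure_minimal _ (Submodule.span_le.2 ?_)
    (Submodule.isClosed_topologicalClosure _)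
  rintro _ ⟨x, h, rfl⟩
  have hle : (Submodule.span ℂ {v : σ.H | ∃ (y : C_c(G, A)) (z : GreenSpace hα μG μN σ),
      (creation hα μG μN σ y).adjoint z = v}).topologicalClosure ≤
        S.topologicalClosure.comap (creation hα μG μN σ x).toLinearMap := by
    refine Submodule.topologicalClosure_minimal _ (Submodule.span_le.2 ?_)
      ((Submodule.isClosed_topologicalClosure _).preimage (creation hα μG μN σ x).continuous)
    rintro _ ⟨y, z, rfl⟩
    refine Submodule.le_topologicalClosure _ (Submodule.subset_span
      ⟨toCrossedProduct (alphaLt α N) μG (leftInner hα μN x y), z, ?_⟩)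
    rw [greenInd_leftInner]
    rfl
  rw [span_adjoint_creation_dense] at hle
  exact hle (Submodule.mem_top (x := h))

include hV in
lemma extension_apply_π (k : K) (a : A) (h : σ.H) :
    (V k : σ.H →L[ℂ] σ.H) (σ.π a h) = σ.π (α (k : G) a) ((V k : σ.H →L[ℂ] σ.H) h) :=
  CovRep.U_π (⟨σ.H, σ.π, V, hV⟩ : CovRep (α.comp K.subtype)) k a h

include hVN in
-- V is multiplicative on k(k⁻¹nk) = nk and restricts to U on N; this is the relation `hV` required
-- by `form_rightTransl`.
lemma extension_apply_U (k : K) (n : N) (h : σ.H) :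
    (V k : σ.H →L[ℂ] σ.H) ((σ.U (conjEquiv N (k : G) n) : σ.H →L[ℂ] σ.H) h) =
      (σ.U n : σ.H →L[ℂ] σ.H) ((V k : σ.H →L[ℂ] σ.H) h) := by
  have hk : k * ⟨_, hNK (conjEquiv N (k : G) n).2⟩ = ⟨n, hNK n.2⟩ * k := by
    ext
    change (k : G) * ((k : G)⁻¹ * n * k) = n * k
    group
  have h1 : V k * σ.U (conjEquiv N (k : G) n) = σ.U n * V k :=
    (congrArg (fun W => V k * W) (hVN (conjEquiv N (k : G) n)).symm).trans
      ((V.map_mul k _).symm.trans ((congrArg V hk).trans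
        ((V.map_mul _ k).trans (congrArg (fun W => W * V k) (hVN n)))))
  exact congrArg (fun W : unitary (σ.H →L[ℂ] σ.H) => (W : σ.H →L[ℂ] σ.H) h) h1

include hV hVN in
lemma form_extension (k : K) (v w : C_c(G, A) ⊗[ℂ] σ.H) :
    form μG μN σ
      (greenVecLift hα σ (TensorProduct.map (rightTransl N (k : G))
        (V k : σ.H →L[ℂ] σ.H).toLinearMap v))
      (greenVecLift hα σ (TensorProduct.map (rightTransl N (k : G))
        (V k : σ.H →L[ℂ] σ.H).toLinearMap w)) =
    form μG μN σ (greenVecLift hα σ v) (greenVecLift hα σ w) :=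
  form_rightTransl μG μN σ (k : G) (V k) (extension_apply_U hNK σ hVN k)
    (Unitary.inner_map_map (V k)) _ _ _ _
    (greenVecLift_rightTransl hα σ (k : G) (V k) (extension_apply_π σ hV k) v)
    (greenVecLift_rightTransl hα σ (k : G) (V k) (extension_apply_π σ hV k) w)

include hV hVN in
lemma GreenPre.norm_extension_le (k : K) (v : C_c(G, A) ⊗[ℂ] σ.H) :
    ‖GreenPre.of hα μG μN σ (TensorProduct.map (rightTransl N (k : G))
      (V k : σ.H →L[ℂ] σ.H).toLinearMap v)‖ ≤ 1 * ‖GreenPre.of hα μG μN σ v‖ := by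
  rw [one_mul]
  refine le_of_sq_le_sq (le_of_eq ?_) (norm_nonneg _)
  exact (GreenPre.norm_of_sq hα μG μN σ _).trans
    ((congrArg Complex.re (form_extension hα hNK μG μN σ hV hVN k v v)).trans
      (GreenPre.norm_of_sq hα μG μN σ v).symm)

/-- The operator `x ⊗ h ↦ (x · k) ⊗ V_k h`. -/
def extensionOp (k : K) : GreenSpace hα μG μN σ →L[ℂ] GreenSpace hα μG μN σ :=
  ContinuousLinearMap.completion (LinearMap.mkContinuous
    (show GreenPre hα μG μN σ →ₗ[ℂ] GreenPre hα μG μN σ from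
      { toFun := fun v => GreenPre.of hα μG μN σ (TensorProduct.map (rightTransl N (k : G))
          (V k : σ.H →L[ℂ] σ.H).toLinearMap v)
        map_add' := fun v w => (TensorProduct.map (rightTransl N (k : G))
          (V k : σ.H →L[ℂ] σ.H).toLinearMap).map_add v w
        map_smul' := fun c v => (TensorProduct.map (rightTransl N (k : G))
          (V k : σ.H →L[ℂ] σ.H).toLinearMap).map_smul c v }) 1
      (GreenPre.norm_extension_le hα hNK μG μN σ hV hVN k))

lemma extensionOp_of (k : K) (v : C_c(G, A) ⊗[ℂ] σ.H) :
    extensionOp hα hNK μG μN σ hV hVN k (GreenSpace.of hα μG μN σ v) =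
      GreenSpace.of hα μG μN σ (TensorProduct.map (rightTransl N (k : G))
        (V k : σ.H →L[ℂ] σ.H).toLinearMap v) :=
  ContinuousLinearMap.completion_apply_coe _ _

lemma extensionOp_creation (k : K) (x : C_c(G, A)) (h : σ.H) :
    extensionOp hα hNK μG μN σ hV hVN k (creation hα μG μN σ x h) =
      creation hα μG μN σ (rightTransl N (k : G) x) ((V k : σ.H →L[ℂ] σ.H) h) :=
  extensionOp_of hα hNK μG μN σ hV hVN k _

lemma extensionOp_mul (k l : K) : extensionOp hα hNK μG μN σ hV hVN (k * l) =
    extensionOp hα hNK μG μN σ hV hVN k * extensionOp hα hNK μG μN σ hV hVN l := by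
  refine GreenSpace.ext_creation hα μG μN σ fun x h => ?_
  refine (extensionOp_creation hα hNK μG μN σ hV hVN (k * l) x h).trans ?_
  refine Eq.trans ?_ (congrArg (extensionOp hα hNK μG μN σ hV hVN k)
    (extensionOp_creation hα hNK μG μN σ hV hVN l x h)).symm
  refine Eq.trans ?_ (extensionOp_creation hα hNK μG μN σ hV hVN k _ _).symm
  exact congrArg₂ (fun y v => creation hα μG μN σ y v) (rightTransl_mul (k : G) (l : G) x)
    (congrArg (fun W : unitary (σ.H →L[ℂ] σ.H) => (W : σ.H →L[ℂ] σ.H) h) (V.map_mul k l))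

/-- V_n = U_n and tensors are balanced over N, so the representation of K factors through K/N. -/
lemma extensionOp_coe (n : N) : extensionOp hα hNK μG μN σ hV hVN ⟨n, hNK n.2⟩ = 1 := by
  refine GreenSpace.ext_creation hα μG μN σ fun x h => ?_
  rw [extensionOp_creation, hVN, creation_rightTransl_coe]
  rfl

lemma extensionOp_one : extensionOp hα hNK μG μN σ hV hVN 1 = 1 :=
  extensionOp_coe hα hNK μG μN σ hV hVN 1

lemma inner_extensionOp (k : K) (z w : GreenSpace hα μG μN σ) :
    inner ℂ (extensionOp hα hNK μG μN σ hV hVN k z) (extensionOp hα hNK μG μN σ hV hVN k w) =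
      inner ℂ z w := by
  refine GreenSpace.induction hα μG μN σ z (isClosed_eq
    ((extensionOp hα hNK μG μN σ hV hVN k).continuous.inner continuous_const)
    (continuous_id'.inner continuous_const)) fun v => ?_
  refine GreenSpace.induction hα μG μN σ w (isClosed_eq
    (continuous_const.inner (extensionOp hα hNK μG μN σ hV hVN k).continuous)
    (continuous_const.inner continuous_id')) fun v' => ?_
  rw [extensionOp_of, extensionOp_of, GreenSpace.inner_of_eq_form, GreenSpace.inner_of_eq_form]
  exact form_extension hα hNK μG μN σ hV hVN k v v'

lemma star_extensionOp (k : K) : star (extensionOp hα hNK μG μN σ hV hVN k) =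
    extensionOp hα hNK μG μN σ hV hVN k⁻¹ := by
  symm
  rw [ContinuousLinearMap.star_eq_adjoint, ContinuousLinearMap.eq_adjoint_iff]
  intro z w
  rw [← inner_extensionOp hα hNK μG μN σ hV hVN k (extensionOp hα hNK μG μN σ hV hVN k⁻¹ z) w,
    ← mul_apply_eq_comp, ← extensionOp_mul, mul_inv_cancel, extensionOp_one]
  rfl

/-- The unitary representation `k ↦ (x ⊗ h ↦ (x · k) ⊗ V_k h)` of `K`. -/
def extensionRep : K →* unitary (GreenSpace hα μG μN σ →L[ℂ] GreenSpace hα μG μN σ) where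
  toFun k := ⟨extensionOp hα hNK μG μN σ hV hVN k, by
    rw [Unitary.mem_iff, star_extensionOp, ← extensionOp_mul, ← extensionOp_mul, inv_mul_cancel,
      mul_inv_cancel, extensionOp_one]
    exact ⟨rfl, rfl⟩⟩
  map_one' := Subtype.ext (extensionOp_one hα hNK μG μN σ hV hVN)
  map_mul' k l := Subtype.ext (extensionOp_mul hα hNK μG μN σ hV hVN k l)

/-- The representation of `K/N` induced by `extensionRep`. -/
def extensionQuotientRep : (K ⧸ N.subgroupOf K) →*
    unitary (GreenSpace hα μG μN σ →L[ℂ] GreenSpace hα μG μN σ) :=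
  QuotientGroup.lift (N.subgroupOf K) (extensionRep hα hNK μG μN σ hV hVN) fun k hk =>
    Subtype.ext (extensionOp_coe hα hNK μG μN σ hV hVN ⟨(k : G), hk⟩)

/-- On x ⊗ h the orbit is the norm continuous family `creation` (x·k) applied to the continuous
family V_k h. -/
lemma continuous_extensionOp (z : GreenSpace hα μG μN σ) :
    Continuous fun k => extensionOp hα hNK μG μN σ hV hVN k z := by
  refine continuous_orbit_of_span_dense (extensionOp hα hNK μG μN σ hV hVN)
    (fun k v => (norm_unitary_apply (extensionRep hα hNK μG μN σ hV hVN k) v).le)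
    (span_creation_dense hα μG μN σ) ?_ z
  rintro _ ⟨x, h, rfl⟩
  simp only [extensionOp_creation]
  exact ((continuous_creation_rightTransl hα μG μN σ x).comp continuous_subtype_val).clm_apply
    (hV.continuous h)

lemma extensionOp_mulOp (k : K) (f : C₀(G ⧸ N, A)) (z : GreenSpace hα μG μN σ) :
    extensionOp hα hNK μG μN σ hV hVN k (mulOp hα μG μN σ f z) =
      mulOp hα μG μN σ (idRt A N ((k : G) : G ⧸ N) f)
        (extensionOp hα hNK μG μN σ hV hVN k z) := by
  have h : extensionOp hα hNK μG μN σ hV hVN k * mulOp hα μG μN σ f =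
      mulOp hα μG μN σ (idRt A N ((k : G) : G ⧸ N) f) *
        extensionOp hα hNK μG μN σ hV hVN k := by
    refine GreenSpace.ext_creation hα μG μN σ fun x v => ?_
    rw [mul_apply_eq_comp, mul_apply_eq_comp, extensionOp_creation]
    refine (congrArg (extensionOp hα hNK μG μN σ hV hVN k) (mulOp_tmul hα μG μN σ f x v)).trans ?_
    refine (extensionOp_creation hα hNK μG μN σ hV hVN k (leftMul f x) v).trans ?_
    rw [leftMul_rightTransl]
    exact (mulOp_tmul hα μG μN σ _ _ _).symm
  exact congrArg (fun S : GreenSpace hα μG μN σ →L[ℂ] GreenSpace hα μG μN σ => S z) h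

lemma extensionOp_translOp (k : K) (s : G) (z : GreenSpace hα μG μN σ) :
    extensionOp hα hNK μG μN σ hV hVN k (translOp hα μG μN σ s z) =
      translOp hα μG μN σ s (extensionOp hα hNK μG μN σ hV hVN k z) := by
  have h : extensionOp hα hNK μG μN σ hV hVN k * translOp hα μG μN σ s =
      translOp hα μG μN σ s * extensionOp hα hNK μG μN σ hV hVN k := by
    refine GreenSpace.ext_creation hα μG μN σ fun x v => ?_
    rw [mul_apply_eq_comp, mul_apply_eq_comp, extensionOp_creation]
    refine (congrArg (extensionOp hα hNK μG μN σ hV hVN k)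
      (translOp_tmul hα μG μN σ s x v)).trans ?_
    refine (extensionOp_creation hα hNK μG μN σ hV hVN k (leftTransl hα s x) v).trans ?_
    rw [leftTransl_rightTransl]
    exact (translOp_tmul hα μG μN σ _ _ _).symm
  exact congrArg (fun S : GreenSpace hα μG μN σ →L[ℂ] GreenSpace hα μG μN σ => S z) h

/-- The operator passes under the integral over G, commutes with left translations and twists the
coefficients by id ⊗ rt. -/
lemma extensionOp_greenInd (k : K) (f : C_c(G, C₀(G ⧸ N, A))) (z : GreenSpace hα μG μN σ) :
    extensionOp hα hNK μG μN σ hV hVN k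
      (greenInd hα μG μN σ (toCrossedProduct (alphaLt α N) μG f) z) =
    greenInd hα μG μN σ (toCrossedProduct (alphaLt α N) μG
      (mapCc (idRt A N ((k : G) : G ⧸ N)) f)) (extensionOp hα hNK μG μN σ hV hVN k z) := by
  refine ((extensionOp hα hNK μG μN σ hV hVN k).integral_comp_comm
    ((greenCovRep hα μG μN σ).integrable μG f z)).symm.trans ?_
  refine integral_congr_ae (Filter.Eventually.of_forall fun s => ?_)
  refine (extensionOp_mulOp hα hNK μG μN σ hV hVN k (f s) (translOp hα μG μN σ s z)).trans ?_
  rw [extensionOp_translOp]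
  rfl

/-- An extension of `(π, U)` to `K` makes the induced representation covariant. -/
lemma isCovariant_extensionQuotientRep : IsCovariant (betaRestrict α N μG K)
    (greenInd hα μG μN σ) (extensionQuotientRep hα hNK μG μN σ hV hVN) where
  nondegenerate := greenInd_nondegenerate hα μG μN σ
  continuous z := QuotientGroup.isOpenQuotientMap_mk.continuous_comp_iff.1
    (continuous_extensionOp hα hNK μG μN σ hV hVN z)
  covariant q c := by
    induction q using QuotientGroup.induction_on with
    | H k =>
      let W := extensionRep hα hNK μG μN σ hV hVN k
      -- Both sides of the covariance relation for fixed k are `*`-homomorphisms in c, so it is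
      -- enough to compare them on `C_c` functions.
      let φ : CrossedProduct (alphaLt α N) μG →⋆ₙₐ[ℂ]
          (GreenSpace hα μG μN σ →L[ℂ] GreenSpace hα μG μN σ) :=
        (greenInd hα μG μN σ).comp (betaRestrict α N μG K (k : K ⧸ N.subgroupOf K) :
          CrossedProduct (alphaLt α N) μG →⋆ₙₐ[ℂ] CrossedProduct (alphaLt α N) μG)
      let ψ : CrossedProduct (alphaLt α N) μG →⋆ₙₐ[ℂ]
          (GreenSpace hα μG μN σ →L[ℂ] GreenSpace hα μG μN σ) :=
        (StarAlgEquiv.toNonUnitalStarAlgHom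
          (Unitary.conjStarAlgAut ℂ (GreenSpace hα μG μN σ →L[ℂ] GreenSpace hα μG μN σ) W)).comp
            (greenInd hα μG μN σ)
      have h : φ = ψ := by
        refine crossedProduct_hom_ext (alphaLt α N) μG fun f => ?_
        refine ContinuousLinearMap.ext fun z => ?_
        -- Evaluating at W^* z puts W W^* = 1 next to z on the right.
        have h1 := extensionOp_greenInd hα hNK μG μN σ hV hVN k f
          (star (W : GreenSpace hα μG μN σ →L[ℂ] GreenSpace hα μG μN σ) z)
        have h2 : extensionOp hα hNK μG μN σ hV hVN k
            (star (W : GreenSpace hα μG μN σ →L[ℂ] GreenSpace hα μG μN σ) z) = z :=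
          congrArg (fun S : GreenSpace hα μG μN σ →L[ℂ] GreenSpace hα μG μN σ => S z)
            (Unitary.coe_mul_star_self W)
        rw [h2] at h1
        exact h1.symm
      exact congrArg (fun χ : CrossedProduct (alphaLt α N) μG →⋆ₙₐ[ℂ]
        (GreenSpace hα μG μN σ →L[ℂ] GreenSpace hα μG μN σ) => χ c) h

end Induced

end

end CDyn

/-! ### The extension theorem -/

theorem theorem3p1 {G A H : Type u} [Group G] [TopologicalSpace G] [IsTopologicalGroup G]
    [LocallyCompactSpace G] [T2Space G] [MeasurableSpace G] [BorelSpace G]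
    [NonUnitalCStarAlgebra A]
    [NormedAddCommGroup H] [InnerProductSpace ℂ H] [CompleteSpace H]
    (α : G →* (A ≃⋆ₐ[ℂ] A)) (hα : CDyn.IsContinuousAction α)
    (N K : Subgroup G) [N.Normal] [IsClosed (N : Set G)] (hK : IsClosed (K : Set G)) (hNK : N ≤ K)
    (μG : Measure G) [μG.IsHaarMeasure] [μG.Regular]
    (μN : Measure N) [μN.IsHaarMeasure] [μN.Regular]
    (π : A →⋆ₙₐ[ℂ] (H →L[ℂ] H)) (U : N →* unitary (H →L[ℂ] H))
    (hπU : CDyn.IsCovariant (α.comp N.subtype) π U) :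
    (∃ V : K →* unitary (H →L[ℂ] H), CDyn.IsCovariant (α.comp K.subtype) π V ∧
        ∀ n : N, V ⟨n, hNK n.2⟩ = U n) ↔
      ∃ T : (K ⧸ N.subgroupOf K) →*
          unitary (CDyn.GreenSpace hα μG μN ⟨H, π, U, hπU⟩ →L[ℂ]
            CDyn.GreenSpace hα μG μN ⟨H, π, U, hπU⟩),
        CDyn.IsCovariant (CDyn.betaRestrict α N μG K)
          (CDyn.greenInd hα μG μN ⟨H, π, U, hπU⟩) T := by
  constructor
  · rintro ⟨V, hV, hVN⟩
    exact ⟨_, CDyn.isCovariant_extensionQuotientRep hα hNK μG μN ⟨H, π, U, hπU⟩ hV hVN⟩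
  · rintro ⟨T, hT⟩
    exact CDyn.exists_extension_of_isCovariant hα μG μN ⟨H, π, U, hπU⟩ hNK T hT
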